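/- Let $E=\mathbf{Q}(\sqrt{-D})$ be an imaginary quadratic field of discriminant $-D$, let $p\neq 2$ be a prime ramified in $E$ (i.e. $p\mid D$), and let $E_p=E\otimes\mathbf{Q}_p$, with ring of integers $\mathfrak{O}$, conjugation $x\mapsto\bar x$, uniformizer $\varpi=\delta=\sqrt{-D}$, and absolute value normalized by $|p|=p^{-1}$. Let $$J=\begin{pmatrix}&&\delta^{-1}\\&1&\\-\delta^{-1}&&\end{pmatrix},\qquad G=\{g\in \mathrm{GL}_3(E_p): {}^t\bar g Jg=\mu(g)J,\ \mu(g)\in\mathbf{Q}_p^\times\},\qquad K=G\cap \mathrm{GL}_3(\mathfrak{O}).$$ Let $U$ and $T$ be the upper triangular unipotent and the diagonal subgroups of $G$, let $\psi$ be an additive character of $\mathbf{Q}_p$ trivial on $\mathbf{Z}_p$ but not on $p^{-1}\mathbf{Z}_p$ (for instance the standard one), and put $\chi(u)=\psi(\mathrm{tr}_{E_p/\mathbf{Q}_p}(\delta^{-1}u_{23}))$ for $u\in U$. Let $\pi$ be an irreducible admissible complex representation of $G$ which is generic, let $\Lambda\neq 0$ be a Whittaker functional, i.e. $\Lambda(\pi(u)x)=\chi(u)\Lambda(x)$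 for $u\in U$, and let $v\neq 0$ be a vector of $\pi$ fixed by $K$. (1) $\Lambda(v)\neq 0$. (2) Put $W(g)=\Lambda(\pi(g)v)/\Lambda(v)$. Let $\eta$ be an unramified character of $T$ (trivial on $T\cap K$) such that $\pi$ is a constituent of $\mathrm{ind}_B^G(\delta_B^{1/2}\eta)$, where $\delta_B(\mathrm{diag}(t_1,t_2,t_3))=|t_1/t_2|^2|t_1/t_3|$. Write $\eta(\mathrm{diag}(\tau_1\tau_2,\tau_2,\bar\tau_1^{-1}\tau_2))=\eta_1(\tau_1)\eta_2(\tau_2)$ and $\alpha_{\eta_i}=\eta_i(\varpi)$. Let $\nu_1$ be an unramified character of $\mathbf{Q}_p^\times$ and let $\alpha_{\nu_1}\in\mathbf{C}$ satisfy $\alpha_{\nu_1}^2=\nu_1(p)$ (that is, $\alpha_{\nu_1}=\tilde\nu_1(\varpi)$ for an unramified extension $\tilde\nu_1$ of $\nu_1$ to $E_p^\times$). Let $H=\{(g_1,\lambda)\in\mathrm{GL}_2(\mathbf{Q}_p)\times E_p^\times:\det g_1=\lambda\bar\lambda\}$, embedded in $G$ by $\left(\begin{pmatrix}a&b\\c&d\end{pmatrix},\lambda\right)\mapsto\begin{pmatrix}a&&b\\&\lambda&\\c&&d\end{pmatrix}$.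 Let $T_H$ be its diagonal torus, with $\delta_{B_H}(\mathrm{diag}(t_1,t_2,t_3))=|t_1/t_3|$, and let $U_2\subset H$ be the subgroup of elements $\left(\begin{pmatrix}1&*\\&1\end{pmatrix},1\right)$. Use Haar measures giving the integral points of $H$, $U_2$ and $T_H$ measure $1$, and the quotient measure on $U_2\backslash H$. Let $\mathrm{char}$ be the characteristic function of $M_3(\mathfrak{O})$ and $\Phi$ that of $\mathbf{Z}_p\oplus\mathbf{Z}_p$. Then for all $s\in\mathbf{C}$ with $|\alpha_{\nu_1}^2\alpha_{\eta_1}^{\pm1}\alpha_{\eta_2}p^{-s}|<1$ (in particular for $\mathrm{Re}(s)$ large) the following two integrals converge absolutely and $$\int_{T_H}\delta_{B_H}^{-1}(t)\,\nu_1(\mu(t))\,\mathrm{char}(t)\,W(t)\,|\mu(t)|^s\,dt=\int_{U_2\backslash H}\nu_1(\det g_1)\,\Phi((0,1)g_1)\,W(g)\,|\det g_1|^s\,dg$$ $$=\frac{1}{(1-\alpha_{\nu_1}^2\alpha_{\eta_1}\alpha_{\eta_2}p^{-s})(1-\alpha_{\nu_1}^2\alpha_{\eta_2}p^{-s})(1-\alpha_{\nu_1}^2\alpha_{\eta_1}^{-1}\alpha_{\eta_2}p^{-s})}.$$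 Moreover this is the $\nu_1$-twisted standard Langlands $L$-factor $\det\bigl(1-p^{-s}\nu_1(p)\,r(\mathrm{Frob})\mid r^{I}\bigr)^{-1}$. Here $r$ is the $6$-dimensional representation of ${}^LG=(\mathbf{C}^\times\times\mathrm{GL}_3(\mathbf{C}))\rtimes\mathrm{Gal}(E_p/\mathbf{Q}_p)$, where the nontrivial Galois element $\sigma$ acts by $(x,g)\mapsto(x\det g,\Phi_3^{-1}\,{}^tg^{-1}\Phi_3)$ and $\Phi_3$ is antidiagonal with entries $1,-1,1$, given by $$(x,g)\mapsto\mathrm{diag}\bigl(xg,\;x\det(g)\,\Phi_3\,{}^tg^{-1}\Phi_3^{-1}\bigr),\qquad \sigma\mapsto\begin{pmatrix}&\mathbf{1}_3\\\mathbf{1}_3&\end{pmatrix}.$$ The inertia group $I$ acts through $\sigma$, and $\mathrm{Frob}$ acts through the Satake parameter $(\alpha_{\eta_2},\mathrm{diag}(\alpha_{\eta_1},1,\alpha_{\eta_1}^{-1}))$, which is the parameter attached to $\eta$ by the local Langlands correspondence for $T$. -/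

import Mathlib

open Matrix MeasureTheory
open scoped ENNReal

noncomputable section

namespace GU21

/-- `d` is a fundamental discriminant (of a quadratic field). -/
def IsFundamentalDiscriminant (d : ℤ) : Prop :=
  (d % 4 = 1 ∧ Squarefree d) ∨ ∃ m : ℤ, d = 4 * m ∧ Squarefree m ∧ (m % 4 = 2 ∨ m % 4 = 3)

/-- The completion `E_p = E ⊗ ℚ_p` of the imaginary quadratic field `E = ℚ(√-D)` of discriminant
`-D` at a prime `p` ramified in `E` (that is, `p ∣ D`). It is the field `E_p = ℚ_p(δ)` with
`δ² = -D`, normed by the (unique) extension of the absolute value of `ℚ_p` with `|p| = p⁻¹`;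
`conj` is its nontrivial automorphism over `ℚ_p`. The ring of integers is `{x | ‖x‖ ≤ 1}`. -/
structure RamifiedCompletion (p : ℕ) [Fact p.Prime] (E : Type*) [NormedField E]
    [NormedAlgebra ℚ_[p] E] where
  D : ℕ
  disc : IsFundamentalDiscriminant (-(D : ℤ))
  dvd : p ∣ D
  δ : E
  δ_sq : δ ^ 2 = -(D : E)
  gen : ∀ x : E, ∃ a b : ℚ_[p], x = algebraMap ℚ_[p] E a + algebraMap ℚ_[p] E b * δ
  conj : E ≃ₐ[ℚ_[p]] E
  conj_δ : conj δ = -δ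

/-- The diagonal matrix with the given invertible entries. -/
def diagGL {n R : Type*} [Fintype n] [DecidableEq n] [CommRing R] (d : n → Rˣ) : GL n R :=
  ⟨diagonal fun i => (d i : R), diagonal fun i => ((d i)⁻¹ : Rˣ),
    by simp [diagonal_mul_diagonal], by simp [diagonal_mul_diagonal]⟩

theorem diagGL_one {n R : Type*} [Fintype n] [DecidableEq n] [CommRing R] :
    diagGL (1 : n → Rˣ) = 1 := by
  ext1; simp [diagGL]

theorem diagGL_mul {n R : Type*} [Fintype n] [DecidableEq n] [CommRing R] (d e : n → Rˣ) :
    diagGL (d * e) = diagGL d * diagGL e := by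
  ext1; simp [diagGL, diagonal_mul_diagonal]

theorem diagGL_inv {n R : Type*} [Fintype n] [DecidableEq n] [CommRing R] (d : n → Rˣ) :
    diagGL d⁻¹ = (diagGL d)⁻¹ := by
  rw [eq_inv_iff_mul_eq_one, ← diagGL_mul, inv_mul_cancel, diagGL_one]

/-- `GL_n` of the ring of integers `{x | ‖x‖ ≤ 1}` of a nonarchimedean field. -/
def integralGL (n A : Type*) [Fintype n] [DecidableEq n] [NormedField A] [IsUltrametricDist A] :
    Subgroup (GL n A) where
  carrier := {g | ∀ i j, ‖g.val i j‖ ≤ 1 ∧ ‖(g⁻¹).val i j‖ ≤ 1}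
  one_mem' := by
    have h : ∀ i j, ‖(1 : Matrix n n A) i j‖ ≤ 1 := by
      intro i j
      by_cases hij : i = j <;> simp [Matrix.one_apply, hij]
    exact fun i j => ⟨by simpa using h i j, by simpa using h i j⟩
  mul_mem' := by
    have h : ∀ M N : Matrix n n A, (∀ i j, ‖M i j‖ ≤ 1) → (∀ i j, ‖N i j‖ ≤ 1) →
        ∀ i j, ‖(M * N) i j‖ ≤ 1 := by
      intro M N hM hN i j
      rw [Matrix.mul_apply]
      refine IsUltrametricDist.norm_sum_le_of_forall_le_of_nonneg zero_le_one fun k _ => ?_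
      rw [norm_mul]
      exact mul_le_one₀ (hM i k) (norm_nonneg _) (hN k j)
    intro a b ha hb i j
    refine ⟨?_, ?_⟩
    · rw [Units.val_mul]
      exact h _ _ (fun i j => (ha i j).1) (fun i j => (hb i j).1) i j
    · rw [_root_.mul_inv_rev, Units.val_mul]
      exact h _ _ (fun i j => (hb i j).2) (fun i j => (ha i j).2) i j
  inv_mem' := by
    intro a ha i j
    exact ⟨(ha i j).2, by rw [inv_inv]; exact (ha i j).1⟩

variable {p : ℕ} [Fact p.Prime] {E : Type*} [NormedField E] [NormedAlgebra ℚ_[p] E]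
variable (F : RamifiedCompletion p E)

namespace RamifiedCompletion

theorem D_ne_zero : F.D ≠ 0 := by
  intro h
  have := F.disc
  rw [h] at this
  rcases this with ⟨h1, _⟩ | ⟨m, h1, h2, _⟩
  · simp at h1
  · have : m = 0 := by simp at h1; omega
    subst this
    exact not_squarefree_zero h2

theorem δ_ne_zero : F.δ ≠ 0 := by
  intro h
  have h1 := F.δ_sq
  have : CharZero E := charZero_of_injective_algebraMap (algebraMap ℚ_[p] E).injective
  rw [h] at h1
  have h2 : (F.D : E) = 0 := by
    have : (0 : E) = -(F.D : E) := by simpa using h1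
    simpa using this.symm
  exact F.D_ne_zero (by exact_mod_cast h2)

theorem conj_conj (x : E) : F.conj (F.conj x) = x := by
  obtain ⟨a, b, rfl⟩ := F.gen x
  simp [F.conj_δ]

theorem mul_conj_mem (x : E) : ∃ m : ℚ_[p], x * F.conj x = algebraMap ℚ_[p] E m := by
  obtain ⟨a, b, rfl⟩ := F.gen x
  refine ⟨a ^ 2 + F.D * b ^ 2, ?_⟩
  have h := F.δ_sq
  simp only [map_add, map_mul, AlgEquiv.commutes, F.conj_δ, map_pow, map_natCast]
  linear_combination (-(algebraMap ℚ_[p] E b) ^ 2) * h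

/-- The uniformizer `ϖ = δ` as a unit of `E_p`. -/
def ϖ : Eˣ := Units.mk0 F.δ F.δ_ne_zero

/-- Conjugation on `E_p^×`. -/
def conjU : Eˣ →* Eˣ := Units.map (F.conj : E →* E)

@[simp] theorem val_conjU (x : Eˣ) : ((F.conjU x : Eˣ) : E) = F.conj x := rfl

/-- The Hermitian form `J`. -/
def J : Matrix (Fin 3) (Fin 3) E := !![0, 0, F.δ⁻¹; 0, 1, 0; -F.δ⁻¹, 0, 0]

/-- The conjugate transpose of a matrix over `E_p`. -/
def star (g : Matrix (Fin 3) (Fin 3) E) : Matrix (Fin 3) (Fin 3) E := (g.map F.conj)ᵀ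

theorem star_mul (g h : Matrix (Fin 3) (Fin 3) E) : F.star (g * h) = F.star h * F.star g := by
  rw [star, star, star, ← Matrix.transpose_mul]
  congr 1
  exact Matrix.map_mul (f := (F.conj : E →+* E))

theorem star_one : F.star 1 = 1 := by
  simp [star]

/-- The unitary similitude group `G = GU(J)(ℚ_p)`. -/
def G : Subgroup (GL (Fin 3) E) where
  carrier := {g | ∃ m : ℚ_[p]ˣ, F.star g.val * F.J * g.val = (m : ℚ_[p]) • F.J}
  one_mem' := ⟨1, by simp [star_one]⟩
  mul_mem' := by
    rintro g h ⟨m, hm⟩ ⟨n, hn⟩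
    refine ⟨m * n, ?_⟩
    calc F.star (g * h).val * F.J * (g * h).val
        = F.star h.val * (F.star g.val * F.J * g.val) * h.val := by
          simp only [Units.val_mul, star_mul, Matrix.mul_assoc]
      _ = _ := by
          rw [hm, Matrix.mul_smul, Matrix.smul_mul, hn, smul_smul, Units.val_mul]
  inv_mem' := by
    rintro g ⟨m, hm⟩
    refine ⟨m⁻¹, ?_⟩
    have h1 : g.val * (g⁻¹).val = 1 := by rw [← Units.val_mul]; simp
    have h2 : F.star (g⁻¹).val * F.star g.val = 1 := by rw [← star_mul, h1, star_one]
    have h3 : F.J = (m : ℚ_[p]) • (F.star (g⁻¹).val * F.J * (g⁻¹).val) := by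
      calc F.J = (F.star (g⁻¹).val * F.star g.val) * F.J * (g.val * (g⁻¹).val) := by
            rw [h1, h2]; simp
        _ = F.star (g⁻¹).val * (F.star g.val * F.J * g.val) * (g⁻¹).val := by
            simp only [Matrix.mul_assoc]
        _ = _ := by rw [hm, Matrix.mul_smul, Matrix.smul_mul]
    conv_rhs => rw [h3]
    rw [smul_smul, Units.inv_mul, one_smul]

/-- The similitude character `μ` (the `m` in the definition of `G` is unique as `J ≠ 0`). -/
def similitude (g : F.G) : ℚ_[p]ˣ := g.2.choose

/-- The matrix of an element of `G`. -/
abbrev mat (g : F.G) : Matrix (Fin 3) (Fin 3) E := g.1.val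

/-- The special maximal compact subgroup `K = G(ℤ_p)`, the intersection of `G` with `GL₃(𝔒)`
(its elements `g` have `μ(g) ∈ ℤ_p^×` since the cube of `μ(g)` is the norm of `det g`). -/
def K : Subgroup F.G :=
  haveI : IsUltrametricDist E := IsUltrametricDist.of_normedAlgebra ℚ_[p]
  (integralGL (Fin 3) E).subgroupOf F.G

/-- The unipotent radical `U = U_B(ℚ_p)` of the upper triangular Borel subgroup, as a set. -/
def U : Set F.G := {u | (∀ i, F.mat u i i = 1) ∧ ∀ i j, j < i → F.mat u i j = 0}

/-- The diagonal torus `T` of `G`. -/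
def T : Subgroup F.G where
  carrier := {t | ∃ d : Fin 3 → Eˣ, t.1 = diagGL d}
  one_mem' := ⟨1, by rw [diagGL_one]; rfl⟩
  mul_mem' := by
    rintro a b ⟨d, hd⟩ ⟨e, he⟩
    exact ⟨d * e, by rw [diagGL_mul, ← hd, ← he]; rfl⟩
  inv_mem' := by
    rintro a ⟨d, hd⟩
    exact ⟨d⁻¹, by rw [diagGL_inv, ← hd]; rfl⟩

theorem diagGL_mem_G (d : Fin 3 → Eˣ) (h1 : F.conj (d 0) * d 2 = F.conj (d 1) * d 1) :
    diagGL d ∈ F.G := by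
  obtain ⟨m, hm⟩ := F.mul_conj_mem (d 1)
  have hm0 : m ≠ 0 := by
    rintro rfl
    exact (d 1 * F.conjU (d 1)).ne_zero (by rw [Units.val_mul, val_conjU, hm, map_zero])
  have h2 : F.conj (d 2) * d 0 = F.conj (d 1) * d 1 := by
    have := congrArg F.conj h1
    simp only [map_mul, F.conj_conj] at this
    linear_combination this
  refine ⟨Units.mk0 m hm0, ?_⟩
  rw [mul_comm] at hm
  ext i j
  fin_cases i <;> fin_cases j <;>
    simp [diagGL, star, J, Matrix.mul_apply, Fin.sum_univ_three, Matrix.diagonal,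
      Algebra.smul_def, ← hm]
  · linear_combination F.δ⁻¹ * h1
  · linear_combination F.δ⁻¹ * h2

/-- The element `diag(t₁, t₂, t₃)` of `T`, for `conj t₁ * t₃ = conj t₂ * t₂`. -/
def torusElt (t₁ t₂ t₃ : Eˣ) (h : F.conjU t₁ * t₃ = F.conjU t₂ * t₂) : F.T :=
  ⟨⟨diagGL ![t₁, t₂, t₃], F.diagGL_mem_G _ (by simpa using congrArg Units.val h)⟩, _, rfl⟩

/-- The entry `t_i` of an element of `T`. -/
def entry (t : F.T) (i : Fin 3) : E := F.mat t i i

/-- The modulus character `δ_B(t) = |t₁/t₂|² |t₁/t₃|` of the Borel subgroup of `G`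
(`E_p` has the absolute value with `|p| = p⁻¹`). -/
def modulusB (t : F.T) : ℝ :=
  ‖F.entry t 0 / F.entry t 1‖ ^ 2 * ‖F.entry t 0 / F.entry t 2‖

/-- A character of `T` is unramified if it is trivial on `T ∩ K`. -/
def IsUnramified (η : F.T →* ℂˣ) : Prop := ∀ t : F.T, (t : F.G) ∈ F.K → η t = 1

/-- The character `η₁` of `E_p^×`, where
`η(diag(τ₁τ₂, τ₂, conj(τ₁)⁻¹τ₂)) = η₁(τ₁) η₂(τ₂)`. -/
def eta₁ (η : F.T →* ℂˣ) (τ : Eˣ) : ℂˣ :=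
  η (F.torusElt τ 1 (F.conjU τ)⁻¹ (by simp))

/-- The character `η₂` of `E_p^×`, where
`η(diag(τ₁τ₂, τ₂, conj(τ₁)⁻¹τ₂)) = η₁(τ₁) η₂(τ₂)`. -/
def eta₂ (η : F.T →* ℂˣ) (τ : Eˣ) : ℂˣ :=
  η (F.torusElt τ τ τ rfl)

/-! ### Representations of `G` -/

section Representations

variable {V : Type*} [AddCommGroup V] [Module ℂ V]

/-- Smooth representations: every vector has an open stabilizer. -/
def IsSmooth (π : Representation ℂ F.G V) : Prop := ∀ v : V, IsOpen {g : F.G | π g v = v}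

/-- Admissible representations: smooth, with finite-dimensional spaces of invariants under all
open subgroups. -/
def IsAdmissible (π : Representation ℂ F.G V) : Prop :=
  F.IsSmooth π ∧ ∀ K' : Subgroup F.G, IsOpen (K' : Set F.G) →
    FiniteDimensional ℂ (Representation.invariants (π.comp K'.subtype))

/-- The character `χ(u) = ψ(tr(δ⁻¹ u₂₃))` of `U`. -/
def chi (ψ : AddChar ℚ_[p] ℂ) (u : F.G) : ℂ :=
  ψ (Algebra.trace ℚ_[p] E (F.δ⁻¹ * F.mat u 1 2))

/-- `Λ` is a (nonzero) Whittaker functional. -/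
def IsWhittaker (ψ : AddChar ℚ_[p] ℂ) (π : Representation ℂ F.G V) (Λ : V →ₗ[ℂ] ℂ) : Prop :=
  Λ ≠ 0 ∧ ∀ u ∈ F.U, ∀ v : V, Λ (π u v) = F.chi ψ u * Λ v

/-- The normalized Whittaker function `W(g) = Λ(π(g)v) / Λ(v)`. -/
def whittaker (π : Representation ℂ F.G V) (Λ : V →ₗ[ℂ] ℂ) (v : V) (g : F.G) : ℂ :=
  Λ (π g v) / Λ v

/-- Right translation of functions on `G`. -/
def rightReg : Representation ℂ F.G (F.G → ℂ) where
  toFun g := LinearMap.funLeft ℂ ℂ (fun x => x * g)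
  map_one' := by ext; simp
  map_mul' g h := by ext; simp [mul_assoc]

/-- The normalized principal series `ind_B^G(δ_B^{1/2} η)`: functions `f` on `G` which are
right invariant under some open subgroup and satisfy `f(tug) = δ_B(t)^{1/2} η(t) f(g)`
for `t ∈ T`, `u ∈ U`, acted on by right translation. -/
def ind (η : F.T →* ℂˣ) : Subrepresentation F.rightReg where
  toSubmodule :=
    { carrier := {f | (∀ t : F.T, ∀ u ∈ F.U, ∀ g : F.G,
          f (t * u * g) = (Real.sqrt (F.modulusB t) : ℂ) * η t * f g) ∧
        ∃ K' : Subgroup F.G, IsOpen (K' : Set F.G) ∧ ∀ g, ∀ k ∈ K', f (g * k) = f g}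
      zero_mem' := ⟨by simp, ⊤, by simp, by simp⟩
      add_mem' := by
        rintro f f' ⟨h, K₁, hK₁, hk₁⟩ ⟨h', K₂, hK₂, hk₂⟩
        refine ⟨fun t u hu g => ?_, K₁ ⊓ K₂, hK₁.inter hK₂, fun g k hk => ?_⟩
        · simp only [Pi.add_apply, h t u hu g, h' t u hu g]; ring
        · simp only [Pi.add_apply, hk₁ g k hk.1, hk₂ g k hk.2]
      smul_mem' := by
        rintro c f ⟨h, K₁, hK₁, hk₁⟩
        refine ⟨fun t u hu g => ?_, K₁, hK₁, fun g k hk => ?_⟩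
        · simp only [Pi.smul_apply, smul_eq_mul, h t u hu g]; ring
        · simp only [Pi.smul_apply, hk₁ g k hk] }
  apply_mem_toSubmodule := by
    rintro g f ⟨h, K₁, hK₁, hk₁⟩
    refine ⟨fun t u hu x => ?_, K₁.comap (MulAut.conj g⁻¹).toMonoidHom, ?_, fun x k hk => ?_⟩
    · change f (t * u * x * g) = _ * f (x * g)
      rw [mul_assoc (t * u : F.G), h t u hu]
    · exact hK₁.preimage (f := fun k => g⁻¹ * k * (g⁻¹)⁻¹) (by fun_prop)
    · change f (x * k * g) = f (x * g)
      have := hk₁ (x * g) (g⁻¹ * k * (g⁻¹)⁻¹) hk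
      rw [← this]
      congr 1
      group

/-- `π` is a constituent (a quotient of a subrepresentation) of `ind_B^G(δ_B^{1/2} η)`. -/
def IsConstituent (η : F.T →* ℂˣ) (π : Representation ℂ F.G V) : Prop :=
  ∃ M : Subrepresentation F.rightReg, M ≤ F.ind η ∧
    ∃ A : Representation.IntertwiningMap M.toRepresentation π, Function.Surjective A

end Representations

/-! ### The subgroup `H` and the local integrals -/

/-- `H = {(g₁, λ) ∈ GL₂(ℚ_p) × E_p^× : det g₁ = Nm(λ)}`. -/
def H : Subgroup (GL (Fin 2) ℚ_[p] × Eˣ) where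
  carrier := {h | algebraMap ℚ_[p] E h.1.val.det = h.2 * F.conj h.2}
  one_mem' := by simp
  mul_mem' := by
    intro a b ha hb
    simp only [Set.mem_ofPred_eq, Prod.fst_mul, Prod.snd_mul, Units.val_mul, det_mul, map_mul]
      at ha hb ⊢
    rw [ha, hb]; ring
  inv_mem' := by
    intro a ha
    simp only [Set.mem_ofPred_eq, Prod.fst_inv, Prod.snd_inv] at ha ⊢
    have h1 : a.1.val.det * (a.1⁻¹).val.det = 1 := by
      rw [← det_mul, ← Units.val_mul]; simp
    have h2 : algebraMap ℚ_[p] E a.1.val.det * algebraMap ℚ_[p] E (a.1⁻¹).val.det = 1 := by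
      rw [← map_mul, h1, map_one]
    rw [ha] at h2
    have h3 : (a.2 : E) * ((a.2⁻¹ : Eˣ) : E) = 1 := by simp
    have h4 : F.conj (a.2 : E) * F.conj ((a.2⁻¹ : Eˣ) : E) = 1 := by
      rw [← map_mul, h3, map_one]
    linear_combination ((a.2⁻¹ : Eˣ) : E) * F.conj ((a.2⁻¹ : Eˣ) : E) * h2
      - algebraMap ℚ_[p] E (a.1⁻¹).val.det * F.conj (a.2 : E) * F.conj ((a.2⁻¹ : Eˣ) : E) * h3
      - algebraMap ℚ_[p] E (a.1⁻¹).val.det * h4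

/-- The matrix with rows `(a, 0, b)`, `(0, l, 0)`, `(c, 0, d)`. -/
def embMat (A : Matrix (Fin 2) (Fin 2) ℚ_[p]) (l : E) : Matrix (Fin 3) (Fin 3) E :=
  !![algebraMap ℚ_[p] E (A 0 0), 0, algebraMap ℚ_[p] E (A 0 1); 0, l, 0;
    algebraMap ℚ_[p] E (A 1 0), 0, algebraMap ℚ_[p] E (A 1 1)]

theorem embMat_mul (A B : Matrix (Fin 2) (Fin 2) ℚ_[p]) (l m : E) :
    embMat A l * embMat B m = embMat (A * B) (l * m) := by
  ext i j
  fin_cases i <;> fin_cases j <;>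
    simp [embMat, Matrix.mul_apply, Fin.sum_univ_three, Fin.sum_univ_two]

theorem embMat_one : embMat (1 : Matrix (Fin 2) (Fin 2) ℚ_[p]) (1 : E) = 1 := by
  ext i j
  fin_cases i <;> fin_cases j <;> simp [embMat]

/-- The embedding of `GL₂(ℚ_p) × E_p^×` in `GL₃(E_p)`. -/
def embGL : GL (Fin 2) ℚ_[p] × Eˣ →* GL (Fin 3) E where
  toFun h := ⟨embMat h.1.val h.2, embMat (h.1⁻¹).val ((h.2⁻¹ : Eˣ) : E),
    by rw [embMat_mul, ← Units.val_mul, ← Units.val_mul]; simp [embMat_one],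
    by rw [embMat_mul, ← Units.val_mul, ← Units.val_mul]; simp [embMat_one]⟩
  map_one' := by ext1; simp [embMat_one]
  map_mul' a b := by ext1; simp [embMat_mul]

theorem embGL_mem_G (h : F.H) : embGL (h : GL (Fin 2) ℚ_[p] × Eˣ) ∈ F.G := by
  obtain ⟨⟨g, l⟩, hgl⟩ := h
  have hgl' : algebraMap ℚ_[p] E g.val.det = l * F.conj l := hgl
  rw [Matrix.det_fin_two, map_sub, map_mul, map_mul] at hgl'
  refine ⟨Matrix.GeneralLinearGroup.det g, ?_⟩
  ext i j
  fin_cases i <;> fin_cases j <;>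
    simp [embGL, embMat, star, J, Matrix.mul_apply, Fin.sum_univ_three, Algebra.smul_def,
      Matrix.det_fin_two] <;>
    first
      | ring1
      | linear_combination -hgl'

/-- The embedding `ι : H → G`. -/
def iota : F.H →* F.G where
  toFun h := ⟨embGL (h : GL (Fin 2) ℚ_[p] × Eˣ), F.embGL_mem_G h⟩
  map_one' := by ext1; simp
  map_mul' a b := by ext1; simp

/-- The matrix of the first projection `h₁` of an element `h` of `H`. -/
abbrev fstMat (h : F.H) : Matrix (Fin 2) (Fin 2) ℚ_[p] := h.1.1.val

theorem fstMat_one : F.fstMat 1 = 1 := rfl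

theorem fstMat_mul (a b : F.H) : F.fstMat (a * b) = F.fstMat a * F.fstMat b := rfl

theorem fstMat_inv (a : F.H) : F.fstMat a⁻¹ = (F.fstMat a)⁻¹ :=
  Matrix.coe_units_inv a.1.1

/-- `det h₁` as an element of `ℚ_p^×`. -/
def det₁ (h : F.H) : ℚ_[p]ˣ := Matrix.GeneralLinearGroup.det h.1.1

/-- `H(ℤ_p)`, the elements `(g₁, λ)` with `g₁ ∈ GL₂(ℤ_p)` and `λ ∈ 𝔒^×`. -/
def KH : Subgroup F.H where
  carrier := {h | h.1.1 ∈ integralGL (Fin 2) ℚ_[p] ∧ ‖(h.1.2 : E)‖ = 1}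
  one_mem' := ⟨one_mem _, by simp⟩
  mul_mem' := fun ha hb => ⟨mul_mem ha.1 hb.1, by simp [ha.2, hb.2]⟩
  inv_mem' := fun ha => ⟨inv_mem ha.1, by simp [ha.2]⟩

/-- The unipotent subgroup `U₂ = {(1 *; 0 1)}` of `GL₂`, inside `H`. -/
def U₂ : Subgroup F.H where
  carrier := {h | F.fstMat h 0 0 = 1 ∧ F.fstMat h 1 0 = 0 ∧ F.fstMat h 1 1 = 1 ∧ h.1.2 = 1}
  one_mem' := by simp [fstMat_one]
  mul_mem' := by
    rintro a b ⟨h1, h2, h3, h4⟩ ⟨k1, k2, k3, k4⟩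
    simp [fstMat_mul, Matrix.mul_apply, Fin.sum_univ_two, *]
  inv_mem' := by
    rintro a ⟨h1, h2, h3, h4⟩
    simp [fstMat_inv, Matrix.inv_def, Matrix.adjugate_fin_two, Matrix.det_fin_two, *]

/-- The diagonal torus `T_H` of `H`. -/
def TH : Subgroup F.H where
  carrier := {h | F.fstMat h 0 1 = 0 ∧ F.fstMat h 1 0 = 0}
  one_mem' := by simp [fstMat_one]
  mul_mem' := by
    rintro a b ⟨h1, h2⟩ ⟨k1, k2⟩
    simp [fstMat_mul, Matrix.mul_apply, Fin.sum_univ_two, *]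
  inv_mem' := by
    rintro a ⟨h1, h2⟩
    simp [fstMat_inv, Matrix.inv_def, Matrix.adjugate_fin_two, *]

/-- The modulus character `δ_{B_H}(t) = |t₁/t₃|` of the upper triangular Borel subgroup of `H`. -/
def modulusBH (t : F.TH) : ℝ := ‖F.fstMat t 0 0 / F.fstMat t 1 1‖

open Classical in
/-- The characteristic function of `M₃(𝔒)`. -/
def charInt (g : F.G) : ℂ := if ∀ i j, ‖F.mat g i j‖ ≤ 1 then 1 else 0

/-- The integrand `δ_{B_H}⁻¹(t) ν₁(μ(t)) char(t) W(t) |μ(t)|^s` of the torus integral. -/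
def torusIntegrand (W : F.G → ℂ) (ν₁ : ℚ_[p]ˣ →* ℂˣ) (s : ℂ) (t : F.TH) : ℂ :=
  ((F.modulusBH t)⁻¹ : ℝ) * (ν₁ (F.similitude (F.iota t)) : ℂ) * F.charInt (F.iota t) *
    W (F.iota t) * ((‖(F.similitude (F.iota t) : ℚ_[p])‖ : ℝ) : ℂ) ^ s

/-- The integrand `ν₁(det g₁) Φ((0,1)g₁) W(g) |det g₁|^s` of the local Rankin-Selberg integral. -/
def zetaIntegrand (W : F.G → ℂ) (Φ : (Fin 2 → ℚ_[p]) → ℂ) (ν₁ : ℚ_[p]ˣ →* ℂˣ) (s : ℂ)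
    (h : F.H) : ℂ :=
  (ν₁ (F.det₁ h) : ℂ) * Φ (![0, 1] ᵥ* F.fstMat h) * W (F.iota h) *
    ((‖(F.det₁ h : ℚ_[p])‖ : ℝ) : ℂ) ^ s

end RamifiedCompletion

open Classical in
/-- The characteristic function of `ℤ_p ⊕ ℤ_p`. -/
def charLattice (p : ℕ) [Fact p.Prime] (x : Fin 2 → ℚ_[p]) : ℂ :=
  if ∀ i, ‖x i‖ ≤ 1 then 1 else 0

/-- The prime `p` as an element of `ℚ_p^×`. -/
def pUnit (p : ℕ) [Fact p.Prime] : ℚ_[p]ˣ :=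
  Units.mk0 (p : ℚ_[p]) (by exact_mod_cast (Fact.out : p.Prime).ne_zero)

/-- An additive character of `ℚ_p` with kernel containing `ℤ_p` but not `p⁻¹ℤ_p` (for instance
the standard one). -/
def IsUnramifiedAddChar (ψ : AddChar ℚ_[p] ℂ) : Prop :=
  (∀ x : ℚ_[p], ‖x‖ ≤ 1 → ψ x = 1) ∧ ∃ x : ℚ_[p], ‖x‖ ≤ p ∧ ψ x ≠ 1

/-- `dq` is the quotient measure on `U\H` of the Haar measures `dh` on `H` and `du` on `U`:
`∫_H f(h) dh = ∫_{U\H} ∫_U f(uh) du dq`. (The inner integral does not depend on the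
representative of the coset for right invariant `du`.) -/
def IsQuotientMeasure {H : Type*} [Group H] [MeasurableSpace H] (U : Subgroup H)
    (dh : Measure H) (du : Measure U) (dq : Measure (Quotient (QuotientGroup.rightRel U))) : Prop :=
  ∀ f : H → ℝ≥0∞, Measurable f → ∫⁻ h, f h ∂dh = ∫⁻ q, ∫⁻ u : U, f (u * q.out) ∂du ∂dq

/-! ### The `L`-group, its standard representation, and the `L`-factor -/

/-- The connected component `𝔾_m(ℂ) × GL₃(ℂ)` of the `L`-group of `G`. -/
abbrev DualConn := ℂˣ × GL (Fin 3) ℂ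

/-- The antidiagonal matrix `Φ₃` with entries `1, -1, 1`. -/
def Phi₃ : GL (Fin 3) ℂ :=
  ⟨!![0, 0, 1; 0, -1, 0; 1, 0, 0], !![0, 0, 1; 0, -1, 0; 1, 0, 0],
    by ext i j; fin_cases i <;> fin_cases j <;> simp [Matrix.mul_apply, Fin.sum_univ_three],
    by ext i j; fin_cases i <;> fin_cases j <;> simp [Matrix.mul_apply, Fin.sum_univ_three]⟩

/-- `g ↦ ᵗg⁻¹`. -/
def invTranspose : GL (Fin 3) ℂ →* GL (Fin 3) ℂ where
  toFun g := ⟨(g⁻¹).valᵀ, g.valᵀ, by rw [← transpose_mul, ← Units.val_mul]; simp,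
    by rw [← transpose_mul, ← Units.val_mul]; simp⟩
  map_one' := by ext1; simp
  map_mul' a b := Units.ext <| by
    change ((a * b)⁻¹).valᵀ = (a⁻¹).valᵀ * (b⁻¹).valᵀ
    rw [_root_.mul_inv_rev, Units.val_mul, transpose_mul]

theorem invTranspose_invTranspose (g : GL (Fin 3) ℂ) : invTranspose (invTranspose g) = g := by
  ext1
  change ((g.valᵀ)ᵀ) = g.val
  rw [transpose_transpose]

theorem Phi₃_mul_self : Phi₃ * Phi₃ = 1 := Units.ext Phi₃.mul_inv

theorem Phi₃_inv : Phi₃⁻¹ = Phi₃ := rfl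

theorem invTranspose_Phi₃ : invTranspose Phi₃ = Phi₃ := by
  ext i j
  change Phi₃.val j i = Phi₃.val i j
  fin_cases i <;> fin_cases j <;> simp [Phi₃]

theorem det_invTranspose (g : GL (Fin 3) ℂ) :
    Matrix.GeneralLinearGroup.det (invTranspose g) = (Matrix.GeneralLinearGroup.det g)⁻¹ := by
  rw [← map_inv]
  ext1
  change (g⁻¹).valᵀ.det = (g⁻¹).val.det
  rw [det_transpose]

/-- The action `(x, g) ↦ (x det g, Φ₃⁻¹ ᵗg⁻¹ Φ₃)` of the nontrivial Galois element `σ`. -/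
def dualMap : DualConn →* DualConn where
  toFun y := (y.1 * Matrix.GeneralLinearGroup.det y.2, Phi₃⁻¹ * invTranspose y.2 * Phi₃)
  map_one' := by simp
  map_mul' a b := by
    ext1
    · simp only [Prod.fst_mul, Prod.snd_mul, map_mul]
      exact mul_mul_mul_comm _ _ _ _
    · simp only [Prod.snd_mul, map_mul]
      group

theorem dualMap_dualMap (y : DualConn) : dualMap (dualMap y) = y := by
  ext1
  · simp [dualMap, det_invTranspose, mul_assoc]
  · simp only [dualMap, MonoidHom.coe_mk, OneHom.coe_mk, map_mul, invTranspose_invTranspose,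
      invTranspose_Phi₃, Phi₃_inv]
    rw [mul_assoc, mul_assoc, mul_assoc, Phi₃_mul_self, mul_one, ← mul_assoc, Phi₃_mul_self, one_mul]

/-- `dualMap` as an automorphism. -/
def dualAut : MulAut DualConn where
  toFun := dualMap
  invFun := dualMap
  left_inv := dualMap_dualMap
  right_inv := dualMap_dualMap
  map_mul' := map_mul dualMap

/-- The homomorphism from the group `{1, -1}` sending `-1` to a given involution. -/
def signHom {M : Type*} [Monoid M] (m : M) (h : m * m = 1) : ℤˣ →* M where
  toFun u := if u = 1 then 1 else m
  map_one' := by simp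
  map_mul' a b := by
    rcases Int.units_eq_one_or a with rfl | rfl <;> rcases Int.units_eq_one_or b with rfl | rfl <;>
      simp [h]

/-- The action of `Gal(E_p/ℚ_p) ≅ {1, -1}` on the connected component of the `L`-group. -/
def galAction : ℤˣ →* MulAut DualConn :=
  signHom dualAut (by ext1 y; exact dualMap_dualMap y)

/-- The (finite Galois form of the) `L`-group of `G`. -/
abbrev LGroup := DualConn ⋊[galAction] ℤˣ

/-- Block diagonal matrices. -/
def blockGL : GL (Fin 3) ℂ × GL (Fin 3) ℂ →* GL (Fin 3 ⊕ Fin 3) ℂ where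
  toFun g := ⟨fromBlocks g.1.val 0 0 g.2.val, fromBlocks (g.1⁻¹).val 0 0 (g.2⁻¹).val,
    by simp only [fromBlocks_multiply, ← Units.val_mul]; simp,
    by simp only [fromBlocks_multiply, ← Units.val_mul]; simp⟩
  map_one' := by ext1; simp
  map_mul' a b := by ext1; simp [fromBlocks_multiply]

/-- The block matrix with rows `(0, 1)`, `(1, 0)`. -/
def swapGL : GL (Fin 3 ⊕ Fin 3) ℂ :=
  ⟨fromBlocks 0 1 1 0, fromBlocks 0 1 1 0, by simp [fromBlocks_multiply],
    by simp [fromBlocks_multiply]⟩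

theorem swapGL_mul_self : swapGL * swapGL = 1 := Units.ext swapGL.mul_inv

theorem swapGL_conj (a b : GL (Fin 3) ℂ) : swapGL * blockGL (a, b) = blockGL (b, a) * swapGL := by
  ext1
  simp [swapGL, blockGL, fromBlocks_multiply]

/-- Scalar matrices. -/
def scalarGL : ℂˣ →* GL (Fin 3) ℂ := Units.map (Matrix.scalar (Fin 3)).toMonoidHom

theorem scalarGL_comm (x : ℂˣ) (g : GL (Fin 3) ℂ) : scalarGL x * g = g * scalarGL x := by
  ext1
  exact Matrix.scalar_commute (x : ℂ) (fun r => Commute.all _ r) g.val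

theorem scalarGL_mul_mul (x y : ℂˣ) (g h : GL (Fin 3) ℂ) :
    scalarGL (x * y) * (g * h) = scalarGL x * g * (scalarGL y * h) := by
  rw [map_mul, mul_assoc, mul_assoc, ← mul_assoc g, ← scalarGL_comm y g, mul_assoc]

/-- The restriction `(x, g) ↦ diag(x g, x det(g) Φ₃ ᵗg⁻¹ Φ₃⁻¹)` of the standard representation. -/
def stdRepConn : DualConn →* GL (Fin 3 ⊕ Fin 3) ℂ where
  toFun y := blockGL (scalarGL y.1 * y.2,
    scalarGL (y.1 * Matrix.GeneralLinearGroup.det y.2) * (Phi₃ * invTranspose y.2 * Phi₃⁻¹))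
  map_one' := by
    have : ((1 : GL (Fin 3) ℂ), (1 : GL (Fin 3) ℂ)) = 1 := rfl
    simp [this]
  map_mul' a b := by
    rw [← map_mul]
    congr 1
    ext1
    · exact scalarGL_mul_mul _ _ _ _
    · simp only [Prod.mk_mul_mk, Prod.fst_mul, Prod.snd_mul]
      rw [map_mul Matrix.GeneralLinearGroup.det, mul_mul_mul_comm, ← scalarGL_mul_mul, map_mul invTranspose]
      group

theorem stdRepConn_dualMap (y : DualConn) :
    stdRepConn (dualMap y) = swapGL * stdRepConn y * swapGL⁻¹ := by
  rw [eq_mul_inv_iff_mul_eq]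
  change blockGL _ * swapGL = swapGL * blockGL _
  rw [swapGL_conj]
  congr 3
  simp only [dualMap, MonoidHom.coe_mk, OneHom.coe_mk, map_mul, det_invTranspose,
    invTranspose_invTranspose, invTranspose_Phi₃, Phi₃_inv]
  have h : Matrix.GeneralLinearGroup.det Phi₃ * Matrix.GeneralLinearGroup.det Phi₃ = 1 := by
    rw [← map_mul, Phi₃_mul_self, map_one]
  have h2 : ∀ z : GL (Fin 3) ℂ, Phi₃ * (Phi₃ * z * Phi₃) * Phi₃ = z := fun z => by
    rw [mul_assoc, mul_assoc, mul_assoc, Phi₃_mul_self, mul_one, ← mul_assoc, Phi₃_mul_self,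
      one_mul]
  have h3 : ∀ a d e : ℂˣ, e * e = 1 → a * d * (e * d⁻¹ * e) = a := fun a d e he => by
    rw [mul_right_comm e, he, one_mul, mul_inv_cancel_right]
  have h4 : Matrix.GeneralLinearGroup.det (Phi₃ * y.2⁻¹ * Phi₃) =
      Matrix.GeneralLinearGroup.det Phi₃ * (Matrix.GeneralLinearGroup.det y.2)⁻¹ *
        Matrix.GeneralLinearGroup.det Phi₃ := by
    simp only [map_mul, map_inv]
  rw [h2]
  simp only [← map_mul, ← map_inv]
  simp only [h4, h3 _ _ _ h]

/-- The standard representation `r` of the `L`-group, of dimension `6`; `σ` acts by the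
interchange of the two blocks. -/
def stdRep : LGroup →* GL (Fin 3 ⊕ Fin 3) ℂ :=
  SemidirectProduct.lift stdRepConn (signHom swapGL swapGL_mul_self) (by
    intro u
    rcases Int.units_eq_one_or u with rfl | rfl
    · ext1 y; simp
    · ext1 y
      simpa [signHom, galAction, dualAut] using stdRepConn_dualMap y)

namespace RamifiedCompletion

/-- The Satake parameter in the connected component of the `L`-group attached to a character `η`
of `T` by the local Langlands correspondence for tori. A cocharacter `e` of `T` over `E_p` is a
character of the dual torus, and its value at the parameter is `η(N(e(ϖ)))`, where
`N : T(E_p) → T(ℚ_p)` is the norm. With `T(E_p) = {(m; t₁, t₂, t₃)}` the norm takes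
`(m; t₁, t₂, t₃)` to the matrix with diagonal entries
`t₁ conj(m/t₃)`, `t₂ conj(m/t₂)`, `t₃ conj(m/t₁)`. -/
def satake (η : F.T →* ℂˣ) : DualConn :=
  (η (F.torusElt (F.conjU F.ϖ) (F.conjU F.ϖ) (F.conjU F.ϖ) rfl),
    diagGL ![η (F.torusElt F.ϖ 1 (F.conjU F.ϖ)⁻¹ (by simp)),
      η (F.torusElt 1 (F.ϖ / F.conjU F.ϖ) 1 (by
        ext1; simp [ϖ, F.conj_δ, F.δ_ne_zero])),
      η (F.torusElt (F.conjU F.ϖ)⁻¹ 1 F.ϖ (by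
        ext1; simp [F.conj_conj, ϖ, F.δ_ne_zero]))])

theorem torusElt_mem_K (t₁ t₂ t₃ : Eˣ) (h : F.conjU t₁ * t₃ = F.conjU t₂ * t₂)
    (h₁ : ‖(t₁ : E)‖ = 1) (h₂ : ‖(t₂ : E)‖ = 1) (h₃ : ‖(t₃ : E)‖ = 1) :
    (F.torusElt t₁ t₂ t₃ h : F.G) ∈ F.K := by
  intro i j
  change ‖diagonal (fun i => ((![t₁, t₂, t₃] i : Eˣ) : E)) i j‖ ≤ 1 ∧
    ‖diagonal (fun i => ((![t₁, t₂, t₃] i)⁻¹ : Eˣ).val) i j‖ ≤ 1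
  fin_cases i <;> fin_cases j <;> simp [h₁, h₂, h₃]

theorem torusElt_mul (t₁ t₂ t₃ : Eˣ) (h) (s₁ s₂ s₃ : Eˣ) (h') :
    F.torusElt t₁ t₂ t₃ h * F.torusElt s₁ s₂ s₃ h' =
      F.torusElt (t₁ * s₁) (t₂ * s₂) (t₃ * s₃)
        (by rw [map_mul, map_mul, mul_mul_mul_comm, h, h', mul_mul_mul_comm]) := by
  apply Subtype.ext
  apply Subtype.ext
  change diagGL _ * diagGL _ = diagGL _
  rw [← diagGL_mul]
  congr 1
  ext1 i
  fin_cases i <;> rfl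

theorem dualMap_diagGL (x : ℂˣ) (d : Fin 3 → ℂˣ) :
    dualMap (x, diagGL d) = (x * (d 0 * d 1 * d 2), diagGL ![(d 2)⁻¹, (d 1)⁻¹, (d 0)⁻¹]) := by
  ext1
  · change x * _ = x * _
    congr 1
    ext1
    simp [diagGL, Fin.prod_univ_three]
  · ext1
    change Phi₃.val * (diagonal fun i => ((d i)⁻¹ : ℂˣ).val)ᵀ * Phi₃.val = diagonal _
    ext i j
    fin_cases i <;> fin_cases j <;>
      simp [Phi₃, Matrix.mul_apply, Fin.sum_univ_three, Matrix.diagonal, Matrix.vecMul,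
        dotProduct]

/-- For unramified `η` the parameter is fixed by the Galois action. -/
theorem galAction_satake (η : F.T →* ℂˣ) (hη : F.IsUnramified η) :
    galAction (-1) (F.satake η) = F.satake η := by
  change dualMap _ = _
  have hne : ‖F.δ‖ ≠ 0 := norm_ne_zero_iff.2 F.δ_ne_zero
  have key : ∀ a b c : ℂˣ, b = 1 → a * c = 1 → ∀ x : ℂˣ,
      dualMap (x, diagGL ![a, b, c]) = (x, diagGL ![a, b, c]) := by
    intro a b c hb hac x
    subst hb
    have hc : c = a⁻¹ := eq_inv_of_mul_eq_one_right hac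
    subst hc
    rw [dualMap_diagGL]
    simp
  refine key _ _ _ ?_ ?_ _
  · exact hη _ (F.torusElt_mem_K _ _ _ _ (by simp) (by simp [ϖ, F.conj_δ, hne]) (by simp))
  · rw [← map_mul, torusElt_mul]
    exact hη _ (F.torusElt_mem_K _ _ _ _ (by simp [ϖ, F.conj_δ, hne]) (by simp)
      (by simp [ϖ, F.conj_δ, hne]))

/-- The inertial invariants of the standard representation composed with the parameter: inertia
acts through `Gal(E_p/ℚ_p)`, whose nontrivial element is mapped to `1 ⋊ σ`. -/
def inertialInvariants : Submodule ℂ (Fin 3 ⊕ Fin 3 → ℂ) where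
  carrier := {v | (stdRep (SemidirectProduct.inr (-1))).val *ᵥ v = v}
  add_mem' := by
    intro a b ha hb
    exact (Matrix.mulVec_add _ _ _).trans (congrArg₂ _ ha hb)
  zero_mem' := Matrix.mulVec_zero _
  smul_mem' := by
    intro c a ha
    exact (Matrix.mulVec_smul _ _ _).trans (congrArg _ ha)

/-- The action of Frobenius, mapped to `s ⋊ 1` by the parameter, on the inertial invariants. -/
def frobOnInvariants (s : DualConn) (hs : galAction (-1) s = s) :
    inertialInvariants →ₗ[ℂ] inertialInvariants :=
  (Matrix.mulVecLin (stdRep (SemidirectProduct.inl s)).val).restrict (by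
    intro v hv
    have h1 : (SemidirectProduct.inr (-1) : LGroup) * SemidirectProduct.inl s =
        SemidirectProduct.inl s * SemidirectProduct.inr (-1) := by
      ext1 <;> simp [hs]
    have h2 := congrArg (fun g => (stdRep g).val) h1
    simp only [map_mul, Units.val_mul] at h2
    change _ *ᵥ (_ *ᵥ v) = _ *ᵥ v
    rw [Matrix.mulVec_mulVec, h2, ← Matrix.mulVec_mulVec]
    exact congrArg _ hv)

/-- The `ν₁`-twisted standard Langlands `L`-factor
`det(1 - p^{-s} ν₁(p) r(Frob) | inertial invariants)⁻¹` attached to `η`. -/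
def langlandsLFactor (η : F.T →* ℂˣ) (hη : F.IsUnramified η) (ν₁ : ℚ_[p]ˣ →* ℂˣ) (s : ℂ) : ℂ :=
  (LinearMap.det (1 - ((p : ℂ) ^ (-s) * (ν₁ (pUnit p) : ℂ)) •
    frobOnInvariants (F.satake η) (F.galAction_satake η hη)))⁻¹

/-- The product
`1 / ((1 - α²α₁α₂p^{-s}) (1 - α²α₂p^{-s}) (1 - α²α₁⁻¹α₂p^{-s}))`, where `α₁ = η₁(ϖ)`
and `α₂ = η₂(ϖ)`. -/
def eulerFactor (η : F.T →* ℂˣ) (α s : ℂ) : ℂ :=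
  1 / ((1 - α ^ 2 * F.eta₁ η F.ϖ * F.eta₂ η F.ϖ * (p : ℂ) ^ (-s)) *
    (1 - α ^ 2 * F.eta₂ η F.ϖ * (p : ℂ) ^ (-s)) *
    (1 - α ^ 2 * (F.eta₁ η F.ϖ : ℂ)⁻¹ * F.eta₂ η F.ϖ * (p : ℂ) ^ (-s)))

end RamifiedCompletion

end GU21

end

noncomputable section

namespace GU21

namespace RamifiedCompletion

variable {p : ℕ} [Fact p.Prime] {E : Type*} [NormedField E] [NormedAlgebra ℚ_[p] E]

/-! ### The norm of `E_p` -/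

/-! Both integrals are sums over the cells `F.cell (n + j) j` of `H`, and everything reduces to the
values of the spherical Whittaker function W on the torus elements `F.tor n m`.

Since p is odd and ramified, ‖δ‖² = 1/p. Norms from ℚ_p are even powers of ‖δ‖, and norms of δℚ_p
are odd powers. This parity argument (`norm_gen`) gives the sharp estimates for entries of elements
of G on which the Iwasawa and Cartan decompositions (`iwasawa`, `cartan`) rest.

The Hecke operator of the double coset of diag(ϖ, 1, conj ϖ⁻¹) has p² + p explicit coset
representatives in Iwasawa form (`heckeRep`). The space of K-fixed vectors of π is a line
(`invariants_eq_span`), so v is an eigenvector. Applying Λ to the operator gives a three-term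
recursion for n ↦ Λ(π(`F.tor n 0`)v) with leading coefficient p² (`whittaker_recursion`), while
these values vanish for n < 0 (`whittaker_tor_neg`). If Λ(v) were 0, all values would be 0, and Λ
would vanish on the whole irreducible space (`whittaker_apply_ne_zero`).

Evaluating the same operator on a K-fixed function of the principal series identifies the eigenvalue
as p·a + p·a⁻¹ + (p - 1), where a = η₁(ϖ) (`sum_heckeRep_ind`, `hecke_of_isConstituent`). The
recursion then has the solution pⁿW(`F.tor n 0`) = hₙ(a, a⁻¹) + hₙ₋₁(a, a⁻¹), with h the complete
symmetric polynomials (`whittaker_tor_nat`). Its generating series in X is (1 + X)/((1 - aX)(1 -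
a⁻¹X)).

With X = ν₁(p)η₂(ϖ)p⁻ˢ, the cell with indices n, j contributes pⁿ·p⁻ⁿ(hₙ + hₙ₋₁)X^(n + 2j) to either
integral. The factor pⁿ is the inverse modulus in the torus integral, and the volume of the cell in
U₂\H in the other. Summation over j supplies 1/(1 - X²), and (1 + X)/(1 - X²) = 1/(1 - X) produces
the third Euler factor (`hasSum_sphericalCoeff_mul`). On the dual side inertia exchanges the two
blocks, so its invariants are a diagonal copy of ℂ³, where Frobenius acts by η₂(ϖ)·diag(a, 1, a⁻¹).
-/

theorem norm_add_le_max (_F : RamifiedCompletion p E) (x y : E) : ‖x + y‖ ≤ max ‖x‖ ‖y‖ :=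
  haveI : IsUltrametricDist E := IsUltrametricDist.of_normedAlgebra ℚ_[p]
  IsUltrametricDist.norm_add_le_max x y

theorem norm_add_le_of_le (F : RamifiedCompletion p E) {x y : E} {c : ℝ} (hx : ‖x‖ ≤ c)
    (hy : ‖y‖ ≤ c) : ‖x + y‖ ≤ c :=
  (F.norm_add_le_max x y).trans (max_le hx hy)

theorem norm_sub_le_of_le (F : RamifiedCompletion p E) {x y : E} {c : ℝ} (hx : ‖x‖ ≤ c)
    (hy : ‖y‖ ≤ c) : ‖x - y‖ ≤ c := by
  rw [sub_eq_add_neg]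
  exact F.norm_add_le_of_le hx (by rwa [norm_neg])

theorem norm_add_lt_of_lt (F : RamifiedCompletion p E) {x y : E} {c : ℝ} (hx : ‖x‖ < c)
    (hy : ‖y‖ < c) : ‖x + y‖ < c :=
  (F.norm_add_le_max x y).trans_lt (max_lt hx hy)

theorem norm_add_eq_max (_F : RamifiedCompletion p E) {x y : E} (h : ‖x‖ ≠ ‖y‖) :
    ‖x + y‖ = max ‖x‖ ‖y‖ :=
  haveI : IsUltrametricDist E := IsUltrametricDist.of_normedAlgebra ℚ_[p]
  IsUltrametricDist.norm_add_eq_max_of_norm_ne_norm h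

theorem charZero (_F : RamifiedCompletion p E) : CharZero E :=
  charZero_of_injective_algebraMap (algebraMap ℚ_[p] E).injective

theorem one_lt_p : (1 : ℝ) < p := by exact_mod_cast (Fact.out : p.Prime).one_lt

theorem p_pos : (0 : ℝ) < p := zero_lt_one.trans one_lt_p

theorem norm_two (hp : p ≠ 2) : ‖(2 : ℚ_[p])‖ = 1 := by
  have : ‖((2 : ℕ) : ℚ_[p])‖ = 1 := by
    rw [Padic.norm_natCast_eq_one_iff, (Fact.out : p.Prime).coprime_iff_not_dvd]
    intro h
    exact hp ((Nat.prime_dvd_prime_iff_eq Fact.out Nat.prime_two).1 h)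
  exact_mod_cast this

theorem norm_two_E (_F : RamifiedCompletion p E) (hp : p ≠ 2) : ‖(2 : E)‖ = 1 := by
  have := norm_algebraMap' E (2 : ℚ_[p])
  rw [norm_two hp, map_ofNat] at this
  exact this

/-- A fundamental discriminant is squarefree up to a factor 4, which is prime to p. Hence D is
exactly divisible by p and δ is a uniformizer. -/
theorem not_sq_dvd_D (F : RamifiedCompletion p E) (hp : p ≠ 2) : ¬ p * p ∣ F.D := by
  intro h
  have hpp : p.Prime := Fact.out
  have h' : (p : ℤ) * p ∣ -(F.D : ℤ) := by
    rw [dvd_neg]; exact_mod_cast h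
  have hu : ¬ IsUnit (p : ℤ) := by
    rw [Int.isUnit_iff_natAbs_eq]; simpa using hpp.one_lt.ne'
  rcases F.disc with ⟨-, h1⟩ | ⟨m, hm, h1, -⟩
  · exact hu (h1 _ h')
  · rw [hm] at h'
    refine hu (h1 _ (IsCoprime.dvd_of_dvd_mul_left ?_ h'))
    have h2 : IsCoprime (p : ℤ) 2 := by
      exact_mod_cast Nat.isCoprime_iff_coprime.2 ((Nat.coprime_primes hpp Nat.prime_two).2 hp)
    have h4 : IsCoprime (p : ℤ) 4 := by
      simpa using (h2.mul_right h2 : IsCoprime (p : ℤ) (2 * 2))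
    exact h4.mul_left h4

theorem norm_D (F : RamifiedCompletion p E) (hp : p ≠ 2) : ‖(F.D : ℚ_[p])‖ = (p : ℝ)⁻¹ := by
  obtain ⟨k, hk⟩ := F.dvd
  have hk' : ‖(k : ℚ_[p])‖ = 1 := by
    rw [Padic.norm_natCast_eq_one_iff, (Fact.out : p.Prime).coprime_iff_not_dvd]
    intro h
    exact F.not_sq_dvd_D hp (hk ▸ mul_dvd_mul_left p h)
  rw [hk, Nat.cast_mul, norm_mul, hk', mul_one, Padic.norm_p]

theorem norm_δ_sq (F : RamifiedCompletion p E) (hp : p ≠ 2) : ‖F.δ‖ ^ 2 = (p : ℝ)⁻¹ := by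
  rw [← norm_pow, F.δ_sq, norm_neg, ← F.norm_D hp, ← norm_algebraMap' E (F.D : ℚ_[p]), map_natCast]

theorem norm_δ_pos (F : RamifiedCompletion p E) : 0 < ‖F.δ‖ := norm_pos_iff.2 F.δ_ne_zero

theorem norm_δ_lt_one (F : RamifiedCompletion p E) (hp : p ≠ 2) : ‖F.δ‖ < 1 := by
  have h := F.norm_δ_sq hp
  have h1 : (p : ℝ)⁻¹ < 1 := inv_lt_one_of_one_lt₀ one_lt_p
  rw [← h] at h1
  exact (sq_lt_one_iff₀ (norm_nonneg _)).1 h1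

theorem norm_padic_eq (F : RamifiedCompletion p E) (hp : p ≠ 2) {a : ℚ_[p]} (ha : a ≠ 0) :
    ‖a‖ = ‖F.δ‖ ^ (2 * a.valuation) := by
  rw [Padic.norm_eq_zpow_neg_valuation ha, _root_.zpow_mul]
  have : ‖F.δ‖ ^ (2 : ℤ) = (p : ℝ)⁻¹ := by exact_mod_cast F.norm_δ_sq hp
  rw [this, _root_.inv_zpow, _root_.zpow_neg]

theorem norm_δ_zpow_injective (F : RamifiedCompletion p E) (hp : p ≠ 2) {m n : ℤ}
    (h : ‖F.δ‖ ^ m = ‖F.δ‖ ^ n) : m = n :=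
  zpow_right_injective₀ F.norm_δ_pos (F.norm_δ_lt_one hp).ne h

theorem norm_δ_zpow_le (F : RamifiedCompletion p E) (hp : p ≠ 2) {m n : ℤ} :
    ‖F.δ‖ ^ m ≤ ‖F.δ‖ ^ n ↔ n ≤ m :=
  zpow_le_zpow_iff_right_of_lt_one₀ F.norm_δ_pos (F.norm_δ_lt_one hp)

theorem norm_δ_zpow_lt (F : RamifiedCompletion p E) (hp : p ≠ 2) {m n : ℤ} :
    ‖F.δ‖ ^ m < ‖F.δ‖ ^ n ↔ n < m :=
  zpow_lt_zpow_iff_right_of_lt_one₀ F.norm_δ_pos (F.norm_δ_lt_one hp)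

/-- The norms of the two nonzero terms are an even and an odd power of ‖δ‖, so they differ and the
ultrametric inequality is an equality. -/
theorem norm_gen (F : RamifiedCompletion p E) (hp : p ≠ 2) (a b : ℚ_[p]) :
    ‖algebraMap ℚ_[p] E a + algebraMap ℚ_[p] E b * F.δ‖ = max ‖a‖ (‖b‖ * ‖F.δ‖) := by
  rcases eq_or_ne a 0 with rfl | ha
  · simp [norm_algebraMap']; positivity
  rcases eq_or_ne b 0 with rfl | hb
  · simp [norm_algebraMap']
  rw [F.norm_add_eq_max, norm_mul, norm_algebraMap', norm_algebraMap']
  rw [norm_mul, norm_algebraMap', norm_algebraMap', F.norm_padic_eq hp ha, F.norm_padic_eq hp hb,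
    ← zpow_add_one₀ F.norm_δ_pos.ne']
  intro h
  have := F.norm_δ_zpow_injective hp h
  omega

theorem exists_norm_eq (F : RamifiedCompletion p E) (hp : p ≠ 2) {x : E} (hx : x ≠ 0) :
    ∃ n : ℤ, ‖x‖ = ‖F.δ‖ ^ n := by
  obtain ⟨a, b, rfl⟩ := F.gen x
  rw [F.norm_gen hp]
  rcases eq_or_ne a 0 with rfl | ha
  · rcases eq_or_ne b 0 with rfl | hb
    · simp at hx
    · refine ⟨2 * b.valuation + 1, ?_⟩
      rw [F.norm_padic_eq hp hb, ← zpow_add_one₀ F.norm_δ_pos.ne', max_eq_right]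
      rw [norm_zero]; exact (zpow_pos F.norm_δ_pos _).le
  rcases eq_or_ne b 0 with rfl | hb
  · refine ⟨2 * a.valuation, ?_⟩
    rw [F.norm_padic_eq hp ha, norm_zero, zero_mul, max_eq_left]
    exact (zpow_pos F.norm_δ_pos _).le
  rw [F.norm_padic_eq hp ha, F.norm_padic_eq hp hb, ← zpow_add_one₀ F.norm_δ_pos.ne']
  rcases max_choice (‖F.δ‖ ^ (2 * a.valuation)) (‖F.δ‖ ^ (2 * b.valuation + 1)) with h | h <;>
    exact ⟨_, h⟩

theorem norm_le_δ_mul_of_lt (F : RamifiedCompletion p E) (hp : p ≠ 2) {x y : E}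
    (h : ‖x‖ < ‖y‖) : ‖x‖ ≤ ‖F.δ‖ * ‖y‖ := by
  rcases eq_or_ne x 0 with rfl | hx
  · rw [norm_zero]; positivity
  have hy : y ≠ 0 := norm_pos_iff.1 ((norm_nonneg x).trans_lt h)
  obtain ⟨m, hm⟩ := F.exists_norm_eq hp hx
  obtain ⟨n, hn⟩ := F.exists_norm_eq hp hy
  rw [hm, hn] at h ⊢
  rw [F.norm_δ_zpow_lt hp] at h
  rw [← zpow_one_add₀ F.norm_δ_pos.ne', F.norm_δ_zpow_le hp]
  omega

/-- Rounding in the value group: ‖x‖ > ‖y‖ would mean a gap of at least one power of ‖δ‖, hence two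
powers after squaring, while the hypothesis allows only one. -/
theorem norm_le_of_sq_le (F : RamifiedCompletion p E) (hp : p ≠ 2) {x y : E}
    (h : ‖F.δ‖ * ‖x‖ ^ 2 ≤ ‖y‖ ^ 2) : ‖x‖ ≤ ‖y‖ := by
  by_contra! hlt
  have h1 := F.norm_le_δ_mul_of_lt hp hlt
  have h2 := F.norm_δ_lt_one hp
  have h3 := F.norm_δ_pos
  have hx : 0 < ‖x‖ := (norm_nonneg y).trans_lt hlt
  have h4 : ‖y‖ ^ 2 ≤ (‖F.δ‖ * ‖x‖) ^ 2 := pow_le_pow_left₀ (norm_nonneg _) h1 2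
  have h5 : 0 < ‖F.δ‖ * ‖x‖ ^ 2 := by positivity
  nlinarith

theorem norm_le_δ_mul_of_sq_le (F : RamifiedCompletion p E) (hp : p ≠ 2) {x y : E}
    (h : ‖x‖ ^ 2 ≤ ‖F.δ‖ * ‖y‖ ^ 2) : ‖x‖ ≤ ‖F.δ‖ * ‖y‖ := by
  have h3 := F.norm_δ_pos
  rw [← norm_mul]
  refine F.norm_le_of_sq_le hp ?_
  rw [norm_mul, mul_pow, pow_two ‖F.δ‖, mul_assoc]
  exact mul_le_mul_of_nonneg_left h h3.le

theorem norm_conj (F : RamifiedCompletion p E) (hp : p ≠ 2) (x : E) : ‖F.conj x‖ = ‖x‖ := by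
  obtain ⟨a, b, rfl⟩ := F.gen x
  have : F.conj (algebraMap ℚ_[p] E a + algebraMap ℚ_[p] E b * F.δ) =
      algebraMap ℚ_[p] E a + algebraMap ℚ_[p] E (-b) * F.δ := by
    simp [F.conj_δ]
  rw [this, F.norm_gen hp, F.norm_gen hp, norm_neg]

theorem conj_ne_zero (F : RamifiedCompletion p E) {x : E} : F.conj x ≠ 0 ↔ x ≠ 0 := by simp

theorem exists_algebraMap_of_conj_eq (F : RamifiedCompletion p E) {x : E} (h : F.conj x = x) :
    ∃ a : ℚ_[p], x = algebraMap ℚ_[p] E a := by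
  have := F.charZero
  obtain ⟨a, b, rfl⟩ := F.gen x
  refine ⟨a, ?_⟩
  simp only [map_add, map_mul, AlgEquiv.commutes, F.conj_δ] at h
  have : 2 * (algebraMap ℚ_[p] E b * F.δ) = 0 := by linear_combination -h
  have h2 : algebraMap ℚ_[p] E b * F.δ = 0 := by simpa using this
  rw [h2, add_zero]

theorem finiteDimensional (F : RamifiedCompletion p E) : FiniteDimensional ℚ_[p] E := by
  refine Module.Finite.of_surjective
    ((LinearMap.lsmul ℚ_[p] E).flip 1 |>.coprod ((LinearMap.lsmul ℚ_[p] E).flip F.δ)) ?_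
  intro x
  obtain ⟨a, b, rfl⟩ := F.gen x
  exact ⟨(a, b), by simp [Algebra.smul_def]⟩

theorem finrank_eq_two (F : RamifiedCompletion p E) (hp : p ≠ 2) :
    Module.finrank ℚ_[p] E = 2 := by
  have hli : LinearIndependent ℚ_[p] ![(1 : E), F.δ] := by
    rw [LinearIndependent.pair_iff]
    intro a b h
    have h1 := F.norm_gen hp a b
    simp only [Algebra.smul_def, mul_one] at h
    rw [h, norm_zero] at h1
    have h2 := le_max_left ‖a‖ (‖b‖ * ‖F.δ‖)
    have h3 := le_max_right ‖a‖ (‖b‖ * ‖F.δ‖)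
    rw [← h1] at h2 h3
    refine ⟨norm_le_zero_iff.1 h2, norm_le_zero_iff.1 ?_⟩
    exact nonpos_of_mul_nonpos_left h3 F.norm_δ_pos
  have hsp : ⊤ ≤ Submodule.span ℚ_[p] (Set.range ![(1 : E), F.δ]) := by
    intro x _
    obtain ⟨a, b, rfl⟩ := F.gen x
    rw [Matrix.range_cons, Matrix.range_cons, Matrix.range_empty, Set.union_empty,
      Set.singleton_union, Submodule.mem_span_pair]
    exact ⟨a, b, by simp [Algebra.smul_def]⟩
  rw [Module.finrank_eq_card_basis (Module.Basis.mk hli hsp), Fintype.card_fin]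

theorem trace_algebraMap_eq (F : RamifiedCompletion p E) (hp : p ≠ 2) (a : ℚ_[p]) :
    Algebra.trace ℚ_[p] E (algebraMap ℚ_[p] E a) = 2 * a := by
  rw [Algebra.trace_algebraMap, F.finrank_eq_two hp, nsmul_eq_mul, Nat.cast_ofNat]

/-- Conjugation preserves the trace and negates these elements. -/
theorem trace_mul_δ (F : RamifiedCompletion p E) (b : ℚ_[p]) :
    Algebra.trace ℚ_[p] E (algebraMap ℚ_[p] E b * F.δ) = 0 := by
  have h := Algebra.trace_eq_of_algEquiv F.conj (algebraMap ℚ_[p] E b * F.δ)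
  rw [map_mul, AlgEquiv.commutes, F.conj_δ, mul_neg, map_neg] at h
  linear_combination (-1 / 2 : ℚ_[p]) * h

/-- The inverse different is δ⁻¹𝔒. The rational part of x has a norm that is an even power of ‖δ‖,
so a bound by ‖δ‖⁻¹ already makes it integral. -/
theorem norm_trace_le (F : RamifiedCompletion p E) (hp : p ≠ 2) {x : E} (hx : ‖x‖ ≤ ‖F.δ‖⁻¹) :
    ‖Algebra.trace ℚ_[p] E x‖ ≤ 1 := by
  obtain ⟨a, b, rfl⟩ := F.gen x
  rw [map_add, F.trace_algebraMap_eq hp, F.trace_mul_δ, add_zero, norm_mul, norm_two hp, one_mul]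
  rw [F.norm_gen hp] at hx
  have h := (le_max_left _ _).trans hx
  rcases eq_or_ne a 0 with rfl | ha
  · simp
  rw [F.norm_padic_eq hp ha, ← _root_.zpow_neg_one, F.norm_δ_zpow_le hp] at h
  rw [F.norm_padic_eq hp ha, ← zpow_zero ‖F.δ‖, F.norm_δ_zpow_le hp]
  omega

theorem exists_residue (_F : RamifiedCompletion p E) {a : ℚ_[p]} (ha : ‖a‖ ≤ 1) :
    ∃ n < p, ‖a - n‖ ≤ (p : ℝ)⁻¹ := by
  obtain ⟨b, rfl⟩ : ∃ b : ℤ_[p], (b : ℚ_[p]) = a := ⟨⟨a, ha⟩, rfl⟩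
  obtain ⟨n, hn, h⟩ := PadicInt.exists_mem_range b
  refine ⟨n, hn, ?_⟩
  rw [PadicInt.maximalIdeal_eq_span_p, Ideal.mem_span_singleton,
    ← pow_one (p : ℤ_[p]), ← Ideal.mem_span_singleton, ← PadicInt.norm_le_pow_iff_mem_span_pow] at h
  rw [PadicInt.norm_def, PadicInt.coe_sub, PadicInt.coe_natCast] at h
  simpa using h

theorem norm_natCast_sub_le (_F : RamifiedCompletion p E) {m n : ℕ} (hm : m < p) (hn : n < p)
    (h : ‖(m - n : ℚ_[p])‖ < 1) : m = n := by
  have h1 : ‖(((m : ℤ) - n : ℤ) : ℚ_[p])‖ < 1 := by push_cast; exact h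
  rw [Padic.norm_intCast_lt_one_iff] at h1
  have : (m : ℤ) - n = 0 := Int.eq_zero_of_abs_lt_dvd h1 (by rw [abs_lt]; omega)
  omega

/-- The extension is ramified, so its residue field is still 𝔽_p. -/
theorem exists_residue_E (F : RamifiedCompletion p E) (hp : p ≠ 2) {x : E} (hx : ‖x‖ ≤ 1) :
    ∃ n < p, ‖x - n‖ ≤ ‖F.δ‖ := by
  obtain ⟨a, b, rfl⟩ := F.gen x
  rw [F.norm_gen hp, max_le_iff] at hx
  obtain ⟨n, hn, h⟩ := F.exists_residue hx.1
  refine ⟨n, hn, ?_⟩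
  have h1 : algebraMap ℚ_[p] E a + algebraMap ℚ_[p] E b * F.δ - n =
      algebraMap ℚ_[p] E (a - n) + algebraMap ℚ_[p] E b * F.δ := by
    rw [map_sub, map_natCast]; ring
  have h3 := F.norm_δ_pos
  have h4 := F.norm_δ_lt_one hp
  rw [h1, F.norm_gen hp]
  refine max_le (h.trans ?_) ?_
  · rw [← F.norm_δ_sq hp, pow_two]
    nlinarith
  · have h5 : ‖b‖ * ‖F.δ‖ < 1 ∨ ‖b‖ * ‖F.δ‖ = 1 := lt_or_eq_of_le hx.2
    have h6 : ‖algebraMap ℚ_[p] E b * F.δ‖ = ‖b‖ * ‖F.δ‖ := by rw [norm_mul, norm_algebraMap']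
    rcases h5 with h5 | h5
    · have := F.norm_le_δ_mul_of_lt hp (x := algebraMap ℚ_[p] E b * F.δ) (y := 1)
        (by rwa [h6, norm_one])
      rwa [h6, norm_one, mul_one] at this
    -- ‖bδ‖ is an odd power of ‖δ‖ and cannot be 1.
    · exfalso
      rcases eq_or_ne b 0 with rfl | hb
      · simp at h5
      rw [F.norm_padic_eq hp hb, ← zpow_add_one₀ h3.ne', ← zpow_zero ‖F.δ‖] at h5
      have := F.norm_δ_zpow_injective hp h5
      omega

/-! ### Elements of `G` -/

/-- The inverse of the Hermitian form `J`. -/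
def Jinv (F : RamifiedCompletion p E) : Matrix (Fin 3) (Fin 3) E :=
  !![0, 0, -F.δ; 0, 1, 0; F.δ, 0, 0]

theorem J_mul_Jinv (F : RamifiedCompletion p E) : F.J * F.Jinv = 1 := by
  have := F.δ_ne_zero
  ext i j
  fin_cases i <;> fin_cases j <;> simp [J, Jinv, Matrix.mul_apply, Fin.sum_univ_three, this]

theorem Jinv_mul_J (F : RamifiedCompletion p E) : F.Jinv * F.J = 1 :=
  mul_eq_one_comm.1 F.J_mul_Jinv

/-- The element of `G` with a given matrix. -/
def ofMat (F : RamifiedCompletion p E) (M : Matrix (Fin 3) (Fin 3) E) (m : ℚ_[p]ˣ)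
    (h : F.star M * F.J * M = (m : ℚ_[p]) • F.J) : F.G :=
  have h1 : ((m⁻¹ : ℚ_[p]ˣ) : ℚ_[p]) • (F.Jinv * (F.star M * F.J)) * M = 1 := by
    rw [Matrix.smul_mul, Matrix.mul_assoc, h, Matrix.mul_smul, smul_smul, Jinv_mul_J,
      Units.inv_mul, one_smul]
  ⟨⟨M, ((m⁻¹ : ℚ_[p]ˣ) : ℚ_[p]) • (F.Jinv * (F.star M * F.J)), mul_eq_one_comm.1 h1, h1⟩, m, h⟩

theorem G_ext (F : RamifiedCompletion p E) {g h : F.G} (H : F.mat g = F.mat h) : g = h :=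
  Subtype.ext (Units.ext H)

@[simp] theorem mat_mul (F : RamifiedCompletion p E) (g h : F.G) :
    F.mat (g * h) = F.mat g * F.mat h := rfl

@[simp] theorem mat_one (F : RamifiedCompletion p E) : F.mat 1 = 1 := rfl

theorem mat_mul_inv (F : RamifiedCompletion p E) (g : F.G) : F.mat g * F.mat g⁻¹ = 1 := by
  rw [← mat_mul, mul_inv_cancel, mat_one]

theorem similitude_spec (F : RamifiedCompletion p E) (g : F.G) :
    F.star (F.mat g) * F.J * F.mat g = (F.similitude g : ℚ_[p]) • F.J := g.2.choose_spec

theorem similitude_eq (F : RamifiedCompletion p E) (g : F.G) (m : ℚ_[p]ˣ)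
    (h : F.star (F.mat g) * F.J * F.mat g = (m : ℚ_[p]) • F.J) : F.similitude g = m := by
  have h1 := congrFun (congrFun ((F.similitude_spec g).symm.trans h) 1) 1
  simp only [J, Matrix.smul_apply, Algebra.smul_def] at h1
  ext1
  simpa using h1

@[simp] theorem similitude_ofMat (F : RamifiedCompletion p E) (M : Matrix (Fin 3) (Fin 3) E)
    (m : ℚ_[p]ˣ) (h : F.star M * F.J * M = (m : ℚ_[p]) • F.J) :
    F.similitude (F.ofMat M m h) = m := F.similitude_eq _ _ h

@[simp] theorem similitude_mul (F : RamifiedCompletion p E) (g h : F.G) :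
    F.similitude (g * h) = F.similitude g * F.similitude h := by
  refine F.similitude_eq _ _ ?_
  calc F.star (F.mat g * F.mat h) * F.J * (F.mat g * F.mat h)
      = F.star (F.mat h) * (F.star (F.mat g) * F.J * F.mat g) * F.mat h := by
        simp only [star_mul, Matrix.mul_assoc]
    _ = _ := by
        rw [similitude_spec, Matrix.mul_smul, Matrix.smul_mul, similitude_spec, smul_smul,
          Units.val_mul]

@[simp] theorem similitude_one (F : RamifiedCompletion p E) : F.similitude 1 = 1 :=
  F.similitude_eq _ _ (by simp [star_one])

@[simp] theorem similitude_inv (F : RamifiedCompletion p E) (g : F.G) :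
    F.similitude g⁻¹ = (F.similitude g)⁻¹ := by
  rw [eq_inv_iff_mul_eq_one, ← similitude_mul, inv_mul_cancel, similitude_one]

theorem mat_inv (F : RamifiedCompletion p E) (g : F.G) :
    F.mat g⁻¹ = (((F.similitude g)⁻¹ : ℚ_[p]ˣ) : ℚ_[p]) •
      (F.Jinv * (F.star (F.mat g) * F.J)) := by
  have h1 : ((F.similitude g)⁻¹ : ℚ_[p]ˣ).val • (F.Jinv * (F.star (F.mat g) * F.J)) * F.mat g = 1 := by
    rw [Matrix.smul_mul, Matrix.mul_assoc, similitude_spec, Matrix.mul_smul, smul_smul, Jinv_mul_J,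
      Units.inv_mul, one_smul]
  calc F.mat g⁻¹ = (((F.similitude g)⁻¹ : ℚ_[p]ˣ).val • (F.Jinv * (F.star (F.mat g) * F.J)) *
        F.mat g) * F.mat g⁻¹ := by rw [h1, Matrix.one_mul]
    _ = _ := by rw [Matrix.mul_assoc, mat_mul_inv, Matrix.mul_one]

theorem col_rel (F : RamifiedCompletion p E) (g : F.G) (i j : Fin 3) :
    F.δ⁻¹ * (F.conj (F.mat g 0 i) * F.mat g 2 j) - F.δ⁻¹ * (F.conj (F.mat g 2 i) * F.mat g 0 j) +
      F.conj (F.mat g 1 i) * F.mat g 1 j =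
      algebraMap ℚ_[p] E (F.similitude g) * F.J i j := by
  have h := congrFun (congrFun (F.similitude_spec g) i) j
  rw [Matrix.smul_apply, Algebra.smul_def] at h
  rw [← h]
  simp [Matrix.mul_apply, Fin.sum_univ_three, star, J]
  ring

/-- Rows of g are governed by the inverse form. In `Jinv` the power of δ is opposite to that in `J`,
which makes the estimate for rows one power of δ better than that for columns. -/
theorem row_rel_mat (F : RamifiedCompletion p E) (g : F.G) :
    F.mat g * F.Jinv * F.star (F.mat g) = (F.similitude g : ℚ_[p]) • F.Jinv := by
  have h := F.mat_mul_inv g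
  rw [mat_inv, Matrix.mul_smul] at h
  have h2 : F.mat g * (F.Jinv * (F.star (F.mat g) * F.J)) = (F.similitude g : ℚ_[p]) • 1 := by
    rw [← h, smul_smul, Units.mul_inv, one_smul]
  calc F.mat g * F.Jinv * F.star (F.mat g)
      = F.mat g * (F.Jinv * (F.star (F.mat g) * F.J)) * F.Jinv := by
        simp only [Matrix.mul_assoc, J_mul_Jinv, Matrix.mul_one]
    _ = _ := by rw [h2, Matrix.smul_mul, Matrix.one_mul]

theorem row_rel (F : RamifiedCompletion p E) (g : F.G) (i j : Fin 3) :
    F.δ * (F.mat g i 2 * F.conj (F.mat g j 0)) - F.δ * (F.mat g i 0 * F.conj (F.mat g j 2)) +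
      F.mat g i 1 * F.conj (F.mat g j 1) =
      algebraMap ℚ_[p] E (F.similitude g) * F.Jinv i j := by
  have h := congrFun (congrFun (F.row_rel_mat g) i) j
  rw [Matrix.smul_apply, Algebra.smul_def] at h
  rw [← h]
  simp [Matrix.mul_apply, Fin.sum_univ_three, star, Jinv]
  ring

theorem norm_sub_conj_le (F : RamifiedCompletion p E) (hp : p ≠ 2) {x y : E} {c : ℝ}
    (hx : ‖x‖ ≤ c) (hy : ‖y‖ ≤ c) : ‖x * F.conj y‖ ≤ c ^ 2 := by
  rw [norm_mul, F.norm_conj hp, pow_two]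
  exact mul_le_mul hx hy (norm_nonneg _) ((norm_nonneg _).trans hx)

/-- The middle entry of an isotropic column is bounded by the outer entries. -/
theorem norm_col_le (F : RamifiedCompletion p E) (hp : p ≠ 2) (g : F.G) {j : Fin 3} (hj : j ≠ 1)
    {x : E} (h0 : ‖F.mat g 0 j‖ ≤ ‖x‖) (h2 : ‖F.mat g 2 j‖ ≤ ‖x‖) : ‖F.mat g 1 j‖ ≤ ‖x‖ := by
  have hJ : F.J j j = 0 := by fin_cases j <;> simp_all [J]
  have h := F.col_rel g j j
  rw [hJ, mul_zero] at h
  -- Isotropy of the column. The factor δ on the left is the slack which `norm_le_of_sq_le` rounds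
  -- away.
  have h' : F.δ * (F.mat g 1 j * F.conj (F.mat g 1 j)) =
      F.mat g 0 j * F.conj (F.mat g 2 j) - F.mat g 2 j * F.conj (F.mat g 0 j) := by
    have := F.δ_ne_zero
    field_simp at h
    linear_combination h
  refine F.norm_le_of_sq_le hp ?_
  have h3 := congrArg norm h'
  rw [norm_mul, norm_mul, F.norm_conj hp, ← pow_two] at h3
  rw [h3]
  exact F.norm_sub_le_of_le (F.norm_sub_conj_le hp h0 h2) (F.norm_sub_conj_le hp h2 h0)

/-- The middle entry of an isotropic row is strictly bounded by the outer entries. -/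
theorem norm_row_le (F : RamifiedCompletion p E) (hp : p ≠ 2) (g : F.G) {i : Fin 3} (hi : i ≠ 1)
    {x : E} (h0 : ‖F.mat g i 0‖ ≤ ‖x‖) (h2 : ‖F.mat g i 2‖ ≤ ‖x‖) :
    ‖F.mat g i 1‖ ≤ ‖F.δ‖ * ‖x‖ := by
  have hJ : F.Jinv i i = 0 := by fin_cases i <;> simp_all [Jinv]
  have h := F.row_rel g i i
  rw [hJ, mul_zero] at h
  -- Isotropy of the row. Here δ is on the other side, which gains a full power of δ after rounding.
  have h' : F.mat g i 1 * F.conj (F.mat g i 1) =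
      F.δ * (F.mat g i 0 * F.conj (F.mat g i 2) - F.mat g i 2 * F.conj (F.mat g i 0)) := by
    linear_combination h
  refine F.norm_le_δ_mul_of_sq_le hp ?_
  have h3 := congrArg norm h'
  rw [norm_mul, norm_mul, F.norm_conj hp, ← pow_two] at h3
  rw [h3]
  gcongr
  exact F.norm_sub_le_of_le (F.norm_sub_conj_le hp h0 h2) (F.norm_sub_conj_le hp h2 h0)

theorem norm_mul_apply_le (F : RamifiedCompletion p E) {M N : Matrix (Fin 3) (Fin 3) E} {a b : ℝ}
    (hM : ∀ i j, ‖M i j‖ ≤ a) (hN : ∀ i j, ‖N i j‖ ≤ b) (i j : Fin 3) :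
    ‖(M * N) i j‖ ≤ a * b := by
  have h : ∀ k, ‖M i k * N k j‖ ≤ a * b := fun k => by
    rw [norm_mul]
    exact mul_le_mul (hM i k) (hN k j) (norm_nonneg _) ((norm_nonneg _).trans (hM i k))
  rw [Matrix.mul_apply, Fin.sum_univ_three]
  exact F.norm_add_le_of_le (F.norm_add_le_of_le (h 0) (h 1)) (h 2)

theorem norm_similitude_le (F : RamifiedCompletion p E) (hp : p ≠ 2) {g : F.G}
    (h : ∀ i j, ‖F.mat g i j‖ ≤ 1) : ‖(F.similitude g : ℚ_[p])‖ ≤ 1 := by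
  have h1 := F.row_rel g 1 1
  have h2 : F.Jinv 1 1 = 1 := by simp [Jinv]
  have h3 : ∀ i j k l, ‖F.mat g i j * F.conj (F.mat g k l)‖ ≤ 1 := fun i j k l => by
    simpa using F.norm_sub_conj_le hp (h i j) (h k l)
  have h4 : ∀ i j k l, ‖F.δ * (F.mat g i j * F.conj (F.mat g k l))‖ ≤ 1 := fun i j k l => by
    rw [norm_mul]
    exact mul_le_one₀ (F.norm_δ_lt_one hp).le (norm_nonneg _) (h3 ..)
  rw [h2, mul_one] at h1
  rw [← norm_algebraMap' E, ← h1]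
  exact F.norm_add_le_of_le (F.norm_sub_le_of_le (h4 ..) (h4 ..)) (h3 ..)

/-- The inverse of g is μ⁻¹·`Jinv`·g*·`J`. The entries δ⁻¹ of `J` are harmful only next to the
entries (0,1) and (2,1) of g, and those are divisible by δ by `norm_row_le`. -/
theorem mem_K_iff (F : RamifiedCompletion p E) (hp : p ≠ 2) (g : F.G) :
    g ∈ F.K ↔ (∀ i j, ‖F.mat g i j‖ ≤ 1) ∧ ‖(F.similitude g : ℚ_[p])‖ = 1 := by
  constructor
  · intro h
    have h' : ∀ i j, ‖F.mat g i j‖ ≤ 1 ∧ ‖F.mat g⁻¹ i j‖ ≤ 1 := h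
    refine ⟨fun i j => (h' i j).1, le_antisymm (F.norm_similitude_le hp fun i j => (h' i j).1) ?_⟩
    have := F.norm_similitude_le hp fun i j => (h' i j).2
    rw [similitude_inv, Units.val_inv_eq_inv_val, norm_inv] at this
    exact (inv_le_one₀ (norm_pos_iff.2 (Units.ne_zero _))).1 this
  · rintro ⟨h, hm⟩
    change ∀ i j, ‖F.mat g i j‖ ≤ 1 ∧ ‖F.mat g⁻¹ i j‖ ≤ 1
    refine fun i j => ⟨h i j, ?_⟩
    have hδ := F.norm_δ_pos
    have hδ1 := F.norm_δ_lt_one hp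
    have h0 := F.norm_row_le hp g (i := 0) (x := 1) (by simp) (by simpa using h 0 0)
      (by simpa using h 0 2)
    have h2 := F.norm_row_le hp g (i := 2) (x := 1) (by simp) (by simpa using h 2 0)
      (by simpa using h 2 2)
    rw [norm_one, mul_one] at h0 h2
    rw [mat_inv, Matrix.smul_apply, norm_smul, Units.val_inv_eq_inv_val, norm_inv, hm, inv_one,
      one_mul]
    have h3 : ‖F.δ‖⁻¹ * ‖F.mat g 0 1‖ ≤ 1 := by rwa [inv_mul_le_iff₀ hδ, mul_one]
    have h4 : ‖F.δ‖⁻¹ * ‖F.mat g 2 1‖ ≤ 1 := by rwa [inv_mul_le_iff₀ hδ, mul_one]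
    have h5 : ∀ i j, ‖F.δ‖ * ‖F.mat g i j‖ ≤ 1 := fun i j =>
      mul_le_one₀ hδ1.le (norm_nonneg _) (h i j)
    fin_cases i <;> fin_cases j <;>
      simp [Jinv, star, J, Matrix.mul_apply, Fin.sum_univ_three, F.norm_conj hp, h] <;>
      first
        | exact h5 _ _
        | (rw [mul_comm]; first | exact h3 | exact h4)
        | (rw [mul_comm, mul_assoc, inv_mul_cancel₀ hδ.ne', mul_one]; exact h _ _)

local notation "ι" => algebraMap ℚ_[p] E

/-! ### Unipotent elements, the Weyl element and the torus -/

/-- The upper triangular unipotent element of `G` with parameters `d` and `r`. -/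
def uni (F : RamifiedCompletion p E) (d : E) (r : ℚ_[p]) : F.G :=
  F.ofMat !![1, F.δ * F.conj d, ι r + F.δ * (d * F.conj d) / 2; 0, 1, d; 0, 0, 1] 1 (by
    have := F.δ_ne_zero
    have := F.charZero
    ext i j
    fin_cases i <;> fin_cases j <;>
      simp [star, J, Matrix.mul_apply, Fin.sum_univ_three, F.conj_δ, F.conj_conj, map_ofNat] <;>
      field_simp <;> ring)

/-- The lower triangular unipotent element of `G` with parameters `y` and `r`. -/
def low (F : RamifiedCompletion p E) (y : E) (r : ℚ_[p]) : F.G :=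
  F.ofMat !![1, 0, 0; y, 1, 0; ι r - F.δ * (y * F.conj y) / 2, -(F.δ * F.conj y), 1] 1 (by
    have := F.δ_ne_zero
    have := F.charZero
    ext i j
    fin_cases i <;> fin_cases j <;>
      simp [star, J, Matrix.mul_apply, Fin.sum_univ_three, F.conj_δ, F.conj_conj, map_ofNat] <;>
      field_simp <;> ring)

/-- The Weyl element. -/
def wt (F : RamifiedCompletion p E) : F.G :=
  F.ofMat !![0, 0, 1; 0, 1, 0; -1, 0, 0] 1 (by
    ext i j
    fin_cases i <;> fin_cases j <;>
      simp [star, J, Matrix.mul_apply, Fin.sum_univ_three])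

theorem mat_uni (F : RamifiedCompletion p E) (d : E) (r : ℚ_[p]) : F.mat (F.uni d r) =
    !![1, F.δ * F.conj d, ι r + F.δ * (d * F.conj d) / 2; 0, 1, d; 0, 0, 1] := rfl

theorem mat_low (F : RamifiedCompletion p E) (y : E) (r : ℚ_[p]) : F.mat (F.low y r) =
    !![1, 0, 0; y, 1, 0; ι r - F.δ * (y * F.conj y) / 2, -(F.δ * F.conj y), 1] := rfl

theorem mat_wt (F : RamifiedCompletion p E) : F.mat F.wt = !![0, 0, 1; 0, 1, 0; -1, 0, 0] := rfl

@[simp] theorem similitude_uni (F : RamifiedCompletion p E) (d : E) (r : ℚ_[p]) :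
    F.similitude (F.uni d r) = 1 := F.similitude_ofMat ..

@[simp] theorem similitude_low (F : RamifiedCompletion p E) (d : E) (r : ℚ_[p]) :
    F.similitude (F.low d r) = 1 := F.similitude_ofMat ..

@[simp] theorem similitude_wt (F : RamifiedCompletion p E) : F.similitude F.wt = 1 :=
  F.similitude_ofMat ..

theorem uni_zero (F : RamifiedCompletion p E) : F.uni 0 0 = 1 := by
  apply F.G_ext
  rw [mat_uni]
  ext i j
  fin_cases i <;> fin_cases j <;> simp

theorem uni_mem_U (F : RamifiedCompletion p E) (d : E) (r : ℚ_[p]) : F.uni d r ∈ F.U := by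
  constructor
  · intro i
    rw [mat_uni]
    fin_cases i <;> simp
  · intro i j hij
    rw [mat_uni]
    fin_cases i <;> fin_cases j <;> simp_all

/-- The unipotent radical is a Heisenberg group: s is an alternating cocycle in d and d', and it is
rational because it is fixed by conjugation. -/
theorem uni_mul (F : RamifiedCompletion p E) {d d' : E} {r r' s : ℚ_[p]}
    (h : ι s = F.δ * (F.conj d * d' - d * F.conj d') / 2) :
    F.uni d r * F.uni d' r' = F.uni (d + d') (r + r' + s) := by
  have := F.charZero
  apply F.G_ext
  rw [mat_mul, mat_uni, mat_uni, mat_uni]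
  ext i j
  fin_cases i <;> fin_cases j <;>
    simp [Matrix.mul_apply, Fin.sum_univ_three] <;> (try rw [h]) <;> ring

theorem exists_uni_cocycle (F : RamifiedCompletion p E) (d d' : E) :
    ∃ s : ℚ_[p], ι s = F.δ * (F.conj d * d' - d * F.conj d') / 2 := by
  obtain ⟨s, hs⟩ := F.exists_algebraMap_of_conj_eq
    (x := F.δ * (F.conj d * d' - d * F.conj d') / 2) (by
      simp only [map_div₀, map_mul, map_sub, F.conj_conj, F.conj_δ, map_ofNat]; ring)
  exact ⟨s, hs.symm⟩

theorem uni_inv (F : RamifiedCompletion p E) (d : E) (r : ℚ_[p]) :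
    (F.uni d r)⁻¹ = F.uni (-d) (-r) := by
  rw [inv_eq_iff_mul_eq_one, F.uni_mul (s := 0)]
  · simp [uni_zero]
  · rw [map_neg, map_zero]; ring

theorem uni_mem_K (F : RamifiedCompletion p E) (hp : p ≠ 2) {d : E} {r : ℚ_[p]}
    (hd : ‖d‖ ≤ 1) (hr : ‖r‖ ≤ 1) : F.uni d r ∈ F.K := by
  rw [F.mem_K_iff hp]
  refine ⟨?_, by simp⟩
  have hδ := (F.norm_δ_lt_one hp).le
  have h1 : ‖F.δ * F.conj d‖ ≤ 1 := by
    rw [norm_mul, F.norm_conj hp]; exact mul_le_one₀ hδ (norm_nonneg _) hd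
  have h2 : ‖ι r + F.δ * (d * F.conj d) / 2‖ ≤ 1 := by
    refine F.norm_add_le_of_le (by rwa [norm_algebraMap']) ?_
    rw [norm_div, F.norm_two_E hp, div_one, norm_mul, norm_mul, F.norm_conj hp]
    exact mul_le_one₀ hδ (by positivity) (mul_le_one₀ hd (norm_nonneg _) hd)
  intro i j
  rw [mat_uni]
  fin_cases i <;> fin_cases j <;> simp [h2, hd] <;> simpa using h1

theorem low_mem_K (F : RamifiedCompletion p E) (hp : p ≠ 2) {d : E} {r : ℚ_[p]}
    (hd : ‖d‖ ≤ 1) (hr : ‖ι r - F.δ * (d * F.conj d) / 2‖ ≤ 1) : F.low d r ∈ F.K := by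
  rw [F.mem_K_iff hp]
  refine ⟨?_, by simp⟩
  have hδ := (F.norm_δ_lt_one hp).le
  have h1 : ‖F.δ * F.conj d‖ ≤ 1 := by
    rw [norm_mul, F.norm_conj hp]; exact mul_le_one₀ hδ (norm_nonneg _) hd
  intro i j
  rw [mat_low]
  fin_cases i <;> fin_cases j <;> simp [hr, hd] <;> simpa using h1

theorem wt_mem_K (F : RamifiedCompletion p E) (hp : p ≠ 2) : F.wt ∈ F.K := by
  rw [F.mem_K_iff hp]
  refine ⟨?_, by simp⟩
  intro i j
  rw [mat_wt]
  fin_cases i <;> fin_cases j <;> simp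

/-- The element `diag(ϖ, 1, conj ϖ⁻¹)` of `T`. -/
def tt (F : RamifiedCompletion p E) : F.T := F.torusElt F.ϖ 1 (F.conjU F.ϖ)⁻¹ (by simp)

/-- The central element `diag(ϖ, ϖ, ϖ)` of `T`. -/
def zz (F : RamifiedCompletion p E) : F.T := F.torusElt F.ϖ F.ϖ F.ϖ rfl

/-- The element `diag(ϖ, 1, conj ϖ⁻¹)ⁿ diag(ϖ, ϖ, ϖ)ᵐ` of `T`. -/
def tor (F : RamifiedCompletion p E) (n m : ℤ) : F.T := F.tt ^ n * F.zz ^ m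

theorem torusElt_zpow (F : RamifiedCompletion p E) (t₁ t₂ t₃ : Eˣ) (h) (n : ℤ) :
    F.torusElt t₁ t₂ t₃ h ^ n = F.torusElt (t₁ ^ n) (t₂ ^ n) (t₃ ^ n) (by
      rw [map_zpow, map_zpow, ← _root_.mul_zpow, h, _root_.mul_zpow]) := by
  have h1 : ∀ k : ℕ, F.torusElt t₁ t₂ t₃ h ^ k = F.torusElt (t₁ ^ k) (t₂ ^ k) (t₃ ^ k) (by
      rw [map_pow, map_pow, ← mul_pow, h, mul_pow]) := by
    intro k
    induction k with
    | zero =>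
      apply Subtype.ext
      apply F.G_ext
      change 1 = diagonal (fun i => ((![t₁ ^ 0, t₂ ^ 0, t₃ ^ 0] i : Eˣ) : E))
      ext i j
      fin_cases i <;> fin_cases j <;> simp
    | succ k ih =>
      rw [pow_succ, ih, torusElt_mul]
      simp only [pow_succ]
  rcases n with k | k
  · simpa using h1 k
  · rw [zpow_negSucc, h1, inv_eq_iff_mul_eq_one, torusElt_mul]
    simp only [zpow_negSucc, mul_inv_cancel]
    simpa using (h1 0).symm

theorem mat_torusElt (F : RamifiedCompletion p E) (t₁ t₂ t₃ : Eˣ) (h) :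
    F.mat (F.torusElt t₁ t₂ t₃ h : F.T) = !![(t₁ : E), 0, 0; 0, t₂, 0; 0, 0, t₃] := by
  change diagonal (fun i => ((![t₁, t₂, t₃] i : Eˣ) : E)) = _
  ext i j
  fin_cases i <;> fin_cases j <;> simp

theorem mat_tor (F : RamifiedCompletion p E) (n m : ℤ) : F.mat (F.tor n m : F.T) =
    !![F.δ ^ (n + m), 0, 0; 0, F.δ ^ m, 0; 0, 0, (-F.δ) ^ (-n) * F.δ ^ m] := by
  rw [tor, tt, zz, torusElt_zpow, torusElt_zpow, torusElt_mul, mat_torusElt]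
  ext i j
  fin_cases i <;> fin_cases j <;>
    simp [ϖ, F.conj_δ, zpow_add₀ F.δ_ne_zero]

theorem tt_mul_zz (F : RamifiedCompletion p E) : Commute F.tt F.zz := by
  rw [commute_iff_eq, tt, zz, torusElt_mul, torusElt_mul]
  simp only [mul_comm]

theorem tor_mul (F : RamifiedCompletion p E) (n m n' m' : ℤ) :
    F.tor n m * F.tor n' m' = F.tor (n + n') (m + m') := by
  have h1 : F.zz ^ m * F.tt ^ n' = F.tt ^ n' * F.zz ^ m :=
    (F.tt_mul_zz.symm.zpow_zpow m n')
  rw [tor, tor, tor, _root_.zpow_add, _root_.zpow_add, mul_assoc, ← mul_assoc (F.zz ^ m), h1]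
  simp only [mul_assoc]

/-! ### Iwasawa and Cartan decompositions -/

theorem low_inv (F : RamifiedCompletion p E) (y : E) (r : ℚ_[p]) :
    (F.low y r)⁻¹ = F.low (-y) (-r) := by
  have := F.charZero
  rw [inv_eq_iff_mul_eq_one]
  apply F.G_ext
  rw [mat_mul, mat_low, mat_low, mat_one]
  ext i j
  fin_cases i <;> fin_cases j <;>
    simp [Matrix.mul_apply, Fin.sum_univ_three]
  ring

theorem similitude_ne_zero (F : RamifiedCompletion p E) (g : F.G) :
    ι (F.similitude g) ≠ 0 := by simp

theorem corner_ne_zero (F : RamifiedCompletion p E) (g : F.G) :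
    F.mat g 0 0 ≠ 0 ∨ F.mat g 2 0 ≠ 0 := by
  by_contra! h
  have h1 := F.col_rel g 0 0
  have h2 := F.col_rel g 0 2
  simp only [h.1, h.2, map_zero, J] at h1 h2
  have h3 : F.mat g 1 0 = 0 := by simpa using h1
  simp only [h3, map_zero] at h2
  have := F.similitude_ne_zero g
  simp [F.δ_ne_zero] at h2

/-- The stabilizer of the isotropic line of the first basis vector is the Borel subgroup. The
relations between the columns force the remaining zero and express the first row through the rest.
-/
theorem upper_decomp (F : RamifiedCompletion p E) {g : F.G} (h1 : F.mat g 1 0 = 0)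
    (h2 : F.mat g 2 0 = 0) : ∃ (d : E) (r : ℚ_[p]) (t : F.T), g = F.uni d r * t := by
  have hδ := F.δ_ne_zero
  have hμ := F.similitude_ne_zero g
  have hchar := F.charZero
  have e01 := F.col_rel g 0 1
  have e02 := F.col_rel g 0 2
  have e11 := F.col_rel g 1 1
  have e12 := F.col_rel g 1 2
  have e22 := F.col_rel g 2 2
  simp [h1, h2, J, hδ] at e01 e02 e11 e12 e22
  have h00 : F.mat g 0 0 ≠ 0 := by
    intro h; simp [h] at e02; exact hδ e02
  have h21 : F.mat g 2 1 = 0 := e01.resolve_left h00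
  simp [h21] at e11 e12
  have e02' : F.conj (F.mat g 0 0) * F.mat g 2 2 = ι (F.similitude g) := by
    field_simp at e02; exact e02
  have h22 : F.mat g 2 2 ≠ 0 := by
    intro h; rw [h, mul_zero] at e02'; exact hμ e02'.symm
  have h11 : F.mat g 1 1 ≠ 0 := by
    intro h; rw [h, mul_zero] at e11; exact hμ e11.symm
  have c22 : F.conj (F.mat g 2 2) ≠ 0 := F.conj_ne_zero.2 h22
  have h01 : F.mat g 0 1 = F.δ * F.conj (F.mat g 1 2 / F.mat g 2 2) * F.mat g 1 1 := by
    have := congrArg F.conj e12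
    simp only [map_add, map_mul, map_inv₀, F.conj_conj, F.conj_δ, map_zero, map_div₀] at this ⊢
    field_simp
    field_simp at this
    linear_combination -this
  -- Isotropy of the last column says exactly that this element is fixed by conjugation.
  obtain ⟨r, hr⟩ := F.exists_algebraMap_of_conj_eq (x := F.mat g 0 2 / F.mat g 2 2 -
      F.δ * (F.mat g 1 2 / F.mat g 2 2 * F.conj (F.mat g 1 2 / F.mat g 2 2)) / 2) (by
    simp only [map_sub, map_div₀, map_mul, F.conj_conj, F.conj_δ, map_ofNat]
    field_simp
    field_simp at e22
    linear_combination 2 * e22)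
  refine ⟨F.mat g 1 2 / F.mat g 2 2, r, F.torusElt (Units.mk0 _ h00) (Units.mk0 _ h11)
    (Units.mk0 _ h22) (by ext1; simpa using e02'.trans e11.symm), ?_⟩
  apply F.G_ext
  rw [mat_mul, mat_uni, mat_torusElt, ← hr]
  ext i j
  fin_cases i <;> fin_cases j <;> simp [Matrix.mul_apply, Fin.sum_univ_three, h1, h2, h21, h22]
  · simpa using h01

/-- The first column, scaled to (1, y, z), is isotropic, and isotropy is the condition for it to be
the first column of some `F.low y r`. -/
theorem exists_low_mul (F : RamifiedCompletion p E) {g : F.G} (h0 : F.mat g 0 0 ≠ 0) :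
    ∃ (y : E) (r : ℚ_[p]), y = F.mat g 1 0 / F.mat g 0 0 ∧
      ι r - F.δ * (y * F.conj y) / 2 = F.mat g 2 0 / F.mat g 0 0 ∧
      F.mat ((F.low y r)⁻¹ * g) 1 0 = 0 ∧ F.mat ((F.low y r)⁻¹ * g) 2 0 = 0 ∧
      ∀ j, F.mat ((F.low y r)⁻¹ * g) 0 j = F.mat g 0 j := by
  have hδ := F.δ_ne_zero
  have hchar := F.charZero
  have e00 := F.col_rel g 0 0
  simp [J] at e00
  have c0 : F.conj (F.mat g 0 0) ≠ 0 := F.conj_ne_zero.2 h0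
  set y := F.mat g 1 0 / F.mat g 0 0 with hy
  set z := F.mat g 2 0 / F.mat g 0 0 with hz
  have h1 : F.mat g 1 0 = y * F.mat g 0 0 := by rw [hy]; field_simp
  have h2 : F.mat g 2 0 = z * F.mat g 0 0 := by rw [hz]; field_simp
  have hyz : z - F.conj z + F.δ * (y * F.conj y) = 0 := by
    rw [hy, hz]
    simp only [map_div₀]
    field_simp
    field_simp at e00
    linear_combination e00
  obtain ⟨r, hr⟩ := F.exists_algebraMap_of_conj_eq (x := z + F.δ * (y * F.conj y) / 2) (by
    simp only [map_add, map_div₀, map_mul, F.conj_conj, F.conj_δ, map_ofNat]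
    linear_combination -hyz)
  refine ⟨y, r, rfl, by rw [← hr]; ring, ?_, ?_, ?_⟩
  · rw [low_inv, mat_mul, mat_low]
    simp [Matrix.mul_apply, Fin.sum_univ_three, h1]
  · rw [low_inv, mat_mul, mat_low]
    simp [Matrix.mul_apply, Fin.sum_univ_three, h1, h2, ← hr]
    ring
  · intro j
    rw [low_inv, mat_mul, mat_low]
    simp [Matrix.mul_apply, Fin.sum_univ_three]

theorem mat_wt_inv (F : RamifiedCompletion p E) :
    F.mat F.wt⁻¹ = !![0, 0, -1; 0, 1, 0; 1, 0, 0] := by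
  have h : F.mat F.wt⁻¹ * F.mat F.wt = 1 := by rw [← mat_mul, inv_mul_cancel, mat_one]
  have h2 : F.mat F.wt * !![0, 0, -1; 0, 1, 0; 1, 0, 0] = 1 := by
    rw [mat_wt]
    ext i j
    fin_cases i <;> fin_cases j <;> simp [Matrix.mul_apply, Fin.sum_univ_three]
  exact left_inv_eq_right_inv h h2

/-- The other chart of the isotropic lines: the first column, scaled to (z, y, 1), is up to sign the
first column of `F.uni y r * F.wt`. -/
theorem exists_uni_wt_mul (F : RamifiedCompletion p E) {g : F.G} (h0 : F.mat g 2 0 ≠ 0) :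
    ∃ (y : E) (r : ℚ_[p]), y = F.mat g 1 0 / F.mat g 2 0 ∧
      ι r + F.δ * (y * F.conj y) / 2 = F.mat g 0 0 / F.mat g 2 0 ∧
      F.mat ((F.uni y r * F.wt)⁻¹ * g) 1 0 = 0 ∧ F.mat ((F.uni y r * F.wt)⁻¹ * g) 2 0 = 0 := by
  have hδ := F.δ_ne_zero
  have hchar := F.charZero
  have e00 := F.col_rel g 0 0
  simp [J] at e00
  have c0 : F.conj (F.mat g 2 0) ≠ 0 := F.conj_ne_zero.2 h0
  set y := F.mat g 1 0 / F.mat g 2 0 with hy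
  set z := F.mat g 0 0 / F.mat g 2 0 with hz
  have h1 : F.mat g 1 0 = y * F.mat g 2 0 := by rw [hy]; field_simp
  have h2 : F.mat g 0 0 = z * F.mat g 2 0 := by rw [hz]; field_simp
  have hyz : F.conj z - z + F.δ * (y * F.conj y) = 0 := by
    rw [hy, hz]
    simp only [map_div₀]
    field_simp
    field_simp at e00
    linear_combination e00
  obtain ⟨r, hr⟩ := F.exists_algebraMap_of_conj_eq (x := z - F.δ * (y * F.conj y) / 2) (by
    simp only [map_sub, map_div₀, map_mul, F.conj_conj, F.conj_δ, map_ofNat]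
    linear_combination hyz)
  refine ⟨y, r, rfl, by rw [← hr]; ring, ?_, ?_⟩
  · rw [_root_.mul_inv_rev, uni_inv, mat_mul, mat_mul, mat_uni, mat_wt_inv]
    simp [Matrix.mul_apply, Fin.sum_univ_three, h1]
  · rw [_root_.mul_inv_rev, uni_inv, mat_mul, mat_mul, mat_uni, mat_wt_inv]
    simp [Matrix.mul_apply, Fin.sum_univ_three, h1, h2, ← hr]
    ring

theorem uni_mem_K_of_norm_le (F : RamifiedCompletion p E) (hp : p ≠ 2) {d : E} {r : ℚ_[p]}
    (hd : ‖d‖ ≤ 1) (hr : ‖ι r + F.δ * (d * F.conj d) / 2‖ ≤ 1) : F.uni d r ∈ F.K := by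
  refine F.uni_mem_K hp hd ?_
  have h2 : ‖F.δ * (d * F.conj d) / 2‖ ≤ 1 := by
    rw [norm_div, F.norm_two_E hp, div_one, norm_mul, norm_mul, F.norm_conj hp]
    exact mul_le_one₀ (F.norm_δ_lt_one hp).le (by positivity) (mul_le_one₀ hd (norm_nonneg _) hd)
  have := F.norm_sub_le_of_le hr h2
  rwa [add_sub_cancel_right, norm_algebraMap'] at this

/-- An element of `G` is in the `K`-orbit of an upper triangular one. -/
theorem exists_K_mul_upper (F : RamifiedCompletion p E) (hp : p ≠ 2) (g : F.G) :
    ∃ κ ∈ F.K, F.mat (κ⁻¹ * g) 1 0 = 0 ∧ F.mat (κ⁻¹ * g) 2 0 = 0 := by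
  -- Dividing by the larger outer entry keeps the parameters integral. The middle entry is then
  -- controlled by `norm_col_le`.
  rcases le_or_gt ‖F.mat g 2 0‖ ‖F.mat g 0 0‖ with h | h
  · have h0 : F.mat g 0 0 ≠ 0 := by
      intro h0
      rw [h0, norm_zero, norm_le_zero_iff] at h
      exact (F.corner_ne_zero g).elim (· h0) (· h)
    obtain ⟨y, r, hy, hr, h1, h2, -⟩ := F.exists_low_mul h0
    refine ⟨_, F.low_mem_K hp ?_ ?_, h1, h2⟩
    · rw [hy, norm_div]
      exact div_le_one_of_le₀ (F.norm_col_le hp g (by simp) le_rfl h) (norm_nonneg _)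
    · rw [hr, norm_div]
      exact div_le_one_of_le₀ h (norm_nonneg _)
  · have h0 : F.mat g 2 0 ≠ 0 := norm_pos_iff.1 ((norm_nonneg _).trans_lt h)
    obtain ⟨y, r, hy, hr, h1, h2⟩ := F.exists_uni_wt_mul h0
    refine ⟨_, mul_mem (F.uni_mem_K_of_norm_le hp ?_ ?_) (F.wt_mem_K hp), h1, h2⟩
    · rw [hy, norm_div]
      exact div_le_one_of_le₀ (F.norm_col_le hp g (by simp) h.le le_rfl) (norm_nonneg _)
    · rw [hr, norm_div]
      exact div_le_one_of_le₀ h.le (norm_nonneg _)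

theorem exists_torusElt_eq (F : RamifiedCompletion p E) (t : F.T) :
    ∃ (t₁ t₂ t₃ : Eˣ) (h : F.conjU t₁ * t₃ = F.conjU t₂ * t₂), t = F.torusElt t₁ t₂ t₃ h := by
  obtain ⟨d, hd⟩ := t.2
  have hm : F.mat t = diagonal fun i => (d i : E) := congrArg Units.val hd
  have e02 := F.col_rel t 0 2
  have e11 := F.col_rel t 1 1
  have hδ := F.δ_ne_zero
  simp [hm, J] at e02 e11
  refine ⟨d 0, d 1, d 2, ?_, ?_⟩
  · ext1
    simp only [Units.val_mul, val_conjU]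
    rw [e11]
    field_simp at e02
    exact e02
  · apply Subtype.ext
    apply F.G_ext
    rw [hm, mat_torusElt]
    ext i j
    fin_cases i <;> fin_cases j <;> simp

theorem tor_inv (F : RamifiedCompletion p E) (n m : ℤ) : (F.tor n m)⁻¹ = F.tor (-n) (-m) := by
  rw [inv_eq_iff_mul_eq_one, tor_mul]
  simp [tor]

theorem exists_tor_mul (F : RamifiedCompletion p E) (hp : p ≠ 2) (t : F.T) :
    ∃ (n m : ℤ) (k : F.T), (k : F.G) ∈ F.K ∧ t = F.tor n m * k ∧
      ‖F.mat t 0 0‖ = ‖F.δ‖ ^ (n + m) ∧ ‖F.mat t 1 1‖ = ‖F.δ‖ ^ m ∧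
      ‖F.mat t 2 2‖ = ‖F.δ‖ ^ (m - n) := by
  obtain ⟨t₁, t₂, t₃, h, rfl⟩ := F.exists_torusElt_eq t
  obtain ⟨a, ha⟩ := F.exists_norm_eq hp t₁.ne_zero
  obtain ⟨m, hm⟩ := F.exists_norm_eq hp t₂.ne_zero
  have hδ := F.norm_δ_pos.ne'
  have h3 : ‖(t₃ : E)‖ = ‖F.δ‖ ^ (2 * m - a) := by
    have := congrArg (fun x : Eˣ => ‖(x : E)‖) h
    simp only [Units.val_mul, val_conjU, norm_mul, F.norm_conj hp, ha, hm] at this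
    rw [← zpow_add₀ hδ] at this
    rw [zpow_sub₀ hδ, eq_div_iff (zpow_ne_zero _ hδ), mul_comm, this]
    ring_nf
  refine ⟨a - m, m, (F.tor (a - m) m)⁻¹ * F.torusElt t₁ t₂ t₃ h, ?_, by group, ?_, ?_, ?_⟩
  · obtain ⟨k₁, k₂, k₃, hk, hkeq⟩ := F.exists_torusElt_eq
      ((F.tor (a - m) m)⁻¹ * F.torusElt t₁ t₂ t₃ h)
    have hmat : F.mat (((F.tor (a - m) m)⁻¹ * F.torusElt t₁ t₂ t₃ h : F.T) : F.G) =
        F.mat (F.tor (-(a - m)) (-m)) * F.mat (F.torusElt t₁ t₂ t₃ h) := by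
      rw [tor_inv]; rfl
    rw [hkeq, mat_torusElt, mat_torusElt, mat_tor] at hmat
    have h1 := congrArg norm (congrFun (congrFun hmat 0) 0)
    have h2 := congrArg norm (congrFun (congrFun hmat 1) 1)
    have h4 := congrArg norm (congrFun (congrFun hmat 2) 2)
    simp only [Matrix.mul_apply, Fin.sum_univ_three] at h1 h2 h4
    simp [ha, hm, h3] at h1 h2 h4
    rw [hkeq]
    refine F.torusElt_mem_K _ _ _ hk ?_ ?_ ?_
    · rw [h1, ← zpow_add₀ hδ]; ring_nf; simp
    · rw [h2]; field_simp
    · rw [h4, ← _root_.zpow_neg, ← zpow_add₀ hδ, ← zpow_add₀ hδ]; ring_nf; simp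
  · rw [mat_torusElt]; simpa using ha
  · rw [mat_torusElt]; simpa using hm
  · rw [mat_torusElt]; simp [h3]; ring_nf

theorem torusElt_mul_uni (F : RamifiedCompletion p E) (t₁ t₂ t₃ : Eˣ) (h) (d : E) {r s : ℚ_[p]}
    (hs : ι s = t₁ / t₃ * ι r) :
    (F.torusElt t₁ t₂ t₃ h : F.G) * F.uni d r =
      F.uni (t₂ / t₃ * d) s * F.torusElt t₁ t₂ t₃ h := by
  have hchar := F.charZero
  have h1 : (t₁ : E) * F.conj t₃ = F.conj t₂ * t₂ := by
    have := congrArg F.conj (congrArg Units.val h)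
    simp only [Units.val_mul, val_conjU, map_mul, F.conj_conj] at this
    linear_combination this
  have c3 : F.conj (t₃ : E) ≠ 0 := F.conj_ne_zero.2 t₃.ne_zero
  apply F.G_ext
  rw [mat_mul, mat_mul, mat_torusElt, mat_uni, mat_uni]
  ext i j
  fin_cases i <;> fin_cases j <;>
    simp [Matrix.mul_apply, Fin.sum_univ_three, hs]
  · field_simp
    linear_combination F.δ * F.conj d * h1
  · field_simp
    linear_combination d * F.conj d * F.δ * h1
  · field_simp

theorem exists_T_mul_uni (F : RamifiedCompletion p E) (t : F.T) (d : E) (r : ℚ_[p]) :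
    ∃ d' r', (t : F.G) * F.uni d r = F.uni d' r' * t := by
  obtain ⟨t₁, t₂, t₃, h, rfl⟩ := F.exists_torusElt_eq t
  have c3 : F.conj (t₃ : E) ≠ 0 := F.conj_ne_zero.2 t₃.ne_zero
  have h1 := congrArg Units.val h
  have h2 := congrArg F.conj h1
  simp only [Units.val_mul, val_conjU, map_mul, F.conj_conj] at h1 h2
  obtain ⟨s, hs⟩ := F.exists_algebraMap_of_conj_eq (x := (t₁ : E) / t₃ * ι r) (by
    simp only [map_mul, map_div₀, AlgEquiv.commutes]
    field_simp
    linear_combination ι r * (h1 - h2))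
  exact ⟨_, _, F.torusElt_mul_uni t₁ t₂ t₃ h d hs.symm⟩

/-- K acts transitively on isotropic lines. This gives G = KB, and passing to inverses gives G = BK.
-/
theorem iwasawa (F : RamifiedCompletion p E) (hp : p ≠ 2) (g : F.G) :
    ∃ (d : E) (r : ℚ_[p]) (n m : ℤ), ∃ k ∈ F.K, g = F.uni d r * F.tor n m * k := by
  obtain ⟨κ, hκ, h1, h2⟩ := F.exists_K_mul_upper hp g⁻¹
  obtain ⟨d, r, t, h⟩ := F.upper_decomp h1 h2
  obtain ⟨d', r', h'⟩ := F.exists_T_mul_uni t⁻¹ (-d) (-r)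
  obtain ⟨n, m, k, hk, hnm, -⟩ := F.exists_tor_mul hp t⁻¹
  refine ⟨d', r', n, m, k * κ⁻¹, mul_mem hk (inv_mem hκ), ?_⟩
  calc g = (κ⁻¹ * g⁻¹)⁻¹ * κ⁻¹ := by group
    _ = (((t⁻¹ : F.T) : F.G) * F.uni (-d) (-r)) * κ⁻¹ := by
      rw [h, _root_.mul_inv_rev, uni_inv, Subgroup.coe_inv]
    _ = _ := by
      rw [h', hnm, Subgroup.coe_mul]
      simp only [mul_assoc]

/-- Some corner entry of an element of `G` dominates; it can be moved to the upper left. -/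
theorem exists_max_entry (F : RamifiedCompletion p E) (hp : p ≠ 2) (g : F.G) :
    ∃ κ ∈ F.K, ∃ κ' ∈ F.K, ∀ i j, ‖F.mat (κ * g * κ') i j‖ ≤ ‖F.mat (κ * g * κ') 0 0‖ := by
  -- On the left the Weyl element exchanges the outer rows, on the right the outer columns, up to
  -- signs. So the largest corner can be moved to position (0,0).
  have corner : ∃ κ ∈ F.K, ∃ κ' ∈ F.K, ‖F.mat (κ * g * κ') 0 2‖ ≤ ‖F.mat (κ * g * κ') 0 0‖ ∧
      ‖F.mat (κ * g * κ') 2 0‖ ≤ ‖F.mat (κ * g * κ') 0 0‖ ∧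
      ‖F.mat (κ * g * κ') 2 2‖ ≤ ‖F.mat (κ * g * κ') 0 0‖ := by
    have hw := F.wt_mem_K hp
    have e1 : ∀ j, F.mat (F.wt * g) 0 j = F.mat g 2 j := fun j => by
      simp [mat_wt, Matrix.mul_apply, Fin.sum_univ_three]
    have e2 : ∀ j, F.mat (F.wt * g) 2 j = -F.mat g 0 j := fun j => by
      simp [mat_wt, Matrix.mul_apply, Fin.sum_univ_three]
    have e3 : ∀ (h : F.G) (i), F.mat (h * F.wt) i 0 = -F.mat h i 2 := fun h i => by
      simp [mat_wt, Matrix.mul_apply, Fin.sum_univ_three]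
    have e4 : ∀ (h : F.G) (i), F.mat (h * F.wt) i 2 = F.mat h i 0 := fun h i => by
      simp [mat_wt, Matrix.mul_apply, Fin.sum_univ_three]
    have key : (‖F.mat g 0 2‖ ≤ ‖F.mat g 0 0‖ ∧ ‖F.mat g 2 0‖ ≤ ‖F.mat g 0 0‖ ∧
          ‖F.mat g 2 2‖ ≤ ‖F.mat g 0 0‖) ∨
        (‖F.mat g 0 0‖ ≤ ‖F.mat g 0 2‖ ∧ ‖F.mat g 2 0‖ ≤ ‖F.mat g 0 2‖ ∧
          ‖F.mat g 2 2‖ ≤ ‖F.mat g 0 2‖) ∨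
        (‖F.mat g 0 0‖ ≤ ‖F.mat g 2 0‖ ∧ ‖F.mat g 0 2‖ ≤ ‖F.mat g 2 0‖ ∧
          ‖F.mat g 2 2‖ ≤ ‖F.mat g 2 0‖) ∨
        (‖F.mat g 0 0‖ ≤ ‖F.mat g 2 2‖ ∧ ‖F.mat g 0 2‖ ≤ ‖F.mat g 2 2‖ ∧
          ‖F.mat g 2 0‖ ≤ ‖F.mat g 2 2‖) := by
      grind
    rcases key with h | h | h | h
    · exact ⟨1, one_mem _, 1, one_mem _, by simpa using h⟩
    · refine ⟨1, one_mem _, _, hw, ?_⟩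
      rw [one_mul, e3, e4, e4, e3, norm_neg, norm_neg]
      tauto
    · refine ⟨_, hw, 1, one_mem _, ?_⟩
      rw [mul_one, e1, e1, e2, e2, norm_neg, norm_neg]
      tauto
    · refine ⟨_, hw, _, hw, ?_⟩
      rw [e3, e4, e4, e3, e1, e1, e2, e2]
      simp only [norm_neg]
      tauto
  obtain ⟨κ, hκ, κ', hκ', h02, h20, h22⟩ := corner
  refine ⟨κ, hκ, κ', hκ', ?_⟩
  set g' := κ * g * κ'
  have hδ := F.norm_δ_pos
  have hδ1 := F.norm_δ_lt_one hp
  have hle : ‖F.δ‖ * ‖F.mat g' 0 0‖ ≤ ‖F.mat g' 0 0‖ :=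
    mul_le_of_le_one_left (norm_nonneg _) hδ1.le
  have h01 := F.norm_row_le hp g' (i := 0) (by simp) le_rfl h02
  have h21 := F.norm_row_le hp g' (i := 2) (by simp) h20 h22
  have h10 := F.norm_col_le hp g' (j := 0) (by simp) le_rfl h20
  have h12 := F.norm_col_le hp g' (j := 2) (by simp) h02 h22
  have r02 := F.row_rel g' 0 2
  have r11 := F.row_rel g' 1 1
  have nb : ∀ {x y : E}, ‖x‖ ≤ ‖F.mat g' 0 0‖ → ‖y‖ ≤ ‖F.mat g' 0 0‖ →
      ‖F.δ * (x * F.conj y)‖ ≤ ‖F.δ‖ * ‖F.mat g' 0 0‖ ^ 2 := fun hx hy => by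
    rw [norm_mul]
    exact mul_le_mul_of_nonneg_left (F.norm_sub_conj_le hp hx hy) hδ.le
  -- The outer rows pair to -δμ, and every term of that relation is bounded by ‖δ‖ times the square
  -- of the dominant entry, so a factor ‖δ‖ cancels.
  have hμ : ‖ι (F.similitude g')‖ ≤ ‖F.mat g' 0 0‖ ^ 2 := by
    have h3 : ‖F.mat g' 0 1 * F.conj (F.mat g' 2 1)‖ ≤ ‖F.δ‖ * ‖F.mat g' 0 0‖ ^ 2 := by
      refine (F.norm_sub_conj_le hp h01 h21).trans ?_
      rw [mul_pow]
      gcongr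
      exact pow_le_of_le_one hδ.le hδ1.le two_ne_zero
    have h4 := congrArg norm r02
    have h5 : F.Jinv 0 2 = -F.δ := by simp [Jinv]
    rw [h5, norm_mul, norm_neg] at h4
    have h6 := F.norm_add_le_of_le (F.norm_sub_le_of_le (nb h02 h20) (nb le_rfl h22)) h3
    rw [h4, mul_comm] at h6
    exact le_of_mul_le_mul_left h6 hδ
  have h11 : ‖F.mat g' 1 1‖ ≤ ‖F.mat g' 0 0‖ := by
    have h5 : F.Jinv 1 1 = 1 := by simp [Jinv]
    rw [h5, mul_one] at r11
    have h6 : F.mat g' 1 1 * F.conj (F.mat g' 1 1) = ι (F.similitude g') -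
        (F.δ * (F.mat g' 1 2 * F.conj (F.mat g' 1 0)) -
          F.δ * (F.mat g' 1 0 * F.conj (F.mat g' 1 2))) := by
      linear_combination r11
    have h7 := congrArg norm h6
    rw [norm_mul, F.norm_conj hp, ← pow_two] at h7
    have h8 : ‖F.δ‖ * ‖F.mat g' 0 0‖ ^ 2 ≤ ‖F.mat g' 0 0‖ ^ 2 :=
      mul_le_of_le_one_left (by positivity) hδ1.le
    have h9 := F.norm_sub_le_of_le hμ
      ((F.norm_sub_le_of_le (nb h12 h10) (nb h10 h12)).trans h8)
    rw [← h7] at h9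
    exact (sq_le_sq₀ (norm_nonneg _) (norm_nonneg _)).1 h9
  intro i j
  fin_cases i <;> fin_cases j
  · exact le_rfl
  · exact h01.trans hle
  · exact h02
  · exact h10
  · exact h11
  · exact h12
  · exact h20
  · exact h21.trans hle
  · exact h22

/-- With a dominant entry at (0,0), integral unipotent elements clear the first column and then the
first row. What remains is a torus element whose first entry is still dominant, and this fixes the
sign of the exponent. -/
theorem cartan (F : RamifiedCompletion p E) (hp : p ≠ 2) (g : F.G) :
    ∃ k ∈ F.K, ∃ k' ∈ F.K, ∃ (n : ℕ) (m : ℤ), g = k * F.tor (-n) m * k' := by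
  obtain ⟨κ, hκ, κ', hκ', hmax⟩ := F.exists_max_entry hp g
  set g' := κ * g * κ' with hg'
  have h00 : F.mat g' 0 0 ≠ 0 := by
    intro h0
    have h := hmax 2 0
    rw [h0, norm_zero, norm_le_zero_iff] at h
    exact (F.corner_ne_zero g').elim (· h0) (· h)
  have h00' : 0 < ‖F.mat g' 0 0‖ := norm_pos_iff.2 h00
  obtain ⟨y, r, hy, hr, h1, h2, h0⟩ := F.exists_low_mul h00
  have hlow : F.low y r ∈ F.K := by
    refine F.low_mem_K hp ?_ ?_
    · rw [hy, norm_div]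
      exact div_le_one_of_le₀ (hmax 1 0) (norm_nonneg _)
    · rw [hr, norm_div]
      exact div_le_one_of_le₀ (hmax 2 0) (norm_nonneg _)
  set b := (F.low y r)⁻¹ * g' with hb
  obtain ⟨d, r', t, hdec⟩ := F.upper_decomp h1 h2
  obtain ⟨d', s, hu⟩ := F.exists_T_mul_uni t⁻¹ d r'
  have hbt : b = t * F.uni d' s := by
    rw [hdec, ← mul_inv_cancel_left (t : F.G) (F.uni d r'), ← Subgroup.coe_inv, hu, mul_assoc,
      mul_assoc, Subgroup.coe_inv, inv_mul_cancel, mul_one]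
  obtain ⟨t₁, t₂, t₃, ht, rfl⟩ := F.exists_torusElt_eq t
  have hrow : ∀ j, F.mat g' 0 j = t₁ * F.mat (F.uni d' s) 0 j := fun j => by
    rw [← h0, hbt, mat_mul, mat_torusElt]
    simp [Matrix.mul_apply, Fin.sum_univ_three]
  have ht₁ : F.mat g' 0 0 = t₁ := by
    rw [hrow, mat_uni]; simp
  have huK : F.uni d' s ∈ F.K := by
    apply F.uni_mem_K_of_norm_le hp
    -- The entry (0,1) is t₁·δ·conj d', so the extra ‖δ‖ in the row estimate is what makes d'
    -- integral.
    · have h3 := F.norm_row_le hp g' (i := 0) (by simp) le_rfl (hmax 0 2)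
      rw [hrow 1, mat_uni, ht₁] at h3
      simp only [of_apply, cons_val', cons_val_one, cons_val_zero, norm_mul, F.norm_conj hp,
        mul_comm ‖(t₁ : E)‖] at h3
      have h4 : 0 < ‖F.δ‖ * ‖(t₁ : E)‖ := mul_pos F.norm_δ_pos (norm_pos_iff.2 t₁.ne_zero)
      nlinarith
    · have h3 := hmax 0 2
      rw [hrow 2, mat_uni, ht₁] at h3
      simp only [of_apply, cons_val', cons_val, cons_val_zero, norm_mul (t₁ : E)] at h3
      have h4 : 0 < ‖(t₁ : E)‖ := norm_pos_iff.2 t₁.ne_zero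
      nlinarith
  -- Multiplication by elements of K on either side does not increase the largest norm of an entry,
  -- which is ‖t₁‖.
  have htle : ‖(t₃ : E)‖ ≤ ‖(t₁ : E)‖ := by
    have h3 : (F.torusElt t₁ t₂ t₃ ht : F.G) = (F.low y r)⁻¹ * g' * (F.uni d' s)⁻¹ := by
      rw [← hb, hbt, mul_inv_cancel_right]
    have h4 := F.norm_mul_apply_le (F.norm_mul_apply_le
      ((F.mem_K_iff hp _).1 (inv_mem hlow)).1 hmax)
      ((F.mem_K_iff hp _).1 (inv_mem huK)).1 2 2
    rw [← mat_mul, ← mat_mul, ← h3, mat_torusElt, ht₁] at h4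
    simpa using h4
  obtain ⟨n, m, k, hk, hnm, n1, -, n3⟩ := F.exists_tor_mul hp (F.torusElt t₁ t₂ t₃ ht)
  rw [mat_torusElt] at n1 n3
  simp at n1 n3
  rw [n1, n3, F.norm_δ_zpow_le hp] at htle
  have hn : -(n.natAbs : ℤ) = n := by omega
  refine ⟨κ⁻¹ * F.low y r, mul_mem (inv_mem hκ) hlow, k * F.uni d' s * κ'⁻¹,
    mul_mem (mul_mem hk huK) (inv_mem hκ'), n.natAbs, m, ?_⟩
  rw [hn]
  calc g = κ⁻¹ * F.low y r * b * κ'⁻¹ := by rw [hb, hg']; group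
    _ = _ := by
      rw [hbt, hnm, Subgroup.coe_mul]
      simp only [mul_assoc]

/-! ### Topology of `K` -/

theorem isOpen_setOf_norm_le_one (_F : RamifiedCompletion p E) {X : Type*} [TopologicalSpace X]
    {f : X → E} (hf : Continuous f) : IsOpen {x | ‖f x‖ ≤ 1} := by
  have : IsUltrametricDist E := IsUltrametricDist.of_normedAlgebra ℚ_[p]
  have := (IsUltrametricDist.isOpen_closedBall (0 : E) one_ne_zero).preimage hf
  simpa [Set.preimage, Metric.mem_closedBall, dist_zero_right] using this

theorem continuous_mat_apply (F : RamifiedCompletion p E) (i j : Fin 3) :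
    Continuous fun g : F.G => F.mat g i j :=
  (Units.continuous_val.comp continuous_subtype_val).matrix_elem i j

theorem isOpen_K (F : RamifiedCompletion p E) : IsOpen (F.K : Set F.G) := by
  have h : (F.K : Set F.G) =
      ⋂ i, ⋂ j, {g | ‖F.mat g i j‖ ≤ 1} ∩ {g | ‖F.mat g⁻¹ i j‖ ≤ 1} := by
    ext g
    simp only [Set.mem_iInter]
    exact Iff.rfl
  rw [h]
  refine isOpen_iInter_of_finite fun i => isOpen_iInter_of_finite fun j => ?_
  exact (F.isOpen_setOf_norm_le_one (F.continuous_mat_apply i j)).inter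
    (F.isOpen_setOf_norm_le_one ((F.continuous_mat_apply i j).comp continuous_inv))

theorem continuous_conj (F : RamifiedCompletion p E) (hp : p ≠ 2) : Continuous F.conj :=
  (AddMonoidHomClass.isometry_of_norm F.conj (F.norm_conj hp)).continuous

/-- Membership says that g*Jg lies on the line ℚ_p·J, a closed subspace. The zero multiple cannot
occur as g is invertible. -/
theorem isClosed_G (F : RamifiedCompletion p E) (hp : p ≠ 2) :
    IsClosed (F.G : Set (GL (Fin 3) E)) := by
  have h : (F.G : Set (GL (Fin 3) E)) = (fun g : GL (Fin 3) E => F.star g.val * F.J * g.val) ⁻¹'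
      (Submodule.span ℚ_[p] {F.J} : Submodule ℚ_[p] (Matrix (Fin 3) (Fin 3) E)) := by
    ext g
    simp only [Set.mem_preimage, SetLike.mem_coe, Submodule.mem_span_singleton]
    constructor
    · rintro ⟨m, hm⟩
      exact ⟨m, hm.symm⟩
    · rintro ⟨m, hm⟩
      have hm0 : m ≠ 0 := by
        rintro rfl
        rw [zero_smul] at hm
        have h1 : g.val * (g⁻¹).val = 1 := by rw [← Units.val_mul]; simp
        have h2 : F.star (g⁻¹).val * F.star g.val = 1 := by rw [← star_mul, h1, star_one]
        have h3 : F.J = 0 := by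
          calc F.J = (F.star (g⁻¹).val * F.star g.val) * F.J * (g.val * (g⁻¹).val) := by
                rw [h1, h2]; simp
            _ = F.star (g⁻¹).val * (F.star g.val * F.J * g.val) * (g⁻¹).val := by
                simp only [Matrix.mul_assoc]
            _ = _ := by rw [← hm]; simp
        have := congrFun (congrFun h3 1) 1
        simp [J] at this
      exact ⟨Units.mk0 m hm0, hm.symm⟩
  rw [h]
  refine (Submodule.closed_of_finiteDimensional _).preimage ?_
  have hs : Continuous fun g : GL (Fin 3) E => F.star g.val :=
    (Units.continuous_val.matrix_map (F.continuous_conj hp)).matrix_transpose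
  exact (hs.mul continuous_const).mul Units.continuous_val

/-- E_p is locally compact, and K consists of the g in the closed group G for which both g and g⁻¹
stay in a compact box. -/
theorem compactSpace_K (F : RamifiedCompletion p E) (hp : p ≠ 2) : CompactSpace F.K := by
  have := F.finiteDimensional
  have : ProperSpace E := FiniteDimensional.proper ℚ_[p] E
  have hc : IsCompact {g : GL (Fin 3) E | ∀ i j, ‖g.val i j‖ ≤ 1 ∧ ‖(g⁻¹).val i j‖ ≤ 1} := by
    let B : Set (Matrix (Fin 3) (Fin 3) E) :=
      Set.pi Set.univ fun _ => Set.pi Set.univ fun _ => Metric.closedBall 0 1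
    have hB : IsCompact B := isCompact_univ_pi fun _ => isCompact_univ_pi fun _ =>
      isCompact_closedBall _ _
    have := Units.isClosedEmbedding_embedProduct.isCompact_preimage
      (hB.prod (hB.image MulOpposite.continuous_op))
    convert this using 1
    ext g
    constructor
    · intro h
      exact ⟨fun i _ j _ => mem_closedBall_zero_iff.2 (h i j).1,
        _, fun i _ j _ => mem_closedBall_zero_iff.2 (h i j).2, rfl⟩
    · rintro ⟨h1, M, h2, h3⟩ i j
      have h3' : M = (g⁻¹).val := MulOpposite.op_injective h3
      subst h3'
      exact ⟨mem_closedBall_zero_iff.1 (h1 i trivial j trivial),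
        mem_closedBall_zero_iff.1 (h2 i trivial j trivial)⟩
  have hK : IsCompact (F.K : Set F.G) := by
    have := (F.isClosed_G hp).isClosedEmbedding_subtypeVal.isCompact_preimage hc
    exact this
  exact isCompact_iff_compactSpace.1 hK

theorem finite_quotient_of_isOpen (F : RamifiedCompletion p E) (hp : p ≠ 2) {S : Subgroup F.G}
    (hS : IsOpen (S : Set F.G)) : Finite (F.K ⧸ S.subgroupOf F.K) :=
  have := F.compactSpace_K hp
  Subgroup.quotient_finite_of_isOpen _ (hS.preimage continuous_subtype_val)

end RamifiedCompletion

/-! ### Averaging over a group acting through finite quotients -/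

section Averaging

variable {K V : Type*} [Group K] [AddCommGroup V] [Module ℂ V] (ρ : Representation ℂ K V)

/-- The stabilizer of a vector. -/
def vectorStabilizer (x : V) : Subgroup K where
  carrier := {k | ρ k x = x}
  one_mem' := by simp
  mul_mem' := by
    intro a b ha hb
    change ρ (a * b) x = x
    rw [map_mul, Module.End.mul_apply, show ρ b x = x from hb, show ρ a x = x from ha]
  inv_mem' := by
    intro a ha
    change ρ a⁻¹ x = x
    conv_lhs => rw [← show ρ a x = x from ha]
    simp

theorem apply_out_mk {S : Subgroup K} {x : V} (h : ∀ s ∈ S, ρ s x = x) (k : K) :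
    ρ (Quotient.out (k : K ⧸ S)) x = ρ k x := by
  obtain ⟨s, hs⟩ := QuotientGroup.mk_out_eq_mul S k
  have hs' : Quotient.out (k : K ⧸ S) = k * s := hs
  rw [hs', map_mul, Module.End.mul_apply, h _ s.2]

theorem apply_sum_out {S : Subgroup K} [Fintype (K ⧸ S)] {x : V} (h : ∀ s ∈ S, ρ s x = x) (k : K) :
    ρ k (∑ q : K ⧸ S, ρ q.out x) = ∑ q : K ⧸ S, ρ q.out x := by
  rw [map_sum]
  refine Fintype.sum_equiv (MulAction.toPerm k) _ _ fun q => ?_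
  induction q using QuotientGroup.induction_on with
  | H a =>
    change _ = ρ (Quotient.out ((k * a : K) : K ⧸ S)) x
    rw [apply_out_mk ρ h, apply_out_mk ρ h, map_mul, Module.End.mul_apply]

/-- Summation over a finite quotient of K kills every difference ρ(k)x - x but multiplies an
invariant vector by the order of the quotient. -/
theorem disjoint_invariants_coinvariantsKer
    (hfin : ∀ x, (vectorStabilizer ρ x).FiniteIndex) :
    Disjoint ρ.invariants (Representation.Coinvariants.ker ρ) := by
  rw [Submodule.disjoint_def]
  intro y hy hy'
  -- The claim is made for all smaller normal subgroups so that two summands can be treated at a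
  -- common level. Normality lets right multiplication by k permute the cosets.
  have key : ∃ S : Subgroup K, S.Normal ∧ S.FiniteIndex ∧ ∀ S' : Subgroup K, S'.Normal → S' ≤ S →
      ∀ _ : Fintype (K ⧸ S'), ∑ q : K ⧸ S', ρ q.out y = 0 := by
    clear hy
    induction hy' using Submodule.span_induction with
    | mem y hy =>
      obtain ⟨⟨k, x⟩, rfl⟩ := hy
      have := hfin x
      refine ⟨(vectorStabilizer ρ x).normalCore, inferInstance, inferInstance, ?_⟩
      intro S' hS' hle _
      have hx : ∀ s ∈ S', ρ s x = x := fun s hs =>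
        (vectorStabilizer ρ x).normalCore_le (hle hs)
      have hkx : ∀ s ∈ S', ρ s (ρ k x) = ρ k x := fun s hs => by
        rw [← Module.End.mul_apply, ← map_mul, show s * k = k * (k⁻¹ * s * k) by group, map_mul,
          Module.End.mul_apply, hx _ (by simpa using hS'.conj_mem s hs k⁻¹)]
      simp only [map_sub, Finset.sum_sub_distrib]
      rw [sub_eq_zero]
      refine Fintype.sum_equiv (Equiv.mulRight (k : K ⧸ S')) _ _ fun q => ?_
      induction q using QuotientGroup.induction_on with
      | H a =>
        change _ = ρ (Quotient.out ((a * k : K) : K ⧸ S')) x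
        rw [apply_out_mk ρ hkx, apply_out_mk ρ hx, map_mul, Module.End.mul_apply]
    | zero => exact ⟨⊤, inferInstance, inferInstance, by simp⟩
    | add a b _ _ ha hb =>
      obtain ⟨S, h1, h2, h3⟩ := ha
      obtain ⟨S', h1', h2', h3'⟩ := hb
      refine ⟨S ⊓ S', inferInstance, inferInstance, fun T hT hle _ => ?_⟩
      simp only [map_add, Finset.sum_add_distrib]
      rw [h3 T hT (hle.trans inf_le_left), h3' T hT (hle.trans inf_le_right), add_zero]
    | smul c a _ ha =>
      obtain ⟨S, h1, h2, h3⟩ := ha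
      refine ⟨S, h1, h2, fun T hT hle _ => ?_⟩
      simp only [map_smul, ← Finset.smul_sum]
      rw [h3 T hT hle, smul_zero]
  obtain ⟨S, h1, h2, h3⟩ := key
  have := Fintype.ofFinite (K ⧸ S)
  have h4 := h3 S h1 le_rfl inferInstance
  have h5 : ∀ k, ρ k y = y := hy
  simp only [h5, Finset.sum_const, Finset.card_univ] at h4
  rw [← Nat.cast_smul_eq_nsmul ℂ] at h4
  exact (smul_eq_zero.1 h4).resolve_left (by simp)

/-- A vector is its average over a finite orbit plus a combination of differences ρ(k)x - x. -/
theorem isCompl_invariants_coinvariantsKer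
    (hfin : ∀ x, (vectorStabilizer ρ x).FiniteIndex) :
    IsCompl ρ.invariants (Representation.Coinvariants.ker ρ) := by
  refine ⟨disjoint_invariants_coinvariantsKer ρ hfin, codisjoint_iff.2 ?_⟩
  rw [eq_top_iff]
  intro x _
  have := hfin x
  have := Fintype.ofFinite (K ⧸ vectorStabilizer ρ x)
  set n : ℂ := (Fintype.card (K ⧸ vectorStabilizer ρ x) : ℂ)
  have hn : n ≠ 0 := by simp [n]
  have h1 : x = n⁻¹ • (∑ q : K ⧸ vectorStabilizer ρ x, ρ q.out x) +
      -(n⁻¹ • ∑ q : K ⧸ vectorStabilizer ρ x, (ρ q.out x - x)) := by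
    rw [Finset.sum_sub_distrib, smul_sub, neg_sub, add_sub_cancel, Finset.sum_const,
      Finset.card_univ, ← Nat.cast_smul_eq_nsmul ℂ, smul_smul, inv_mul_cancel₀ hn, one_smul]
  rw [h1]
  refine Submodule.add_mem_sup (Submodule.smul_mem _ _ ?_) (Submodule.neg_mem _
    (Submodule.smul_mem _ _ (Submodule.sum_mem _ fun q _ => ?_)))
  · exact fun k => apply_sum_out ρ (fun s hs => hs) k
  · exact Representation.Coinvariants.sub_mem_ker _ _

/-- There is a linear projection onto the invariants which is constant on orbits. -/
theorem exists_invariants_projection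
    (hfin : ∀ x, (vectorStabilizer ρ x).FiniteIndex) :
    ∃ e : V →ₗ[ℂ] V, (∀ x, ∀ k, ρ k (e x) = e x) ∧
    (∀ x, (∀ k, ρ k x = x) → e x = x) ∧ ∀ k x, e (ρ k x) = e x := by
  have hc := isCompl_invariants_coinvariantsKer ρ hfin
  refine ⟨ρ.invariants.subtype ∘ₗ Submodule.projectionOnto _ _ hc, fun x k => ?_,
    fun x hx => ?_, fun k x => ?_⟩
  · exact (Submodule.projectionOnto _ _ hc x).2 k
  · exact congrArg Subtype.val (Submodule.projectionOnto_apply_left hc ⟨x, hx⟩)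
  · rw [← sub_eq_zero, ← map_sub, LinearMap.comp_apply,
      Submodule.projectionOnto_apply_of_mem_right hc
        (Representation.Coinvariants.sub_mem_ker k x), map_zero]

end Averaging

namespace RamifiedCompletion

variable {p : ℕ} [Fact p.Prime] {E : Type*} [NormedField E] [NormedAlgebra ℚ_[p] E]

local notation "ι" => algebraMap ℚ_[p] E

/-! ### Multiplicity one for vectors fixed by `K` -/

theorem norm_similitude_tor (F : RamifiedCompletion p E) (n m : ℤ) (hp : p ≠ 2) :
    ‖(F.similitude (F.tor n m) : ℚ_[p])‖ = ‖F.δ‖ ^ (2 * m) := by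
  have h := F.col_rel (F.tor n m) 1 1
  rw [mat_tor] at h
  simp [J] at h
  have h2 := congrArg norm h
  rw [norm_mul, norm_zpow, norm_zpow, F.norm_conj hp, norm_algebraMap',
    ← zpow_add₀ F.norm_δ_pos.ne', ← two_mul] at h2
  exact h2.symm

theorem norm_tor_neg_le (F : RamifiedCompletion p E) (hp : p ≠ 2) (n : ℕ) (i j : Fin 3) :
    ‖F.mat (F.tor (-n) 0) i j‖ ≤ ‖F.δ‖ ^ (-n : ℤ) := by
  have hδ := F.norm_δ_pos
  have h0 : (0 : ℝ) ≤ ‖F.δ‖ ^ (-n : ℤ) := (zpow_pos hδ _).le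
  have h1 : ‖F.δ‖ ^ (n : ℤ) ≤ ‖F.δ‖ ^ (-n : ℤ) := by
    rw [F.norm_δ_zpow_le hp]; omega
  have h2 : 1 ≤ ‖F.δ‖ ^ (-n : ℤ) := by
    rw [← zpow_zero ‖F.δ‖, F.norm_δ_zpow_le hp]; omega
  rw [mat_tor]
  fin_cases i <;> fin_cases j <;> simp at h0 h1 h2 ⊢ <;> assumption

theorem zz_central (F : RamifiedCompletion p E) (g : F.G) : g * F.zz = F.zz * g := by
  apply F.G_ext
  rw [mat_mul, mat_mul, zz, mat_torusElt]
  ext i j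
  fin_cases i <;> fin_cases j <;> simp [Matrix.mul_apply, Fin.sum_univ_three, mul_comm]

theorem eq_top_of_stable {G V : Type*} [Group G] [AddCommGroup V] [Module ℂ V]
    {π : Representation ℂ G V} (hirr : π.IsIrreducible) {N : Submodule ℂ V}
    (hN : ∀ g, ∀ x ∈ N, π g x ∈ N) {x : V} (hx : x ∈ N) (hx0 : x ≠ 0) : N = ⊤ := by
  have h := hirr.eq_bot_or_eq_top (⟨N, fun g x hx => hN g x hx⟩ : Subrepresentation π)
  rcases h with h | h
  · exfalso
    have h2 : N = ⊥ := congrArg Subrepresentation.toSubmodule h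
    rw [h2] at hx
    exact hx0 ((Submodule.mem_bot ℂ).1 hx)
  · exact congrArg Subrepresentation.toSubmodule h

section

variable {V : Type*} [AddCommGroup V] [Module ℂ V]

theorem finiteIndex_vectorStabilizer (F : RamifiedCompletion p E) (hp : p ≠ 2)
    {π : Representation ℂ F.G V} {x : V} (h : IsOpen {g : F.G | π g x = x}) :
    (vectorStabilizer (π.comp F.K.subtype) x).FiniteIndex := by
  have := F.finite_quotient_of_isOpen hp (S := vectorStabilizer π x) h
  exact Subgroup.finiteIndex_of_finite_quotient
    (H := (vectorStabilizer π x).subgroupOf F.K)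

theorem finiteDimensional_invariants (F : RamifiedCompletion p E) {π : Representation ℂ F.G V}
    (hadm : F.IsAdmissible π) :
    FiniteDimensional ℂ (Representation.invariants (π.comp F.K.subtype)) :=
  hadm.2 F.K F.isOpen_K

/-- The central element `diag(ϖ, ϖ, ϖ)` acts by a scalar. -/
theorem exists_central_scalar (F : RamifiedCompletion p E) {π : Representation ℂ F.G V}
    (hirr : π.IsIrreducible) (hadm : F.IsAdmissible π) {v : V} (hv0 : v ≠ 0)
    (hv : ∀ k ∈ F.K, π k v = v) : ∃ ω : ℂ, ω ≠ 0 ∧ ∀ x, π F.zz x = ω • x := by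
  have hcomm : ∀ g x, π g (π F.zz x) = π F.zz (π g x) := fun g x => by
    rw [← Module.End.mul_apply, ← Module.End.mul_apply, ← map_mul, ← map_mul, zz_central]
  have := F.finiteDimensional_invariants hadm
  let X := Representation.invariants (π.comp F.K.subtype)
  have hX : ∀ x ∈ X, π F.zz x ∈ X := fun x hx k => by
    change π k (π F.zz x) = π F.zz x
    rw [hcomm]
    exact congrArg _ (hx k)
  have : Nontrivial X := ⟨⟨v, fun k => hv k k.2⟩, 0, fun h => hv0 (congrArg Subtype.val h)⟩
  -- Schur's lemma by way of admissibility: the central element preserves the finite-dimensional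
  -- space of K-fixed vectors, and any of its eigenspaces in V is stable under G.
  obtain ⟨ω, hω⟩ := Module.End.exists_eigenvalue ((π F.zz).restrict hX)
  obtain ⟨w, hw⟩ := hω.exists_hasEigenvector
  have hw1 : π F.zz w = ω • (w : V) := congrArg Subtype.val hw.apply_eq_smul
  have hw0 : (w : V) ≠ 0 := fun h => hw.2 (Subtype.ext h)
  have htop : Module.End.eigenspace (π F.zz) ω = ⊤ := by
    refine eq_top_of_stable hirr (fun g x hx => ?_) (Module.End.mem_eigenspace_iff.2 hw1) hw0
    rw [Module.End.mem_eigenspace_iff] at hx ⊢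
    rw [← hcomm, hx, map_smul]
  have hall : ∀ x, π F.zz x = ω • x := fun x =>
    Module.End.mem_eigenspace_iff.1 (htop ▸ Submodule.mem_top)
  refine ⟨ω, ?_, hall⟩
  rintro rfl
  have h1 : π (F.zz : F.G)⁻¹ (π F.zz v) = v := by
    rw [← Module.End.mul_apply, ← map_mul, inv_mul_cancel, map_one, Module.End.one_apply]
  rw [hall, zero_smul, map_zero] at h1
  exact hv0 h1.symm

theorem apply_zz_zpow (F : RamifiedCompletion p E) {π : Representation ℂ F.G V} {ω : ℂ}
    (hω0 : ω ≠ 0) (hω : ∀ x, π F.zz x = ω • x) (m : ℤ) (x : V) :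
    π (F.zz ^ m : F.T) x = ω ^ m • x := by
  induction m with
  | zero => simp
  | succ n ih =>
    rw [_root_.zpow_add_one, Subgroup.coe_mul, map_mul, Module.End.mul_apply, hω, map_smul, ih,
      smul_smul, zpow_add_one₀ hω0, mul_comm]
  | pred n ih =>
    have h1 : π (F.zz : F.G)⁻¹ x = ω⁻¹ • x := by
      have h2 : π (F.zz : F.G)⁻¹ (π F.zz x) = x := by
        rw [← Module.End.mul_apply, ← map_mul, inv_mul_cancel, map_one, Module.End.one_apply]
      rw [hω, map_smul] at h2
      rw [← h2, smul_smul, inv_mul_cancel₀ hω0, one_smul, h2]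
    rw [_root_.zpow_sub_one, Subgroup.coe_mul, map_mul, Module.End.mul_apply, Subgroup.coe_inv, h1,
      map_smul, ih, smul_smul, zpow_sub_one₀ hω0, mul_comm]

theorem apply_tor (F : RamifiedCompletion p E) {π : Representation ℂ F.G V} {ω : ℂ}
    (hω0 : ω ≠ 0) (hω : ∀ x, π F.zz x = ω • x) (n m : ℤ) (x : V) :
    π (F.tor n m) x = ω ^ m • π (F.tor n 0) x := by
  have h : F.tor n m = F.tor n 0 * F.zz ^ m := by simp [tor]
  rw [h, Subgroup.coe_mul, map_mul, Module.End.mul_apply, F.apply_zz_zpow hω0 hω, map_smul]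

/-- The space of vectors fixed by `K` has dimension at most one. -/
theorem invariants_eq_span (F : RamifiedCompletion p E) (hp : p ≠ 2) {π : Representation ℂ F.G V}
    (hirr : π.IsIrreducible) (hadm : F.IsAdmissible π) {v : V} (hv0 : v ≠ 0)
    (hv : ∀ k ∈ F.K, π k v = v) {x : V} (hx : ∀ k ∈ F.K, π k x = x) : ∃ c : ℂ, x = c • v := by
  obtain ⟨ω, hω0, hω⟩ := F.exists_central_scalar hirr hadm hv0 hv
  obtain ⟨e, he1, he2, he3⟩ := exists_invariants_projection (π.comp F.K.subtype)
    fun x => F.finiteIndex_vectorStabilizer hp (hadm.1 x)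
  have := F.finiteDimensional_invariants hadm
  let X := Representation.invariants (π.comp F.K.subtype)
  have : Nontrivial X := ⟨⟨v, fun k => hv k k.2⟩, 0, fun h => hv0 (congrArg Subtype.val h)⟩
  -- One operator is enough: T = `e ∘ₗ π (F.tor (-1) 0)` on the K-fixed vectors. The remaining steps
  -- show that the line of an eigenvector w of T is all of the K-fixed space.
  obtain ⟨l, hl⟩ := Module.End.exists_eigenvalue
    ((e ∘ₗ π (F.tor (-1) 0)).restrict (p := X) (q := X) fun x _ k => he1 _ k)
  obtain ⟨⟨w, hwX⟩, hw⟩ := hl.exists_hasEigenvector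
  have hw1 : e (π (F.tor (-1) 0) w) = l • w := congrArg Subtype.val hw.apply_eq_smul
  have hw0 : w ≠ 0 := fun h => hw.2 (Subtype.ext h)
  have hwK : ∀ k ∈ F.K, π k w = w := fun k hk => hwX ⟨k, hk⟩
  have he3' : ∀ k ∈ F.K, ∀ x, e (π k x) = e x := fun k hk x => he3 ⟨k, hk⟩ x
  set L := Submodule.span ℂ {w} with hL
  have hwL : w ∈ L := Submodule.mem_span_singleton_self w
  have hδ := F.norm_δ_pos
  have hcart : ∀ k ∈ F.K, ∀ k' ∈ F.K, ∀ n m : ℤ,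
      e (π (k * F.tor n m * k') w) = ω ^ m • e (π (F.tor n 0) w) := fun k hk k' hk' n m => by
    rw [map_mul, map_mul, Module.End.mul_apply, Module.End.mul_apply, he3' k hk, hwK k' hk',
      F.apply_tor hω0 hω, map_smul]
  -- T generates the Hecke operators modulo the centre. Put Eⱼ = `e (π (F.tor (-j) 0) w)`. Applying
  -- T to the K-orbit sum of `π (F.tor (-n) 0) w` gives a sum of vectors Eⱼ with j ≤ n + 1 in which
  -- Eₙ₊₁ occurs, so Eₙ₊₁ can be solved for.
  have key : ∀ n : ℕ, ∀ j ≤ n, e (π (F.tor (-j) 0) w) ∈ L := by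
    intro n
    induction n with
    | zero =>
      intro j hj
      obtain rfl : j = 0 := by omega
      have : F.tor (-(0 : ℕ)) 0 = 1 := by simp [tor]
      rw [this, Subgroup.coe_one, map_one, Module.End.one_apply, he2 w hwX]
      exact hwL
    | succ n ih =>
      intro j hj
      rcases Nat.lt_or_eq_of_le hj with hj | rfl
      · exact ih j (by omega)
      set xn := π (F.tor (-n) 0) w with hxn
      have := F.finiteIndex_vectorStabilizer hp (hadm.1 xn)
      have := Fintype.ofFinite (F.K ⧸ vectorStabilizer (π.comp F.K.subtype) xn)
      have hstab : ∀ s ∈ vectorStabilizer (π.comp F.K.subtype) xn, π.comp F.K.subtype s xn = xn :=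
        fun s hs => hs
      have hsum := apply_sum_out (π.comp F.K.subtype) hstab
      set Y := ∑ q : F.K ⧸ vectorStabilizer (π.comp F.K.subtype) xn,
        π.comp F.K.subtype q.out xn with hY
      have hYe : Y ∈ L := by
        rw [← he2 Y hsum, hY, map_sum]
        refine Submodule.sum_mem _ fun q _ => ?_
        rw [he3]
        exact ih n le_rfl
      have hYT : e (π (F.tor (-1) 0) Y) ∈ L := by
        obtain ⟨c, hc⟩ := Submodule.mem_span_singleton.1 hYe
        rw [← hc, map_smul, map_smul, hw1]
        exact Submodule.smul_mem _ _ (Submodule.smul_mem _ _ hwL)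
      set En := e (π (F.tor (-(n + 1 : ℕ)) 0) w) with hEn
      have hterm : ∀ q : F.K ⧸ vectorStabilizer (π.comp F.K.subtype) xn,
          e (π (F.tor (-1) 0) (π.comp F.K.subtype q.out xn)) ∈ L ∨
          e (π (F.tor (-1) 0) (π.comp F.K.subtype q.out xn)) = En := by
        intro q
        have h1 : π (F.tor (-1) 0) (π.comp F.K.subtype q.out xn) =
            π (F.tor (-1) 0 * (q.out : F.K) * F.tor (-n) 0) w := by
          rw [map_mul, map_mul]; rfl
        set g : F.G := F.tor (-1) 0 * (q.out : F.K) * F.tor (-n) 0 with hg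
        obtain ⟨k, hk, k', hk', j, m, hgk⟩ := F.cartan hp g
        have hm : m = 0 := by
          have h2 := congrArg (fun g => ‖(F.similitude g : ℚ_[p])‖) (hg.symm.trans hgk)
          simp only [similitude_mul, Units.val_mul, norm_mul, F.norm_similitude_tor _ _ hp,
            ((F.mem_K_iff hp _).1 hk).2, ((F.mem_K_iff hp _).1 hk').2,
            ((F.mem_K_iff hp _).1 (q.out : F.K).2).2] at h2
          have h3 : ‖F.δ‖ ^ (0 : ℤ) = ‖F.δ‖ ^ (2 * m) := by simpa using h2
          have := F.norm_δ_zpow_injective hp h3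
          omega
        subst hm
        -- The entries of the product are bounded by ‖δ‖^(-1-n), while `F.tor (-j) 0` has the entry
        -- δ⁻ʲ.
        have hj : j ≤ n + 1 := by
          have h2 : (F.tor (-j) 0 : F.G) = k⁻¹ * g * k'⁻¹ := by rw [hgk]; group
          have hb := F.norm_mul_apply_le (F.norm_mul_apply_le
            ((F.mem_K_iff hp _).1 (inv_mem hk)).1
            (F.norm_mul_apply_le (F.norm_mul_apply_le (F.norm_tor_neg_le hp 1)
              ((F.mem_K_iff hp _).1 (q.out : F.K).2).1) (F.norm_tor_neg_le hp n)))
            ((F.mem_K_iff hp _).1 (inv_mem hk')).1 0 0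
          have h4 := congrArg (fun g => ‖F.mat g 0 0‖) h2
          simp only [mat_mul, hg] at h4
          rw [Nat.cast_one, ← h4, mat_tor] at hb
          simp only [of_apply, cons_val', cons_val_zero, norm_zpow, one_mul, mul_one, add_zero] at hb
          rw [← zpow_add₀ hδ.ne', F.norm_δ_zpow_le hp] at hb
          omega
        rw [h1, hgk, hcart k hk k' hk', zpow_zero, one_smul]
        rcases Nat.lt_or_eq_of_le hj with hj | rfl
        · exact Or.inl (ih j (by omega))
        · exact Or.inr rfl
      classical
      set A := Finset.univ.filter fun q : F.K ⧸ vectorStabilizer (π.comp F.K.subtype) xn =>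
          e (π (F.tor (-1) 0) (π.comp F.K.subtype q.out xn)) = En with hA
      have hsplit : e (π (F.tor (-1) 0) Y) = (A.card : ℂ) • En +
          ∑ q ∈ Aᶜ, e (π (F.tor (-1) 0) (π.comp F.K.subtype q.out xn)) := by
        rw [hY, map_sum, map_sum, ← Finset.sum_add_sum_compl A]
        congr 1
        rw [Finset.sum_congr rfl fun q hq => (Finset.mem_filter.1 hq).2, Finset.sum_const,
          Nat.cast_smul_eq_nsmul]
      -- The trivial coset contributes Eₙ₊₁, so its multiplicity is nonzero in ℂ.
      have hAne : A.card ≠ 0 := by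
        refine Finset.card_ne_zero_of_mem (a := ((1 : F.K) : F.K ⧸ _)) ?_
        rw [hA, Finset.mem_filter]
        refine ⟨Finset.mem_univ _, ?_⟩
        have h7 : F.tor (-(n + 1 : ℕ)) 0 = F.tor (-1) 0 * F.tor (-n) 0 := by
          rw [tor_mul]
          congr 1
          push_cast; ring
        rw [apply_out_mk _ hstab, map_one, Module.End.one_apply, hEn, hxn, h7, Subgroup.coe_mul,
          map_mul, Module.End.mul_apply]
      have h5 : (A.card : ℂ) • En ∈ L := by
        rw [← add_sub_cancel_right ((A.card : ℂ) • En)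
          (∑ q ∈ Aᶜ, e (π (F.tor (-1) 0) (π.comp F.K.subtype q.out xn))), ← hsplit]
        refine Submodule.sub_mem _ hYT (Submodule.sum_mem _ fun q hq => ?_)
        refine (hterm q).resolve_right fun h => ?_
        exact Finset.mem_compl.1 hq (Finset.mem_filter.2 ⟨Finset.mem_univ _, h⟩)
      have h6 := L.smul_mem (A.card : ℂ)⁻¹ h5
      rwa [smul_smul, inv_mul_cancel₀ (by exact_mod_cast hAne), one_smul] at h6
  have hall : ∀ g, e (π g w) ∈ L := by
    intro g
    obtain ⟨k, hk, k', hk', n, m, rfl⟩ := F.cartan hp g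
    rw [hcart k hk k' hk']
    exact Submodule.smul_mem _ _ (key n n le_rfl)
  -- The vectors whose whole G-orbit projects into the line L: a G-stable subspace containing w,
  -- hence everything.
  let N : Submodule ℂ V := ⨅ g, (L.comap e).comap (π g)
  have hN : N = ⊤ := by
    refine eq_top_of_stable hirr (fun g x hx => ?_)
      ((Submodule.mem_iInf _).2 fun g => hall g) hw0
    rw [Submodule.mem_iInf] at hx ⊢
    intro h
    have := hx (h * g)
    rw [map_mul] at this
    exact this
  have hmem : ∀ x, (∀ k ∈ F.K, π k x = x) → x ∈ L := by
    intro x hx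
    have h1 := (Submodule.mem_iInf _).1 (hN ▸ Submodule.mem_top : x ∈ N) 1
    rw [map_one] at h1
    have h2 : e x ∈ L := h1
    rwa [he2 x fun k => hx k k.2] at h2
  obtain ⟨c, hc⟩ := Submodule.mem_span_singleton.1 (hmem v hv)
  obtain ⟨c', hc'⟩ := Submodule.mem_span_singleton.1 (hmem x hx)
  have hc0 : c ≠ 0 := by
    rintro rfl
    exact hv0 (by rw [← hc, zero_smul])
  refine ⟨c' * c⁻¹, ?_⟩
  rw [← hc, ← hc', smul_smul, inv_mul_cancel_right₀ hc0]

end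

/-! ### The Hecke operator of `K diag(ϖ, 1, conj ϖ⁻¹) K` -/

theorem tor_mul_uni (F : RamifiedCompletion p E) (n m : ℤ) (d : E) (r : ℚ_[p]) :
    (F.tor n m : F.G) * F.uni d r =
      F.uni ((-F.δ) ^ n * d) ((F.D : ℚ_[p]) ^ n * r) * F.tor n m := by
  have hδ := F.δ_ne_zero
  have hD : (ι (F.D : ℚ_[p])) = F.δ * (-F.δ) := by
    rw [map_natCast]; linear_combination F.δ_sq
  obtain ⟨t₁, t₂, t₃, h, ht⟩ := F.exists_torusElt_eq (F.tor n m)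
  have hm := F.mat_tor n m
  rw [ht, mat_torusElt] at hm
  have h1 : (t₁ : E) = F.δ ^ (n + m) := congrFun (congrFun hm 0) 0
  have h2 : (t₂ : E) = F.δ ^ m := congrFun (congrFun hm 1) 1
  have h3 : (t₃ : E) = (-F.δ) ^ (-n) * F.δ ^ m := congrFun (congrFun hm 2) 2
  rw [ht, F.torusElt_mul_uni t₁ t₂ t₃ h d (s := (F.D : ℚ_[p]) ^ n * r)]
  · congr 3
    have : (-F.δ) ^ n ≠ 0 := zpow_ne_zero _ (neg_ne_zero.2 hδ)
    rw [h2, h3, _root_.zpow_neg]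
    field_simp
  · have : (-F.δ) ^ n ≠ 0 := zpow_ne_zero _ (neg_ne_zero.2 hδ)
    rw [h1, h3, _root_.zpow_neg, map_mul, map_zpow₀, hD, _root_.mul_zpow, zpow_add₀ hδ]
    field_simp

theorem norm_neg_δ_zpow (F : RamifiedCompletion p E) (n : ℤ) : ‖(-F.δ) ^ n‖ = ‖F.δ‖ ^ n := by
  rw [norm_zpow, norm_neg]

theorem norm_D_zpow (F : RamifiedCompletion p E) (hp : p ≠ 2) (n : ℤ) :
    ‖(F.D : ℚ_[p]) ^ n‖ = ‖F.δ‖ ^ (2 * n) := by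
  rw [norm_zpow, F.norm_D hp, ← F.norm_δ_sq hp, _root_.zpow_mul]
  norm_cast

theorem uni_tor_inv_mul (F : RamifiedCompletion p E) {d d' : E} {r r' s : ℚ_[p]} {n n' : ℤ}
    (h : ι s = F.δ * (F.conj (-d) * d' - -d * F.conj d') / 2) :
    (F.uni d r * F.tor n 0)⁻¹ * (F.uni d' r' * F.tor n' 0) =
      F.uni ((-F.δ) ^ (-n) * (d' - d)) ((F.D : ℚ_[p]) ^ (-n) * (r' - r + s)) *
        F.tor (n' - n) 0 := by
  have h1 : ((F.tor n 0 : F.G))⁻¹ = F.tor (-n) 0 := by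
    rw [← Subgroup.coe_inv, tor_inv, neg_zero]
  calc _ = (F.tor (-n) 0 : F.G) * (F.uni (-d) (-r) * F.uni d' r') * F.tor n' 0 := by
        rw [_root_.mul_inv_rev, uni_inv, h1]; group
    _ = _ := by
        rw [F.uni_mul h, tor_mul_uni, mul_assoc, ← Subgroup.coe_mul, tor_mul, add_zero,
          neg_add_eq_sub, neg_add_eq_sub, neg_add_eq_sub]

theorem uni_mem_K_iff (F : RamifiedCompletion p E) (hp : p ≠ 2) (d : E) (r : ℚ_[p]) :
    F.uni d r ∈ F.K ↔ ‖d‖ ≤ 1 ∧ ‖r‖ ≤ 1 := by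
  refine ⟨fun h => ?_, fun h => F.uni_mem_K hp h.1 h.2⟩
  have h1 := ((F.mem_K_iff hp _).1 h).1
  have hd : ‖d‖ ≤ 1 := h1 1 2
  have h2 : ‖ι r + F.δ * (d * F.conj d) / 2‖ ≤ 1 := h1 0 2
  refine ⟨hd, ?_⟩
  have h3 : ‖F.δ * (d * F.conj d) / 2‖ ≤ 1 := by
    rw [norm_div, F.norm_two_E hp, div_one, norm_mul, norm_mul, F.norm_conj hp]
    exact mul_le_one₀ (F.norm_δ_lt_one hp).le (by positivity) (mul_le_one₀ hd (norm_nonneg _) hd)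
  have := F.norm_sub_le_of_le h2 h3
  rwa [add_sub_cancel_right, norm_algebraMap'] at this

/-- Two cosets in Iwasawa form agree only if their torus components do. -/
theorem eq_of_uni_tor_mem_K (F : RamifiedCompletion p E) (hp : p ≠ 2) {d d' : E} {r r' : ℚ_[p]}
    {n n' : ℤ} (h : (F.uni d r * F.tor n 0)⁻¹ * (F.uni d' r' * F.tor n' 0) ∈ F.K) :
    n = n' ∧ ‖d' - d‖ ≤ ‖F.δ‖ ^ n ∧ (d = d' → ‖r' - r‖ ≤ ‖F.δ‖ ^ (2 * n)) := by
  have hδ := F.norm_δ_pos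
  obtain ⟨s, hs⟩ := F.exists_uni_cocycle (-d) d'
  have hle : ∀ {d d' : E} {r r' : ℚ_[p]} {n n' : ℤ},
      (F.uni d r * F.tor n 0)⁻¹ * (F.uni d' r' * F.tor n' 0) ∈ F.K → n ≤ n' := by
    intro d d' r r' n n' h
    obtain ⟨s, hs⟩ := F.exists_uni_cocycle (-d) d'
    rw [F.uni_tor_inv_mul hs] at h
    have h1 := ((F.mem_K_iff hp _).1 h).1 0 0
    rw [mat_mul, mat_uni, mat_tor] at h1
    simp [Matrix.mul_apply, Fin.sum_univ_three] at h1
    rw [← zpow_zero ‖F.δ‖, F.norm_δ_zpow_le hp] at h1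
    omega
  have hn : n = n' := le_antisymm (hle h) (hle (by
    have := inv_mem h
    rwa [_root_.mul_inv_rev, inv_inv] at this))
  subst hn
  rw [F.uni_tor_inv_mul hs, sub_self] at h
  have h0 : (F.tor 0 0 : F.G) = 1 := by simp [tor]
  rw [h0, mul_one, F.uni_mem_K_iff hp, norm_mul, norm_mul, norm_neg_δ_zpow, F.norm_D_zpow hp] at h
  refine ⟨rfl, ?_, ?_⟩
  · have h1 := h.1
    rwa [_root_.zpow_neg, inv_mul_le_iff₀ (zpow_pos hδ _), mul_one] at h1
  · rintro rfl
    have hs0 : s = 0 := by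
      have : ι s = 0 := by rw [hs, map_neg]; ring
      simpa using this
    have h1 := h.2
    rwa [hs0, add_zero, mul_neg, _root_.zpow_neg, inv_mul_le_iff₀ (zpow_pos hδ _), mul_one] at h1

theorem uni_tor_mem_K (F : RamifiedCompletion p E) (hp : p ≠ 2) {d d' : E} {r r' s : ℚ_[p]}
    {n : ℤ} (h : ι s = F.δ * (F.conj (-d) * d' - -d * F.conj d') / 2)
    (hd : ‖d' - d‖ ≤ ‖F.δ‖ ^ n) (hr : ‖r' - r + s‖ ≤ ‖F.δ‖ ^ (2 * n)) :
    (F.uni d r * F.tor n 0)⁻¹ * (F.uni d' r' * F.tor n 0) ∈ F.K := by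
  have hδ := F.norm_δ_pos
  have h0 : (F.tor 0 0 : F.G) = 1 := by simp [tor]
  rw [F.uni_tor_inv_mul h, sub_self, h0, mul_one, F.uni_mem_K_iff hp, norm_mul, norm_mul,
    norm_neg_δ_zpow, F.norm_D_zpow hp, mul_neg]
  constructor
  · rwa [_root_.zpow_neg, inv_mul_le_iff₀ (zpow_pos hδ _), mul_one]
  · rwa [_root_.zpow_neg, inv_mul_le_iff₀ (zpow_pos hδ _), mul_one]

/-- Indices of the cosets in `K diag(ϖ, 1, conj ϖ⁻¹) K / K`. -/
abbrev HeckeIndex (p : ℕ) := (Fin p × Fin p) ⊕ Fin p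

/-- The unipotent parameter `d` of a coset. -/
def heckeD (F : RamifiedCompletion p E) : HeckeIndex p → E :=
  -- The denominator 2p makes the trace of δ⁻¹d equal to x/p, the argument of ψ in the Whittaker
  -- computation.
  Sum.elim (fun a => ((a.1 : ℕ) : E)) fun x => (x : ℕ) * F.δ / (2 * p)

/-- The unipotent parameter `r` of a coset. -/
def heckeR : HeckeIndex p → ℚ_[p] := Sum.elim (fun a => ((a.2 : ℕ) : ℚ_[p])) fun _ => 0

/-- The torus parameter of a coset. -/
def heckeN : HeckeIndex p → ℤ := Sum.elim (fun _ => 1) fun x => if (x : ℕ) = 0 then -1 else 0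

/-- Representatives of the cosets in `K diag(ϖ, 1, conj ϖ⁻¹) K / K`. -/
def heckeRep (F : RamifiedCompletion p E) (i : HeckeIndex p) : F.G :=
  F.uni (F.heckeD i) (heckeR i) * F.tor (heckeN i) 0

theorem norm_p_E (F : RamifiedCompletion p E) (hp : p ≠ 2) : ‖(p : E)‖ = ‖F.δ‖ ^ 2 := by
  have := norm_algebraMap' E (p : ℚ_[p])
  rw [map_natCast, Padic.norm_p] at this
  rw [this, F.norm_δ_sq hp]

theorem norm_natCast_E (_F : RamifiedCompletion p E) (n : ℕ) : ‖(n : E)‖ = ‖(n : ℚ_[p])‖ := by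
  rw [← norm_algebraMap' E (n : ℚ_[p]), map_natCast]

theorem norm_natCast_sub_E (_F : RamifiedCompletion p E) (m n : ℕ) :
    ‖(m - n : E)‖ = ‖(m - n : ℚ_[p])‖ := by
  rw [← norm_algebraMap' E (m - n : ℚ_[p]), map_sub, map_natCast, map_natCast]

/-- The torus exponent separates the three families, and residues separate the members of each. -/
theorem heckeRep_injective (F : RamifiedCompletion p E) (hp : p ≠ 2) {i j : HeckeIndex p}
    (h : (F.heckeRep i)⁻¹ * F.heckeRep j ∈ F.K) : i = j := by
  obtain ⟨hn, hd, hr⟩ := F.eq_of_uni_tor_mem_K hp h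
  have hδ := F.norm_δ_pos
  have hδ1 := F.norm_δ_lt_one hp
  rcases i with ⟨a, b⟩ | x <;> rcases j with ⟨a', b'⟩ | x'
  · simp only [heckeD, heckeR, heckeN, Sum.elim_inl, zpow_one] at hd hr
    rw [F.norm_natCast_sub_E] at hd
    have ha : a' = a := Fin.ext (F.norm_natCast_sub_le a'.2 a.2 (hd.trans_lt hδ1))
    subst ha
    have hb : b' = b := Fin.ext (F.norm_natCast_sub_le b'.2 b.2 ((hr rfl).trans_lt (by
      rw [← zpow_zero ‖F.δ‖, F.norm_δ_zpow_lt hp]; norm_num)))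
    rw [hb]
  · simp only [heckeN, Sum.elim_inl, Sum.elim_inr] at hn
    split_ifs at hn; all_goals omega
  · simp only [heckeN, Sum.elim_inl, Sum.elim_inr] at hn
    split_ifs at hn; all_goals omega
  · simp only [heckeD, heckeN, Sum.elim_inr] at hd hn
    congr 1
    apply Fin.ext
    by_cases h0 : (x : ℕ) = 0
    · by_cases h0' : (x' : ℕ) = 0
      · rw [h0, h0']
      · simp [h0, h0'] at hn
    · by_cases h0' : (x' : ℕ) = 0
      · simp [h0, h0'] at hn
      · simp only [h0, if_false, zpow_zero] at hd
        refine (F.norm_natCast_sub_le x'.2 x.2 ?_).symm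
        rw [← F.norm_natCast_sub_E]
        rw [← sub_div, ← sub_mul, norm_div, norm_mul, norm_mul, F.norm_two_E hp, one_mul,
          F.norm_p_E hp] at hd
        rw [div_le_iff₀ (by positivity), one_mul, pow_two] at hd
        exact (le_of_mul_le_mul_right hd hδ).trans_lt hδ1

theorem mat_T_apply_ne (F : RamifiedCompletion p E) {g : F.G} (h1 : F.mat g 1 0 = 0)
    (h2 : F.mat g 2 0 = 0) : F.mat g 2 1 = 0 := by
  obtain ⟨d, r, t, rfl⟩ := F.upper_decomp h1 h2
  obtain ⟨t₁, t₂, t₃, h, rfl⟩ := F.exists_torusElt_eq t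
  rw [mat_mul, mat_uni, mat_torusElt]
  simp [Matrix.mul_apply, Fin.sum_univ_three]

theorem mat_tor_eq_diagonal (F : RamifiedCompletion p E) (n m : ℤ) : F.mat (F.tor n m : F.T) =
    diagonal ![F.δ ^ (n + m), F.δ ^ m, (-F.δ) ^ (-n) * F.δ ^ m] := by
  rw [mat_tor]
  ext i j
  fin_cases i <;> fin_cases j <;> simp

/-- Conjugation by `F.tor 1 0` multiplies entries above the diagonal by powers of δ up to sign. So
for k in K the coset of `k * F.tor (-1) 0` depends only on the line spanned by the first column of
k. -/
theorem tor_conj_upper_mem_K (F : RamifiedCompletion p E) (hp : p ≠ 2) {b : F.G} (hb : b ∈ F.K)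
    (h1 : F.mat b 1 0 = 0) (h2 : F.mat b 2 0 = 0) :
    (F.tor 1 0 : F.G) * b * F.tor (-1) 0 ∈ F.K := by
  have h3 := F.mat_T_apply_ne h1 h2
  rw [F.mem_K_iff hp] at hb ⊢
  have hδ := F.δ_ne_zero
  have hδ1 := (F.norm_δ_lt_one hp).le
  have hb' : ∀ i j, ‖F.δ‖ * ‖F.mat b i j‖ ≤ 1 := fun i j =>
    mul_le_one₀ hδ1 (norm_nonneg _) (hb.1 i j)
  constructor
  · intro i j
    rw [mat_mul, mat_mul, mat_tor_eq_diagonal, mat_tor_eq_diagonal, mul_diagonal, diagonal_mul]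
    fin_cases i <;> fin_cases j <;> simp [h1, h2, h3, hb.1]
    · rw [mul_right_comm, mul_inv_cancel₀ (norm_ne_zero_iff.2 hδ), one_mul]; exact hb.1 0 0
    · exact hb' _ _
    · rw [mul_comm]; exact mul_le_one₀ hδ1 (by positivity) (hb' _ _)
    · rw [mul_comm]; exact hb' _ _
    · rw [mul_right_comm, inv_mul_cancel₀ (norm_ne_zero_iff.2 hδ), one_mul]; exact hb.1 2 2
  · simp [F.norm_similitude_tor _ _ hp, hb.2]

theorem mat_tor_neg_one (F : RamifiedCompletion p E) :
    F.mat (F.tor (-1) 0 : F.T) = diagonal ![F.δ⁻¹, 1, -F.δ] := by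
  rw [mat_tor_eq_diagonal]
  congr 1
  ext i
  fin_cases i <;> simp

theorem tor_one_inv (F : RamifiedCompletion p E) : (F.tor 1 0 : F.G)⁻¹ = F.tor (-1) 0 := by
  rw [← Subgroup.coe_inv, tor_inv, neg_zero]

theorem tor_one_inv_wt_tor (F : RamifiedCompletion p E) :
    (F.tor 1 0 : F.G)⁻¹ * F.wt * F.tor (-1) 0 = F.wt⁻¹ := by
  have hδ := F.δ_ne_zero
  apply F.G_ext
  rw [tor_one_inv, mat_mul, mat_mul, mat_tor_neg_one, mat_wt, mat_wt_inv]
  ext i j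
  rw [mul_diagonal, diagonal_mul]
  fin_cases i <;> fin_cases j <;> simp [hδ]

/-- The coset of `low y r * diag(ϖ⁻¹, 1, conj ϖ)` in Iwasawa form, when `y` is a unit. -/
theorem low_tor_mem (F : RamifiedCompletion p E) (hp : p ≠ 2) {y z : E} {r s : ℚ_[p]}
    (hz : z = ι r - F.δ * (y * F.conj y) / 2) (hy : ‖y‖ = 1) (hzn : ‖z‖ = ‖F.δ‖)
    (hs : ι s = ι r / (z * F.conj z)) :
    (F.uni (y / z) s * F.tor 0 0)⁻¹ * (F.low y r * F.tor (-1) 0) ∈ F.K := by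
  have hδ := F.δ_ne_zero
  have hδp := F.norm_δ_pos
  have hδ1 := (F.norm_δ_lt_one hp).le
  have hchar := F.charZero
  have hz0 : z ≠ 0 := by rw [← norm_ne_zero_iff, hzn]; exact F.norm_δ_pos.ne'
  have hz0' : F.conj z ≠ 0 := F.conj_ne_zero.2 hz0
  have hzc : F.conj z = ι r + F.δ * (y * F.conj y) / 2 := by
    rw [hz]; simp only [map_sub, map_div₀, map_mul, F.conj_conj, F.conj_δ, map_ofNat,
      AlgEquiv.commutes]; ring
  have h0 : (F.tor 0 0 : F.G) = 1 := by simp [tor]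
  -- The parameter s makes (1/z, y/z, 1) the last column of `F.uni (y / z) s`. It spans the same
  -- isotropic line as the first column (1, y, z) of `F.low y r`.
  have hc : ι s + F.δ * (y / z * F.conj (y / z)) / 2 = 1 / z := by
    rw [hs, map_div₀]
    field_simp
    rw [hzc]; ring
  have hci : ι (-s) + F.δ * (-(y / z) * F.conj (-(y / z))) / 2 = - (1 / F.conj z) := by
    rw [map_neg, hs, map_neg, map_div₀]
    field_simp
    rw [hz]; ring
  rw [h0, mul_one, uni_inv, F.mem_K_iff hp]
  refine ⟨fun i j => ?_, by simp [F.norm_similitude_tor _ _ hp]⟩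
  rw [← mul_assoc, mat_mul, mat_mul, mat_uni, mat_low, hci, mat_tor_neg_one, mul_diagonal, ← hz,
    Matrix.mul_apply, Fin.sum_univ_three]
  have key : z - F.conj z + F.δ * (y * F.conj y) = 0 := by
    linear_combination hz - hzc
  fin_cases i <;> fin_cases j <;> simp
  · have : 1 + -(F.δ * (F.conj y / F.conj z) * y) + -((F.conj z)⁻¹ * z) = 0 := by
      field_simp
      linear_combination -key
    rw [this]; simp
  · have : -(F.δ * (F.conj y / F.conj z)) + (F.conj z)⁻¹ * (F.δ * F.conj y) = 0 := by
      field_simp; ring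
    rw [this]; simp
  · rw [F.norm_conj hp, hzn, inv_mul_cancel₀ hδp.ne']
  · have : y + -(y / z * z) = 0 := by field_simp; ring
    rw [this]; simp
  · refine F.norm_add_le_of_le (by simp) ?_
    rw [norm_mul, norm_mul, norm_div, F.norm_conj hp, hy, hzn]
    field_simp; exact le_rfl
  · rw [hy, hzn, one_div, inv_mul_cancel₀ hδp.ne']
  · rw [hzn, mul_inv_cancel₀ hδp.ne']
  · rw [F.norm_conj hp, hy, mul_one]; exact hδ1
  · exact hδ1

/-- Conjugation divides y by δ and z by δ², up to signs. Here r is rational and not a unit, so it is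
divisible by p, and therefore z is divisible by δ². -/
theorem low_tor_mem_of_lt (F : RamifiedCompletion p E) (hp : p ≠ 2) {y z : E} {r : ℚ_[p]}
    (hz : z = ι r - F.δ * (y * F.conj y) / 2) (hy : ‖y‖ < 1) (hzn : ‖z‖ < 1) :
    (F.tor (-1) 0 : F.G)⁻¹ * (F.low y r * F.tor (-1) 0) ∈ F.K := by
  have hδ := F.δ_ne_zero
  have hδp := F.norm_δ_pos
  have hδ1 := F.norm_δ_lt_one hp
  have hy' : ‖y‖ ≤ ‖F.δ‖ := by simpa using F.norm_le_δ_mul_of_lt hp (y := 1) (by simpa using hy)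
  have hN : ‖F.δ * (y * F.conj y) / 2‖ ≤ ‖F.δ‖ ^ 2 := by
    rw [norm_div, F.norm_two_E hp, div_one, norm_mul, norm_mul, F.norm_conj hp, pow_two]
    refine mul_le_mul_of_nonneg_left ?_ hδp.le
    nlinarith [norm_nonneg y]
  have hr : ‖r‖ ≤ ‖F.δ‖ ^ 2 := by
    have h1 : ι r = z + F.δ * (y * F.conj y) / 2 := by rw [hz]; ring
    have h2 : ‖ι r‖ < 1 := by
      rw [h1]
      exact F.norm_add_lt_of_lt hzn (hN.trans_lt (pow_lt_one₀ hδp.le hδ1 two_ne_zero))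
    rw [norm_algebraMap'] at h2
    rcases eq_or_ne r 0 with rfl | hr0
    · simp [hδp.le]
    rw [F.norm_padic_eq hp hr0] at h2 ⊢
    rw [← zpow_zero ‖F.δ‖, F.norm_δ_zpow_lt hp] at h2
    rw [← zpow_natCast, F.norm_δ_zpow_le hp]
    push_cast; omega
  have hz' : ‖z‖ ≤ ‖F.δ‖ ^ 2 := by
    rw [hz]
    exact F.norm_sub_le_of_le (by rwa [norm_algebraMap']) hN
  have hinv : (F.tor (-1) 0 : F.G)⁻¹ = F.tor 1 0 := by
    rw [← tor_one_inv, inv_inv]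
  have hdiag : F.mat (F.tor 1 0 : F.T) = diagonal ![F.δ, 1, -F.δ⁻¹] := by
    rw [mat_tor_eq_diagonal]
    congr 1
    ext i
    fin_cases i <;> simp
  have hδi : ‖F.δ‖⁻¹ * ‖F.δ‖ = 1 := inv_mul_cancel₀ hδp.ne'
  rw [hinv, F.mem_K_iff hp]
  refine ⟨fun i j => ?_, by simp [F.norm_similitude_tor _ _ hp]⟩
  rw [← mul_assoc, mat_mul, mat_mul, mat_low, mat_tor_neg_one, mul_diagonal, hdiag, diagonal_mul,
    ← hz]
  fin_cases i <;> fin_cases j <;> simp [hδ, F.norm_conj hp]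
  · rw [← div_eq_mul_inv]; exact div_le_one_of_le₀ hy' hδp.le
  · rw [← div_eq_mul_inv, div_le_iff₀ hδp, inv_mul_le_iff₀ hδp, one_mul, ← pow_two]; exact hz'
  · exact hy.le

/-- Reduce d modulo δ, then reduce r modulo p after correcting it by the cocycle of the first
reduction. -/
theorem exists_hecke_pos (F : RamifiedCompletion p E) (hp : p ≠ 2) {d : E} {r : ℚ_[p]}
    (hd : ‖d‖ ≤ 1) (hr : ‖r‖ ≤ 1) : ∃ j : HeckeIndex p,
      (F.heckeRep j)⁻¹ * (F.uni d r * F.tor 1 0) ∈ F.K := by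
  obtain ⟨a, ha, had⟩ := F.exists_residue_E hp hd
  obtain ⟨s, hs⟩ := F.exists_uni_cocycle (-(a : E)) d
  have ha1 : ‖(a : E)‖ ≤ 1 := by
    rw [F.norm_natCast_E]
    exact_mod_cast Padic.norm_int_le_one (a : ℤ)
  have hsn : ‖s‖ ≤ 1 := by
    rw [← norm_algebraMap' E, hs, norm_div, F.norm_two_E hp, div_one, norm_mul]
    refine mul_le_one₀ (F.norm_δ_lt_one hp).le (norm_nonneg _) (F.norm_sub_le_of_le ?_ ?_)
    · rw [norm_mul, F.norm_conj hp, norm_neg]; exact mul_le_one₀ ha1 (norm_nonneg _) hd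
    · rw [norm_mul, F.norm_conj hp, norm_neg]; exact mul_le_one₀ ha1 (norm_nonneg _) hd
  obtain ⟨b, hb, hbr⟩ := F.exists_residue (a := r + s)
    ((Padic.nonarchimedean _ _).trans (max_le hr hsn))
  refine ⟨Sum.inl (⟨a, ha⟩, ⟨b, hb⟩), F.uni_tor_mem_K hp hs ?_ ?_⟩
  · change _ ≤ ‖F.δ‖ ^ (1 : ℤ)
    rw [zpow_one]; exact had
  · have h1 : r - (b : ℚ_[p]) + s = r + s - b := by ring
    change ‖r - (b : ℚ_[p]) + s‖ ≤ _
    rw [h1]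
    refine hbr.trans_eq ?_
    rw [← F.norm_δ_sq hp]; norm_cast

theorem exists_hecke_zero (F : RamifiedCompletion p E) (hp : p ≠ 2) {d : E} {r : ℚ_[p]}
    (hd : ‖d‖ = ‖F.δ‖⁻¹) (hr : ‖r‖ ≤ 1) : ∃ j : HeckeIndex p,
      (F.heckeRep j)⁻¹ * (F.uni d r * F.tor 0 0) ∈ F.K := by
  have hδ := F.δ_ne_zero
  have hδp := F.norm_δ_pos
  have hδ1 := F.norm_δ_lt_one hp
  have hchar := F.charZero
  have hp0 : (p : E) ≠ 0 := by exact_mod_cast (Fact.out : p.Prime).ne_zero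
  have hd1 : ‖d * (2 * p) / F.δ‖ = 1 := by
    rw [norm_div, norm_mul, norm_mul, F.norm_two_E hp, F.norm_p_E hp, hd]
    field_simp
  obtain ⟨x, hx, hxd⟩ := F.exists_residue_E hp hd1.le
  have hx0 : x ≠ 0 := by
    rintro rfl
    rw [Nat.cast_zero, sub_zero, hd1] at hxd
    exact hxd.not_gt hδ1
  set d₀ : E := x * F.δ / (2 * p) with hd₀
  have he : ‖d - d₀‖ ≤ 1 := by
    have h1 : d - d₀ = (d * (2 * p) / F.δ - x) * F.δ / (2 * p) := by rw [hd₀]; field_simp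
    rw [h1, norm_div, norm_mul, norm_mul, F.norm_two_E hp, F.norm_p_E hp, one_mul,
      div_le_iff₀ (by positivity), one_mul, pow_two]
    exact mul_le_mul_of_nonneg_right hxd hδp.le
  have hd₀n : ‖d₀‖ ≤ ‖F.δ‖⁻¹ := by
    have h1 : d₀ = d - (d - d₀) := by ring
    rw [h1]
    exact F.norm_sub_le_of_le hd.le (he.trans ((one_le_inv₀ hδp).2 hδ1.le))
  obtain ⟨s, hs⟩ := F.exists_uni_cocycle (-d₀) d
  -- The norms of d and d₀ may be as large as ‖δ‖⁻¹, but the cocycle is alternating, so one argument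
  -- can be replaced by the integral difference d - d₀.
  have hsn : ‖s‖ ≤ 1 := by
    have h1 : F.δ * (F.conj (-d₀) * d - -d₀ * F.conj d) / 2 =
        F.δ * (d₀ * F.conj (d - d₀) - (d - d₀) * F.conj d₀) / 2 := by
      simp only [map_neg, map_sub]; ring
    have h2 : ∀ {a b : E}, ‖a‖ * ‖b‖ ≤ ‖F.δ‖⁻¹ → ‖a * F.conj b‖ ≤ ‖F.δ‖⁻¹ := fun h => by
      rwa [norm_mul, F.norm_conj hp]
    have h3 : ‖d₀‖ * ‖d - d₀‖ ≤ ‖F.δ‖⁻¹ :=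
      (mul_le_of_le_one_right (norm_nonneg _) he).trans hd₀n
    rw [← norm_algebraMap' E, hs, h1, norm_div, F.norm_two_E hp, div_one, norm_mul]
    calc _ ≤ ‖F.δ‖ * ‖F.δ‖⁻¹ := mul_le_mul_of_nonneg_left
          (F.norm_sub_le_of_le (h2 h3) (h2 (by rwa [mul_comm]))) hδp.le
      _ = 1 := mul_inv_cancel₀ hδp.ne'
  have hrep : F.heckeRep (Sum.inr ⟨x, hx⟩) = F.uni d₀ 0 * F.tor 0 0 := by
    simp [heckeRep, heckeD, heckeR, heckeN, hx0, hd₀]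
  refine ⟨Sum.inr ⟨x, hx⟩, ?_⟩
  rw [hrep]
  refine F.uni_tor_mem_K hp hs ?_ ?_
  · rw [zpow_zero]; exact he
  · rw [mul_zero, zpow_zero, sub_zero]
    exact (Padic.nonarchimedean _ _).trans (max_le hr hsn)

theorem mul_mem_of_coset (F : RamifiedCompletion p E) {a b c : F.G} (h1 : a⁻¹ * b ∈ F.K)
    (h2 : b⁻¹ * c ∈ F.K) : a⁻¹ * c ∈ F.K := by
  have := mul_mem h1 h2
  rwa [mul_assoc, mul_inv_cancel_left] at this

/-- Only the first column of k matters. If its last entry dominates, the Weyl element leads to a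
coset with torus exponent 1. Otherwise scale the column to (1, y, z): a non-unit y gives exponent
-1, a unit y gives exponent 0. -/
theorem exists_hecke_of_mem_K (F : RamifiedCompletion p E) (hp : p ≠ 2) {k : F.G} (hk : k ∈ F.K) :
    ∃ j : HeckeIndex p, (F.heckeRep j)⁻¹ * (k * F.tor (-1) 0) ∈ F.K := by
  have hδp := F.norm_δ_pos
  have hδ1 := F.norm_δ_lt_one hp
  have hk1 := ((F.mem_K_iff hp _).1 hk).1
  have hupper : ∀ {κ : F.G}, κ ∈ F.K → F.mat (κ⁻¹ * k) 1 0 = 0 → F.mat (κ⁻¹ * k) 2 0 = 0 →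
      (κ * F.tor (-1) 0)⁻¹ * (k * F.tor (-1) 0) ∈ F.K := by
    intro κ hκ h1 h2
    have := F.tor_conj_upper_mem_K hp (mul_mem (inv_mem hκ) hk) h1 h2
    rw [_root_.mul_inv_rev, ← tor_one_inv, inv_inv]
    rw [← tor_one_inv] at this
    simpa only [mul_assoc] using this
  rcases le_or_gt ‖F.mat k 0 0‖ ‖F.mat k 2 0‖ with h | h
  · have h0 : F.mat k 2 0 ≠ 0 := by
      intro h0
      rw [h0, norm_zero, norm_le_zero_iff] at h
      exact (F.corner_ne_zero k).elim (· h) (· h0)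
    obtain ⟨d, r, hd, hr, h1, h2⟩ := F.exists_uni_wt_mul h0
    have hdn : ‖d‖ ≤ 1 := by
      rw [hd, norm_div]
      exact div_le_one_of_le₀ (F.norm_col_le hp k (by simp) h le_rfl) (norm_nonneg _)
    have hcn : ‖ι r + F.δ * (d * F.conj d) / 2‖ ≤ 1 := by
      rw [hr, norm_div]
      exact div_le_one_of_le₀ h (norm_nonneg _)
    have huK := F.uni_mem_K_of_norm_le hp hdn hcn
    obtain ⟨j, hj⟩ := F.exists_hecke_pos hp hdn ((F.uni_mem_K_iff hp _ _).1 huK).2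
    refine ⟨j, F.mul_mem_of_coset hj (F.mul_mem_of_coset ?_
      (hupper (mul_mem huK (F.wt_mem_K hp)) h1 h2))⟩
    have h3 : (F.uni d r * F.tor 1 0)⁻¹ * (F.uni d r * F.wt * F.tor (-1) 0) = F.wt⁻¹ := by
      rw [← F.tor_one_inv_wt_tor]; group
    rw [h3]
    exact inv_mem (F.wt_mem_K hp)
  · have h0' : 0 < ‖F.mat k 0 0‖ := (norm_nonneg _).trans_lt h
    obtain ⟨y, r, hy, hr, h1, h2, -⟩ := F.exists_low_mul (norm_pos_iff.1 h0')
    have hyn : ‖y‖ ≤ 1 := by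
      rw [hy, norm_div]
      exact div_le_one_of_le₀ (F.norm_col_le hp k (by simp) le_rfl h.le) (norm_nonneg _)
    set z := F.mat k 2 0 / F.mat k 0 0 with hz
    have hzn : ‖z‖ < 1 := by
      rw [hz, norm_div, div_lt_one h0']; exact h
    have hlow := F.low_mem_K hp hyn (hr ▸ hzn.le)
    have hmain := hupper hlow h1 h2
    rcases lt_or_eq_of_le hyn with hy1 | hy1
    · refine ⟨Sum.inr ⟨0, (Fact.out : p.Prime).pos⟩, F.mul_mem_of_coset ?_ hmain⟩
      have hrep : F.heckeRep (Sum.inr ⟨0, (Fact.out : p.Prime).pos⟩) = F.tor (-1) 0 := by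
        simp [heckeRep, heckeD, heckeR, heckeN, uni_zero]
      rw [hrep]
      exact F.low_tor_mem_of_lt hp hr.symm hy1 hzn
    · have hN : ‖F.δ * (y * F.conj y) / 2‖ = ‖F.δ‖ := by
        rw [norm_div, F.norm_two_E hp, div_one, norm_mul, norm_mul, F.norm_conj hp, hy1, one_mul,
          mul_one]
      -- Since r is rational and not a unit, it is smaller than δN(y)/2, which has norm ‖δ‖. Hence
      -- ‖z‖ is exactly ‖δ‖.
      have hrn : ‖r‖ ≤ ‖F.δ‖ ^ 2 := by
        have e1 : ι r = z + F.δ * (y * F.conj y) / 2 := by rw [← hr]; ring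
        have e2 : ‖ι r‖ < 1 := by
          rw [e1]
          exact F.norm_add_lt_of_lt hzn (hN.trans_lt hδ1)
        rw [norm_algebraMap'] at e2
        rcases eq_or_ne r 0 with rfl | hr0
        · simp [hδp.le]
        rw [F.norm_padic_eq hp hr0] at e2 ⊢
        rw [← zpow_zero ‖F.δ‖, F.norm_δ_zpow_lt hp] at e2
        rw [← zpow_natCast, F.norm_δ_zpow_le hp]
        push_cast; omega
      have hrlt : ‖r‖ < ‖F.δ‖ := hrn.trans_lt (by nlinarith)
      have hzeq : ‖z‖ = ‖F.δ‖ := by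
        rw [← hr, sub_eq_add_neg, F.norm_add_eq_max, norm_neg, hN, norm_algebraMap',
          max_eq_right hrlt.le]
        rw [norm_neg, hN, norm_algebraMap']
        exact hrlt.ne
      obtain ⟨s, hs⟩ := F.exists_algebraMap_of_conj_eq (x := ι r / (z * F.conj z)) (by
        simp only [map_div₀, map_mul, F.conj_conj, AlgEquiv.commutes, mul_comm])
      have hsn : ‖s‖ ≤ 1 := by
        rw [← norm_algebraMap' E, ← hs, norm_div, norm_mul, F.norm_conj hp, hzeq, norm_algebraMap',
          ← pow_two]
        exact div_le_one_of_le₀ hrn (by positivity)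
      obtain ⟨j, hj⟩ := F.exists_hecke_zero hp (d := y / z) (r := s)
        (by rw [norm_div, hy1, hzeq, one_div]) hsn
      exact ⟨j, F.mul_mem_of_coset hj (F.mul_mem_of_coset
        (F.low_tor_mem hp hr.symm hy1 hzeq hs.symm) hmain)⟩

theorem heckeRep_mem (F : RamifiedCompletion p E) (hp : p ≠ 2) (i : HeckeIndex p) :
    ∃ k ∈ F.K, (F.heckeRep i)⁻¹ * (k * F.tor (-1) 0) ∈ F.K := by
  have hδ := F.δ_ne_zero
  have hδp := F.norm_δ_pos
  have hchar := F.charZero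
  rcases i with ⟨a, b⟩ | ⟨x, hx⟩
  · have hrep : F.heckeRep (Sum.inl (a, b)) = F.uni (a : ℕ) (b : ℕ) * F.tor 1 0 := rfl
    refine ⟨F.uni (a : ℕ) (b : ℕ) * F.wt, mul_mem (F.uni_mem_K hp ?_ ?_) (F.wt_mem_K hp), ?_⟩
    · rw [F.norm_natCast_E]
      exact_mod_cast Padic.norm_int_le_one (a : ℤ)
    · exact_mod_cast Padic.norm_int_le_one (b : ℤ)
    · have h3 : (F.uni (a : ℕ) (b : ℕ) * F.tor 1 0)⁻¹ *
          (F.uni (a : ℕ) (b : ℕ) * F.wt * F.tor (-1) 0) = F.wt⁻¹ := by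
        rw [← F.tor_one_inv_wt_tor]; group
      rw [hrep, h3]
      exact inv_mem (F.wt_mem_K hp)
  · by_cases hx0 : x = 0
    · refine ⟨1, one_mem _, ?_⟩
      have hrep : F.heckeRep (Sum.inr ⟨x, hx⟩) = F.tor (-1) 0 := by
        simp [heckeRep, heckeD, heckeR, heckeN, hx0, uni_zero]
      rw [hrep, one_mul, inv_mul_cancel]
      exact one_mem _
    · have hp0 : (p : E) ≠ 0 := by exact_mod_cast (Fact.out : p.Prime).ne_zero
      have hxE : (x : E) ≠ 0 := by exact_mod_cast hx0
      have hxn : ‖(x : E)‖ = 1 := by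
        rw [F.norm_natCast_E, Padic.norm_natCast_eq_one_iff]
        exact Nat.coprime_of_lt_prime hx0 hx Fact.out
      set d : E := x * F.δ / (2 * p) with hd
      have hrep : F.heckeRep (Sum.inr ⟨x, hx⟩) = F.uni d 0 * F.tor 0 0 := by
        simp [heckeRep, heckeD, heckeR, heckeN, hx0, hd]
      have hcd : F.conj d = -d := by
        rw [hd]; simp [F.conj_δ, neg_div, map_ofNat]
      have hd0 : d ≠ 0 := div_ne_zero (mul_ne_zero hxE hδ) (mul_ne_zero two_ne_zero hp0)
      have hdn : ‖d‖ = ‖F.δ‖⁻¹ := by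
        rw [hd, norm_div, norm_mul, norm_mul, hxn, F.norm_two_E hp, F.norm_p_E hp, one_mul, one_mul]
        field_simp
      have hcy : F.conj (-2 / (F.δ * d)) = -2 / (F.δ * d) := by
        simp [F.conj_δ, hcd, map_ofNat]
      have hyn : ‖-2 / (F.δ * d)‖ = 1 := by
        rw [norm_div, norm_neg, norm_mul, F.norm_two_E hp, hdn, mul_inv_cancel₀ hδp.ne', div_one]
      have hzn : ‖-2 / (F.δ * d ^ 2)‖ = ‖F.δ‖ := by
        rw [norm_div, norm_neg, norm_mul, norm_pow, F.norm_two_E hp, hdn]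
        field_simp
      -- With r = 0 and y fixed by conjugation, z is -δy²/2, and solving y/z = d gives y = -2/(δd).
      refine ⟨F.low (-2 / (F.δ * d)) 0, F.low_mem_K hp hyn.le ?_, ?_⟩
      · rw [map_zero, zero_sub, norm_neg, norm_div, norm_mul, norm_mul, F.norm_conj hp, hyn,
          F.norm_two_E hp, mul_one, mul_one, div_one]
        exact (F.norm_δ_lt_one hp).le
      have h1 := F.low_tor_mem hp (y := -2 / (F.δ * d)) (z := -2 / (F.δ * d ^ 2)) (r := 0) (s := 0)
        (by rw [hcy, map_zero]; field_simp; ring) hyn hzn (by simp)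
      have h2 : -2 / (F.δ * d) / (-2 / (F.δ * d ^ 2)) = d := by field_simp
      rwa [h2, ← hrep] at h1

/-- Left multiplication by k permutes the cosets, and the choice of representatives does not matter
on a K-fixed vector. -/
theorem apply_sum_heckeRep (F : RamifiedCompletion p E) (hp : p ≠ 2) {V : Type*} [AddCommGroup V]
    [Module ℂ V] (π : Representation ℂ F.G V) {v : V} (hv : ∀ k ∈ F.K, π k v = v) {k : F.G}
    (hk : k ∈ F.K) : π k (∑ i, π (F.heckeRep i) v) = ∑ i, π (F.heckeRep i) v := by
  have h1 : ∀ i : HeckeIndex p, ∃ j : HeckeIndex p,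
      (F.heckeRep j)⁻¹ * (k * F.heckeRep i) ∈ F.K := by
    intro i
    obtain ⟨κ, hκ, h⟩ := F.heckeRep_mem hp i
    obtain ⟨j, hj⟩ := F.exists_hecke_of_mem_K hp (mul_mem hk hκ)
    refine ⟨j, F.mul_mem_of_coset hj ?_⟩
    have := inv_mem h
    rw [_root_.mul_inv_rev, inv_inv] at this
    convert this using 1
    group
  choose σ hσ using h1
  have hinj : Function.Injective σ := by
    intro i j hij
    apply F.heckeRep_injective hp
    have h2 := mul_mem (inv_mem (hσ i)) (hij ▸ hσ j)
    convert h2 using 1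
    group
  rw [map_sum]
  refine Fintype.sum_bijective σ (Finite.injective_iff_bijective.1 hinj) _ _ fun i => ?_
  have h3 : k * F.heckeRep i = F.heckeRep (σ i) * ((F.heckeRep (σ i))⁻¹ * (k * F.heckeRep i)) := by
    group
  rw [← Module.End.mul_apply, ← map_mul, h3, map_mul, Module.End.mul_apply, hv _ (hσ i)]

/-- Evaluation of a sum over the cosets. -/
theorem sum_heckeIndex (f : HeckeIndex p → ℂ) (A B : ℂ) (C : ℕ → ℂ)
    (h1 : ∀ a, f (Sum.inl a) = A) (h2 : ∀ x : Fin p, (x : ℕ) = 0 → f (Sum.inr x) = B)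
    (h3 : ∀ x : Fin p, (x : ℕ) ≠ 0 → f (Sum.inr x) = C x) :
    ∑ i, f i = p ^ 2 * A + B + ∑ x ∈ (Finset.range p).erase 0, C x := by
  have h0 : 0 ∈ Finset.range p := Finset.mem_range.2 (Fact.out : p.Prime).pos
  rw [Fintype.sum_sum_type, Finset.sum_congr rfl fun a _ => h1 a, Finset.sum_const,
    Finset.card_univ, Fintype.card_prod, Fintype.card_fin, nsmul_eq_mul, add_assoc]
  congr 1
  · push_cast; ring
  · have : ∀ x : Fin p, f (Sum.inr x) = (fun x : ℕ => if x = 0 then B else C x) x := by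
      intro x
      by_cases hx : (x : ℕ) = 0
      · simp [hx, h2 x hx]
      · simp [hx, h3 x hx]
    rw [Finset.sum_congr rfl fun x _ => this x,
      Fin.sum_univ_eq_sum_range (fun x : ℕ => if x = 0 then B else C x),
      ← Finset.add_sum_erase _ _ h0, if_pos rfl]
    congr 1
    refine Finset.sum_congr rfl fun x hx => ?_
    rw [if_neg (Finset.ne_of_mem_erase hx)]

theorem card_erase_range : ((Finset.range p).erase 0).card = p - 1 := by
  rw [Finset.card_erase_of_mem (Finset.mem_range.2 (Fact.out : p.Prime).pos), Finset.card_range]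

/-! ### Additive characters and the Whittaker functional -/

/-- The group p⁻¹ℤ_p/ℤ_p is generated by the class of p⁻¹. -/
theorem addChar_inv_p_ne_one {ψ : AddChar ℚ_[p] ℂ} (hψ : IsUnramifiedAddChar ψ) :
    ψ ((p : ℚ_[p])⁻¹) ≠ 1 := by
  intro h
  obtain ⟨h1, y, hy, hy1⟩ := hψ
  apply hy1
  have hp0 : (p : ℚ_[p]) ≠ 0 := by exact_mod_cast (Fact.out : p.Prime).ne_zero
  have hyp : ‖y * p‖ ≤ 1 := by
    rw [norm_mul, Padic.norm_p]
    exact mul_inv_le_one_of_le₀ hy p_pos.le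
  obtain ⟨a, ha⟩ : ∃ a : ℤ_[p], (a : ℚ_[p]) = y * p := ⟨⟨_, hyp⟩, rfl⟩
  obtain ⟨n, -, hn⟩ := PadicInt.exists_mem_range a
  rw [PadicInt.maximalIdeal_eq_span_p, Ideal.mem_span_singleton] at hn
  obtain ⟨b, hb⟩ := hn
  have h2 : y = n • (p : ℚ_[p])⁻¹ + b := by
    have h3 := congrArg (fun z : ℤ_[p] => (z : ℚ_[p])) hb
    simp only [PadicInt.coe_sub, PadicInt.coe_mul, PadicInt.coe_natCast, ha] at h3
    rw [nsmul_eq_mul]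
    field_simp
    linear_combination h3
  rw [h2, AddChar.map_add_eq_mul, AddChar.map_nsmul_eq_pow, h, one_pow, one_mul]
  exact h1 _ b.2

/-- The values are the powers of a nontrivial p-th root of unity, and the term x = 0 is left out. -/
theorem sum_addChar {ψ : AddChar ℚ_[p] ℂ} (hψ : IsUnramifiedAddChar ψ) :
    ∑ x ∈ (Finset.range p).erase 0, ψ ((x : ℚ_[p]) / p) = -1 := by
  have hp0 : (p : ℚ_[p]) ≠ 0 := by exact_mod_cast (Fact.out : p.Prime).ne_zero
  have h0 : 0 ∈ Finset.range p := Finset.mem_range.2 (Fact.out : p.Prime).pos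
  have h1 : ∀ x : ℕ, ψ ((x : ℚ_[p]) / p) = ψ ((p : ℚ_[p])⁻¹) ^ x := fun x => by
    rw [← AddChar.map_nsmul_eq_pow, nsmul_eq_mul, div_eq_mul_inv]
  have h2 : ψ ((p : ℚ_[p])⁻¹) ^ p = 1 := by
    rw [← h1, div_self hp0]
    exact hψ.1 1 (by simp)
  have h3 := mul_geom_sum (ψ ((p : ℚ_[p])⁻¹)) p
  rw [h2, sub_self] at h3
  have h4 := (mul_eq_zero.1 h3).resolve_left (sub_ne_zero.2 (addChar_inv_p_ne_one hψ))
  rw [← Finset.add_sum_erase _ _ h0, pow_zero] at h4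
  rw [Finset.sum_congr rfl fun x _ => h1 x]
  linear_combination h4

section Whittaker

variable {V : Type*} [AddCommGroup V] [Module ℂ V]

theorem chi_uni (F : RamifiedCompletion p E) (ψ : AddChar ℚ_[p] ℂ) (d : E) (r : ℚ_[p]) :
    F.chi ψ (F.uni d r) = ψ (Algebra.trace ℚ_[p] E (F.δ⁻¹ * d)) := rfl

theorem chi_uni_eq_one (F : RamifiedCompletion p E) (hp : p ≠ 2) {ψ : AddChar ℚ_[p] ℂ}
    (hψ : IsUnramifiedAddChar ψ) {d : E} (hd : ‖d‖ ≤ 1) (r : ℚ_[p]) :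
    F.chi ψ (F.uni d r) = 1 := by
  rw [chi_uni]
  refine hψ.1 _ (F.norm_trace_le hp ?_)
  rw [norm_mul, norm_inv]
  exact mul_le_of_le_one_right (inv_nonneg.2 (norm_nonneg _)) hd

theorem whittaker_uni (F : RamifiedCompletion p E) {ψ : AddChar ℚ_[p] ℂ}
    {π : Representation ℂ F.G V} {Λ : V →ₗ[ℂ] ℂ} (hΛ : F.IsWhittaker ψ π Λ) (d : E) (r : ℚ_[p])
    (g : F.G) (v : V) : Λ (π (F.uni d r * g) v) = F.chi ψ (F.uni d r) * Λ (π g v) := by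
  rw [map_mul, Module.End.mul_apply, hΛ.2 _ (F.uni_mem_U d r)]

theorem whittaker_tor_uni_tor (F : RamifiedCompletion p E) {ψ : AddChar ℚ_[p] ℂ}
    {π : Representation ℂ F.G V} {Λ : V →ₗ[ℂ] ℂ} (hΛ : F.IsWhittaker ψ π Λ) (d : E) (r : ℚ_[p])
    (n m : ℤ) (v : V) : Λ (π (F.tor n 0 * (F.uni d r * F.tor m 0)) v) =
      ψ (Algebra.trace ℚ_[p] E (F.δ⁻¹ * ((-F.δ) ^ n * d))) * Λ (π (F.tor (n + m) 0) v) := by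
  rw [← mul_assoc, tor_mul_uni, mul_assoc, ← Subgroup.coe_mul, tor_mul, add_zero,
    F.whittaker_uni hΛ, chi_uni]

/-- The Whittaker function vanishes off the dominant cone. -/
theorem whittaker_tor_neg (F : RamifiedCompletion p E) (hp : p ≠ 2) {ψ : AddChar ℚ_[p] ℂ}
    (hψ : IsUnramifiedAddChar ψ) {π : Representation ℂ F.G V} {Λ : V →ₗ[ℂ] ℂ}
    (hΛ : F.IsWhittaker ψ π Λ) {v : V} (hv : ∀ k ∈ F.K, π k v = v) {n : ℤ} (hn : n < 0) :
    Λ (π (F.tor n 0) v) = 0 := by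
  have hδ := F.δ_ne_zero
  have hδp := F.norm_δ_pos
  have hchar := F.charZero
  obtain ⟨x, hx, hx1⟩ := hψ.2
  have hne : (-F.δ) ^ n ≠ 0 := zpow_ne_zero _ (neg_ne_zero.2 hδ)
  -- Moving `F.tor n 0` past `F.uni d 0` turns d into δx/2, on which χ has the value ψ(x) ≠ 1.
  -- Negativity of n makes d integral, so the value equals ψ(x) times itself.
  set d : E := ((-F.δ) ^ n)⁻¹ * (F.δ * ι (x / 2)) with hd
  have hdn : ‖d‖ ≤ 1 := by
    have h1 : ‖x / 2‖ ≤ ‖F.δ‖ ^ (-2 : ℤ) := by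
      rw [norm_div, norm_two hp, div_one]
      refine hx.trans_eq ?_
      rw [_root_.zpow_neg, ← inv_inv (p : ℝ), ← F.norm_δ_sq hp]
      norm_cast
    rw [hd, norm_mul, norm_mul, norm_inv, norm_neg_δ_zpow, norm_algebraMap', ← _root_.zpow_neg]
    calc _ ≤ ‖F.δ‖ ^ (-n) * (‖F.δ‖ ^ (1 : ℤ) * ‖F.δ‖ ^ (-2 : ℤ)) := by
          rw [zpow_one]; gcongr
      _ = ‖F.δ‖ ^ (-n + (1 + -2)) := by rw [zpow_add₀ hδp.ne', zpow_add₀ hδp.ne' 1]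
      _ ≤ ‖F.δ‖ ^ (0 : ℤ) := by rw [F.norm_δ_zpow_le hp]; omega
      _ = 1 := zpow_zero _
  have h1 := F.whittaker_tor_uni_tor hΛ d 0 n 0 v
  have h0 : (F.tor 0 0 : F.G) = 1 := by simp [tor]
  have h2 : F.δ⁻¹ * ((-F.δ) ^ n * d) = ι (x / 2) := by
    rw [hd]; field_simp
  rw [h2, F.trace_algebraMap_eq hp, mul_div_cancel₀ _ two_ne_zero, h0, mul_one, map_mul,
    Module.End.mul_apply, hv _ (F.uni_mem_K hp hdn (by simp)), add_zero] at h1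
  have h3 : (ψ x - 1) * Λ (π (F.tor n 0) v) = 0 := by linear_combination -h1
  exact (mul_eq_zero.1 h3).resolve_left (sub_ne_zero.2 hx1)

/-- Commuting the torus element past each representative leaves a value of ψ. It is 1 on the p²
cosets and on the last one. On the p - 1 middle cosets it is ψ(x/p) for n = 0, with sum -1, and it
is 1 for n > 0. -/
theorem whittaker_hecke (F : RamifiedCompletion p E) (hp : p ≠ 2) {ψ : AddChar ℚ_[p] ℂ}
    (hψ : IsUnramifiedAddChar ψ) {π : Representation ℂ F.G V} {Λ : V →ₗ[ℂ] ℂ}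
    (hΛ : F.IsWhittaker ψ π Λ) (v : V) (n : ℕ) :
    Λ (π (F.tor n 0) (∑ i, π (F.heckeRep i) v)) =
      p ^ 2 * Λ (π (F.tor (n + 1) 0) v) + Λ (π (F.tor (n - 1) 0) v) +
        (if n = 0 then -1 else (p : ℂ) - 1) * Λ (π (F.tor n 0) v) := by
  have hδ := F.δ_ne_zero
  have hδp := F.norm_δ_pos
  have hδ1 := F.norm_δ_lt_one hp
  have hchar := F.charZero
  have hpE : (p : E) ≠ 0 := by exact_mod_cast (Fact.out : p.Prime).ne_zero
  have h1 : ∀ i, Λ (π (F.tor n 0) (π (F.heckeRep i) v)) =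
      ψ (Algebra.trace ℚ_[p] E (F.δ⁻¹ * ((-F.δ) ^ (n : ℤ) * F.heckeD i))) *
        Λ (π (F.tor (n + heckeN i) 0) v) := fun i => by
    rw [← Module.End.mul_apply, ← map_mul, heckeRep, F.whittaker_tor_uni_tor hΛ]
  have hn1 : ‖(-F.δ) ^ (n : ℤ)‖ ≤ 1 := by
    rw [zpow_natCast, norm_pow, norm_neg]; exact pow_le_one₀ hδp.le hδ1.le
  have hχ : ∀ {d : E}, ‖(-F.δ) ^ (n : ℤ) * d‖ ≤ 1 →
      ψ (Algebra.trace ℚ_[p] E (F.δ⁻¹ * ((-F.δ) ^ (n : ℤ) * d))) = 1 := fun h => by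
    have := F.chi_uni_eq_one hp hψ h 0
    rwa [chi_uni] at this
  rw [map_sum, map_sum, Finset.sum_congr rfl fun i _ => h1 i]
  rw [sum_heckeIndex _ (Λ (π (F.tor (n + 1) 0) v)) (Λ (π (F.tor (n - 1) 0) v))
    (fun x => (if n = 0 then ψ ((x : ℚ_[p]) / p) else 1) * Λ (π (F.tor n 0) v))]
  · congr 1
    rw [← Finset.sum_mul]
    congr 1
    split_ifs with hn
    · exact sum_addChar hψ
    · rw [Finset.sum_const, card_erase_range, nsmul_eq_mul, mul_one,
        Nat.cast_sub (Fact.out : p.Prime).one_le, Nat.cast_one]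
  · rintro ⟨a, b⟩
    rw [hχ, one_mul]
    · rfl
    · change ‖(-F.δ) ^ (n : ℤ) * (a : ℕ)‖ ≤ 1
      rw [norm_mul, F.norm_natCast_E]
      exact mul_le_one₀ hn1 (norm_nonneg _) (by exact_mod_cast Padic.norm_int_le_one (a : ℤ))
  · intro x hx
    have hD : F.heckeD (Sum.inr x) = 0 := by simp [heckeD, hx]
    have hN : heckeN (Sum.inr x : HeckeIndex p) = -1 := if_pos hx
    rw [hχ (by rw [hD]; simp), one_mul, hN]
    rfl
  · intro x hx
    have hN : heckeN (Sum.inr x : HeckeIndex p) = 0 := if_neg hx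
    have hD : F.heckeD (Sum.inr x) = (x : ℕ) * F.δ / (2 * p) := rfl
    rw [hN, add_zero]
    congr 1
    split_ifs with hn
    · subst hn
      have h2 : F.δ⁻¹ * ((-F.δ) ^ ((0 : ℕ) : ℤ) * F.heckeD (Sum.inr x)) =
          ι (((x : ℕ) : ℚ_[p]) / p / 2) := by
        rw [hD]; simp [map_ofNat]; field_simp
      rw [h2, F.trace_algebraMap_eq hp, mul_div_cancel₀ _ two_ne_zero]
    · apply hχ
      rw [hD, norm_mul, norm_div, norm_mul, norm_mul, F.norm_two_E hp, F.norm_p_E hp,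
        norm_neg_δ_zpow, zpow_natCast, one_mul]
      have h3 : ‖F.δ‖ ^ n ≤ ‖F.δ‖ := pow_le_of_le_one hδp.le hδ1.le hn
      have h4 : ‖((x : ℕ) : E)‖ ≤ 1 := by
        rw [F.norm_natCast_E]; exact_mod_cast Padic.norm_int_le_one (x : ℤ)
      rw [← mul_div_assoc, div_le_one (by positivity), pow_two]
      exact mul_le_mul h3 (mul_le_of_le_one_left hδp.le h4) (by positivity) hδp.le

end Whittaker

/-! ### The recursion along the torus and non-vanishing at the spherical vector -/

section UnramifiedWhittaker

variable {V : Type*} [AddCommGroup V] [Module ℂ V]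

theorem exists_hecke_eigenvalue (F : RamifiedCompletion p E) (hp : p ≠ 2)
    {π : Representation ℂ F.G V} (hirr : π.IsIrreducible) (hadm : F.IsAdmissible π) {v : V}
    (hv0 : v ≠ 0) (hv : ∀ k ∈ F.K, π k v = v) : ∃ c : ℂ, ∑ i, π (F.heckeRep i) v = c • v :=
  F.invariants_eq_span hp hirr hadm hv0 hv fun _ hk => F.apply_sum_heckeRep hp π hv hk

/-- The three-term recursion for the values of the Whittaker function. -/
theorem whittaker_recursion (F : RamifiedCompletion p E) (hp : p ≠ 2) {ψ : AddChar ℚ_[p] ℂ}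
    (hψ : IsUnramifiedAddChar ψ) {π : Representation ℂ F.G V} {Λ : V →ₗ[ℂ] ℂ}
    (hΛ : F.IsWhittaker ψ π Λ) {v : V} {c : ℂ} (hc : ∑ i, π (F.heckeRep i) v = c • v) (n : ℕ) :
    p ^ 2 * Λ (π (F.tor (n + 1) 0) v) + Λ (π (F.tor (n - 1) 0) v) +
        (if n = 0 then -1 else (p : ℂ) - 1) * Λ (π (F.tor n 0) v) =
      c * Λ (π (F.tor n 0) v) := by
  rw [← F.whittaker_hecke hp hψ hΛ, hc, map_smul, map_smul, smul_eq_mul]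

/-- A Whittaker functional does not vanish on the vector fixed by `K`. -/
theorem whittaker_apply_ne_zero (F : RamifiedCompletion p E) (hp : p ≠ 2) {ψ : AddChar ℚ_[p] ℂ}
    (hψ : IsUnramifiedAddChar ψ) {π : Representation ℂ F.G V} (hirr : π.IsIrreducible)
    (hadm : F.IsAdmissible π) {Λ : V →ₗ[ℂ] ℂ} (hΛ : F.IsWhittaker ψ π Λ) {v : V}
    (hv0 : v ≠ 0) (hv : ∀ k ∈ F.K, π k v = v) : Λ v ≠ 0 := by
  intro h0
  obtain ⟨c, hc⟩ := F.exists_hecke_eigenvalue hp hirr hadm hv0 hv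
  obtain ⟨ω, hω0, hω⟩ := F.exists_central_scalar hirr hadm hv0 hv
  have hpC : (p : ℂ) ^ 2 ≠ 0 := pow_ne_zero _ (by exact_mod_cast (Fact.out : p.Prime).ne_zero)
  -- The leading coefficient p² is invertible, so two consecutive zeros, at -1 and 0, propagate
  -- upwards.
  have hpos : ∀ n : ℕ, Λ (π (F.tor n 0) v) = 0 ∧ Λ (π (F.tor (n - 1) 0) v) = 0 := by
    intro n
    induction n with
    | zero =>
      refine ⟨?_, F.whittaker_tor_neg hp hψ hΛ hv (by norm_num)⟩
      simpa [tor] using h0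
    | succ n ih =>
      have h := F.whittaker_recursion hp hψ hΛ hc n
      rw [ih.1, ih.2, mul_zero, mul_zero, add_zero, add_zero] at h
      refine ⟨?_, ?_⟩
      · exact_mod_cast (mul_eq_zero.1 h).resolve_left hpC
      · rw [Nat.cast_succ, add_sub_cancel_right]; exact ih.1
  have hall : ∀ n : ℤ, Λ (π (F.tor n 0) v) = 0 := fun n => by
    rcases lt_or_ge n 0 with hn | hn
    · exact F.whittaker_tor_neg hp hψ hΛ hv hn
    · lift n to ℕ using hn
      exact (hpos n).1
  -- The vectors on whose orbit Λ vanishes. By the Iwasawa decomposition v is one of them, so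
  -- irreducibility would give Λ = 0.
  let N : Submodule ℂ V := ⨅ g : F.G, LinearMap.ker (Λ ∘ₗ π g)
  have hN : N = ⊤ := by
    refine eq_top_of_stable hirr (x := v) (fun g x hx => ?_) ?_ hv0
    · simp only [N, Submodule.mem_iInf, LinearMap.mem_ker, LinearMap.comp_apply] at hx ⊢
      intro g'
      rw [← Module.End.mul_apply, ← map_mul]
      exact hx _
    · simp only [N, Submodule.mem_iInf, LinearMap.mem_ker, LinearMap.comp_apply]
      intro g
      obtain ⟨d, r, n, m, k, hk, rfl⟩ := F.iwasawa hp g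
      rw [map_mul, Module.End.mul_apply, hv k hk, F.whittaker_uni hΛ, F.apply_tor hω0 hω, map_smul,
        hall, smul_zero, mul_zero]
  refine hΛ.1 (LinearMap.ext fun x => ?_)
  have hx : x ∈ N := hN ▸ Submodule.mem_top
  simp only [N, Submodule.mem_iInf, LinearMap.mem_ker, LinearMap.comp_apply] at hx
  simpa using hx 1

end UnramifiedWhittaker

/-! ### The unramified principal series -/

theorem modulusB_tor (F : RamifiedCompletion p E) (n m : ℤ) :
    F.modulusB (F.tor n m) = (‖F.δ‖ ^ (2 * n)) ^ 2 := by
  have hδ := F.norm_δ_pos.ne'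
  rw [modulusB, entry, entry, entry, mat_tor]
  simp only [of_apply, cons_val', cons_val_zero, cons_val_fin_one, cons_val_one, cons_val]
  rw [norm_div, norm_div, norm_mul, norm_neg_δ_zpow, norm_zpow, norm_zpow, zpow_add₀ hδ,
    _root_.zpow_neg, two_mul, zpow_add₀ hδ]
  have h1 := zpow_ne_zero n hδ
  have h2 := zpow_ne_zero m hδ
  field_simp

theorem sqrt_modulusB_tor (F : RamifiedCompletion p E) (hp : p ≠ 2) (n m : ℤ) :
    ((Real.sqrt (F.modulusB (F.tor n m)) : ℝ) : ℂ) = (p : ℂ) ^ (-n) := by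
  rw [modulusB_tor, Real.sqrt_sq (zpow_nonneg (norm_nonneg _) _), _root_.zpow_mul, zpow_ofNat,
    F.norm_δ_sq hp]
  simp

theorem ind_apply_uni_tor (F : RamifiedCompletion p E) (hp : p ≠ 2) {η : F.T →* ℂˣ} {f : F.G → ℂ}
    (hf : f ∈ F.ind η) (d : E) (r : ℚ_[p]) (n m : ℤ) (g : F.G) :
    f (F.uni d r * F.tor n m * g) = (p : ℂ) ^ (-n) * η (F.tor n m) * f g := by
  obtain ⟨d', r', h⟩ := F.exists_T_mul_uni (F.tor n m)⁻¹ d r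
  have h1 : F.uni d r * F.tor n m = F.tor n m * F.uni d' r' := by
    rw [← mul_right_inj ((F.tor n m)⁻¹ : F.T).1, ← mul_assoc, h, mul_assoc]
    simp
  rw [h1, hf.1 _ _ (F.uni_mem_U d' r'), F.sqrt_modulusB_tor hp]

theorem ind_apply_iwasawa (F : RamifiedCompletion p E) (hp : p ≠ 2) {η : F.T →* ℂˣ} {f : F.G → ℂ}
    (hf : f ∈ F.ind η) (hK : ∀ k ∈ F.K, F.rightReg k f = f) (d : E) (r : ℚ_[p]) (n m : ℤ)
    {k : F.G} (hk : k ∈ F.K) :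
    f (F.uni d r * F.tor n m * k) = (p : ℂ) ^ (-n) * η (F.tor n m) * f 1 := by
  rw [F.ind_apply_uni_tor hp hf]
  congr 1
  have := congrFun (hK k hk) 1
  change f (1 * k) = f 1 at this
  rwa [one_mul] at this

theorem ind_ext (F : RamifiedCompletion p E) (hp : p ≠ 2) {η : F.T →* ℂˣ} {f f' : F.G → ℂ}
    (hf : f ∈ F.ind η) (hf' : f' ∈ F.ind η) (hK : ∀ k ∈ F.K, F.rightReg k f = f)
    (hK' : ∀ k ∈ F.K, F.rightReg k f' = f') (h : f 1 = f' 1) : f = f' := by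
  funext g
  obtain ⟨d, r, n, m, k, hk, rfl⟩ := F.iwasawa hp g
  rw [F.ind_apply_iwasawa hp hf hK _ _ _ _ hk, F.ind_apply_iwasawa hp hf' hK' _ _ _ _ hk, h]

theorem eta₁_ϖ (F : RamifiedCompletion p E) (η : F.T →* ℂˣ) : F.eta₁ η F.ϖ = η F.tt := rfl

theorem eta₂_ϖ (F : RamifiedCompletion p E) (η : F.T →* ℂˣ) : F.eta₂ η F.ϖ = η F.zz := rfl

/-- The Hecke eigenvalue on a function in the principal series fixed by `K`. -/
theorem sum_heckeRep_ind (F : RamifiedCompletion p E) (hp : p ≠ 2) {η : F.T →* ℂˣ} {f : F.G → ℂ}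
    (hf : f ∈ F.ind η) (hK : ∀ k ∈ F.K, F.rightReg k f = f) :
    ∑ i, F.rightReg (F.heckeRep i) f =
      (p * (F.eta₁ η F.ϖ : ℂ) + p * (F.eta₁ η F.ϖ : ℂ)⁻¹ + (p - 1)) • f := by
  have hpC : (p : ℂ) ≠ 0 := by exact_mod_cast (Fact.out : p.Prime).ne_zero
  refine F.ind_ext (η := η) hp ?_ ?_ (fun k hk => F.apply_sum_heckeRep hp F.rightReg hK hk)
    (fun k hk => by rw [map_smul, hK k hk]) ?_
  · exact (F.ind η).toSubmodule.sum_mem fun i _ => (F.ind η).apply_mem_toSubmodule _ hf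
  · exact (F.ind η).toSubmodule.smul_mem _ hf
  -- The representatives are in Iwasawa form, so each contributes p⁻ᴺaᴺ times f(1), with N its torus
  -- exponent. The total is p²·p⁻¹a + p·a⁻¹ + (p - 1).
  · have h1 : ∀ i, F.rightReg (F.heckeRep i) f 1 =
        (p : ℂ) ^ (-heckeN i) * (η F.tt : ℂ) ^ heckeN i * f 1 := fun i => by
      change f (1 * F.heckeRep i) = _
      rw [one_mul, heckeRep, ← mul_one (F.uni _ _ * _),
        F.ind_apply_iwasawa hp hf hK _ _ _ _ (one_mem _)]
      simp [tor]
    rw [Finset.sum_apply, Finset.sum_congr rfl fun i _ => h1 i,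
      sum_heckeIndex _ ((p : ℂ)⁻¹ * η F.tt * f 1) (p * (η F.tt : ℂ)⁻¹ * f 1) (fun _ => f 1)
        (fun a => ?_) (fun x hx => ?_) fun x hx => ?_]
    · rw [Finset.sum_const, card_erase_range, nsmul_eq_mul, Nat.cast_sub (Fact.out : p.Prime).one_le,
        Pi.smul_apply, smul_eq_mul, eta₁_ϖ]
      field_simp
      push_cast
      ring
    · have hN : heckeN (Sum.inl a : HeckeIndex p) = 1 := rfl
      rw [hN, zpow_one, _root_.zpow_neg_one]
    · have hN : heckeN (Sum.inr x : HeckeIndex p) = -1 := if_pos hx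
      rw [hN, neg_neg, zpow_one, _root_.zpow_neg_one]
    · have hN : heckeN (Sum.inr x : HeckeIndex p) = 0 := if_neg hx
      rw [hN, neg_zero, zpow_zero, zpow_zero, one_mul, one_mul]

/-- The Hecke eigenvalue and the central character of a constituent of an unramified principal
series. -/
theorem hecke_of_isConstituent (F : RamifiedCompletion p E) (hp : p ≠ 2) {V : Type*}
    [AddCommGroup V] [Module ℂ V] {π : Representation ℂ F.G V} {η : F.T →* ℂˣ}
    (hπ : F.IsConstituent η π) {v : V} (hv : ∀ k ∈ F.K, π k v = v) :
    ∑ i, π (F.heckeRep i) v =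
      (p * (F.eta₁ η F.ϖ : ℂ) + p * (F.eta₁ η F.ϖ : ℂ)⁻¹ + (p - 1)) • v ∧
    π F.zz v = (F.eta₂ η F.ϖ : ℂ) • v := by
  obtain ⟨M, hM, A, hA⟩ := hπ
  obtain ⟨f₀, rfl⟩ := hA v
  obtain ⟨S, hS, hfS⟩ := (hM f₀.2).2
  let ρ := M.toRepresentation.comp F.K.subtype
  have hfin := F.finite_quotient_of_isOpen hp hS
  have := Fintype.ofFinite (F.K ⧸ S.subgroupOf F.K)
  have hρ : ∀ s ∈ S.subgroupOf F.K, ρ s f₀ = f₀ := fun s hs =>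
    Subtype.ext (funext fun g => hfS g s hs)
  -- A preimage of v need not be fixed by K. Its orbit sum is, and it maps to a nonzero multiple of
  -- v.
  let f := ∑ q : F.K ⧸ S.subgroupOf F.K, ρ q.out f₀
  have hfK : ∀ k ∈ F.K, M.toRepresentation k f = f := fun k hk => apply_sum_out ρ hρ ⟨k, hk⟩
  have hfK' : ∀ k ∈ F.K, F.rightReg k f.1 = f.1 := fun k hk => congrArg Subtype.val (hfK k hk)
  have hN : (Fintype.card (F.K ⧸ S.subgroupOf F.K) : ℂ) ≠ 0 := by
    exact_mod_cast Fintype.card_ne_zero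
  have hAf : A f = (Fintype.card (F.K ⧸ S.subgroupOf F.K) : ℂ) • A f₀ := by
    have h1 : ∀ q : F.K ⧸ S.subgroupOf F.K, A (ρ q.out f₀) = A f₀ := fun q => by
      rw [← hv _ q.out.2, ← A.isIntertwining]; rfl
    rw [map_sum, Finset.sum_congr rfl fun q _ => h1 q, Finset.sum_const, Finset.card_univ,
      Nat.cast_smul_eq_nsmul]
  have hT : ∑ i, M.toRepresentation (F.heckeRep i) f =
      (p * (F.eta₁ η F.ϖ : ℂ) + p * (F.eta₁ η F.ϖ : ℂ)⁻¹ + (p - 1)) • f := by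
    apply Subtype.ext
    rw [← M.toSubmodule.subtype_apply, map_sum]
    exact F.sum_heckeRep_ind hp (hM f.2) hfK'
  have hZ : M.toRepresentation F.zz f = (F.eta₂ η F.ϖ : ℂ) • f := by
    apply Subtype.ext
    funext g
    change f.1 (g * F.zz) = (F.eta₂ η F.ϖ : ℂ) * f.1 g
    have h0 : F.tor 0 1 = F.zz := by simp [tor]
    have h := F.ind_apply_uni_tor hp (hM f.2) 0 0 0 1 g
    rw [uni_zero, one_mul, h0] at h
    rw [zz_central, h, eta₂_ϖ]
    simp
  have hT' := congrArg A hT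
  have hZ' := congrArg A hZ
  simp only [map_sum, map_smul, A.isIntertwining, hAf] at hT' hZ'
  rw [← Finset.smul_sum, smul_comm] at hT'
  rw [smul_comm] at hZ'
  exact ⟨smul_right_injective _ hN hT'.symm.symm, smul_right_injective _ hN hZ'⟩

/-! ### Values of the spherical Whittaker function -/

/-- The complete homogeneous symmetric polynomial of degree `n` in `a` and `a⁻¹`. -/
def hsym (a : ℂ) (n : ℕ) : ℂ := ∑ ij ∈ Finset.HasAntidiagonal.antidiagonal n, a ^ ij.1 * a⁻¹ ^ ij.2

/-- The normalized values of the spherical Whittaker function. -/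
def sphericalCoeff (a : ℂ) : ℕ → ℂ
  | 0 => 1
  | n + 1 => hsym a (n + 1) + hsym a n

theorem hsym_succ (a : ℂ) (n : ℕ) : hsym a (n + 1) = a⁻¹ * hsym a n + a ^ (n + 1) := by
  rw [hsym, Finset.Nat.sum_antidiagonal_succ', hsym, Finset.mul_sum, pow_zero, mul_one, add_comm]
  congr 1
  exact Finset.sum_congr rfl fun x _ => by rw [pow_succ]; ring

theorem hsym_zero (a : ℂ) : hsym a 0 = 1 := by simp [hsym]

theorem hsym_recursion {a : ℂ} (ha : a ≠ 0) (n : ℕ) :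
    hsym a (n + 2) + hsym a n = (a + a⁻¹) * hsym a (n + 1) := by
  rw [hsym_succ a (n + 1), hsym_succ a n]
  field_simp
  ring

/-- A sum of two shifted solutions of the same linear recursion. The initial value 1 agrees with the
convention h₋₁ = 0. -/
theorem sphericalCoeff_recursion {a : ℂ} (ha : a ≠ 0) (n : ℕ) :
    sphericalCoeff a (n + 2) + sphericalCoeff a n = (a + a⁻¹) * sphericalCoeff a (n + 1) := by
  cases n with
  | zero =>
    have h := hsym_recursion ha 0
    have h1 := hsym_succ a 0
    simp only [sphericalCoeff, hsym_zero, zero_add, pow_one, mul_one] at h h1 ⊢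
    linear_combination h + h1
  | succ n =>
    have h := hsym_recursion ha n
    have h1 := hsym_recursion ha (n + 1)
    simp only [sphericalCoeff]
    linear_combination h + h1

theorem hasSum_hsym {a X : ℂ} (h1 : ‖a * X‖ < 1) (h2 : ‖a⁻¹ * X‖ < 1) :
    HasSum (fun n => hsym a n * X ^ n) ((1 - a * X)⁻¹ * (1 - a⁻¹ * X)⁻¹) := by
  have s1 := (summable_geometric_of_norm_lt_one h1).norm
  have s2 := (summable_geometric_of_norm_lt_one h2).norm
  have h3 := tsum_mul_tsum_eq_tsum_sum_antidiagonal_of_summable_norm s1 s2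
  have h4 := (summable_norm_sum_mul_antidiagonal_of_summable_norm s1 s2).of_norm
  rw [tsum_geometric_of_norm_lt_one h1, tsum_geometric_of_norm_lt_one h2] at h3
  have h5 : (fun n => hsym a n * X ^ n) = fun n =>
      ∑ ij ∈ Finset.HasAntidiagonal.antidiagonal n, (a * X) ^ ij.1 * (a⁻¹ * X) ^ ij.2 := by
    funext n
    rw [hsym, Finset.sum_mul]
    refine Finset.sum_congr rfl fun ij hij => ?_
    rw [← Finset.HasAntidiagonal.mem_antidiagonal.1 hij, mul_pow, mul_pow, pow_add]
    ring
  rw [h3, h5]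
  exact h4.hasSum

theorem hasSum_sphericalCoeff {a X : ℂ} (h1 : ‖a * X‖ < 1) (h2 : ‖a⁻¹ * X‖ < 1) :
    HasSum (fun n => sphericalCoeff a n * X ^ n)
      ((1 + X) * ((1 - a * X)⁻¹ * (1 - a⁻¹ * X)⁻¹)) := by
  have h := hasSum_hsym h1 h2
  have h3 := (hasSum_nat_add_iff' 1).2 h
  simp only [Finset.range_one, Finset.sum_singleton, pow_zero, hsym_zero, mul_one] at h3
  have h4 := h3.add (h.mul_left X)
  refine (hasSum_nat_add_iff' 1).1 ?_
  simp only [Finset.range_one, Finset.sum_singleton, pow_zero, mul_one, sphericalCoeff]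
  convert h4 using 2
  · rw [pow_succ]; ring
  · ring

/-- The generating series of the spherical values is the `L`-factor. -/
theorem hasSum_sphericalCoeff_mul {a X : ℂ} (ha : a ≠ 0) (h1 : ‖a * X‖ < 1)
    (h2 : ‖a⁻¹ * X‖ < 1) :
    HasSum (fun x : ℕ × ℕ => sphericalCoeff a x.1 * X ^ (x.1 + 2 * x.2))
      (1 / ((1 - a * X) * (1 - X) * (1 - a⁻¹ * X))) := by
  -- The two given bounds suffice, as X² is the product of aX and a⁻¹X.
  have h3 : ‖X ^ 2‖ < 1 := by
    have : X ^ 2 = a * X * (a⁻¹ * X) := by field_simp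
    rw [this, norm_mul]
    exact mul_lt_one_of_nonneg_of_lt_one_left (norm_nonneg _) h1 h2.le
  have hw := hasSum_sphericalCoeff h1 h2
  have hg := hasSum_geometric_of_norm_lt_one h3
  have hs := summable_mul_of_summable_norm hw.summable.norm hg.summable.norm
  have hm : HasSum (fun x : ℕ × ℕ => sphericalCoeff a x.1 * X ^ x.1 * (X ^ 2) ^ x.2) _ := hw.mul hg hs
  have hX : (1 - X) * (1 + X) ≠ 0 := by
    intro h
    have : X ^ 2 = 1 := by linear_combination -h
    rw [this, norm_one] at h3
    exact lt_irrefl _ h3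
  have hX2 := right_ne_zero_of_mul hX
  have e1 : (fun x : ℕ × ℕ => sphericalCoeff a x.1 * X ^ (x.1 + 2 * x.2)) =
      fun x => sphericalCoeff a x.1 * X ^ x.1 * (X ^ 2) ^ x.2 := by
    funext x
    rw [pow_add, pow_mul, mul_assoc]
  have e2 : 1 / ((1 - a * X) * (1 - X) * (1 - a⁻¹ * X)) =
      (1 + X) * ((1 - a * X)⁻¹ * (1 - a⁻¹ * X)⁻¹) * (1 - X ^ 2)⁻¹ := by
    have e3 : (1 - X ^ 2)⁻¹ = (1 - X)⁻¹ * (1 + X)⁻¹ := by rw [← _root_.mul_inv]; congr 1; ring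
    rw [e3, one_div, _root_.mul_inv, _root_.mul_inv]
    linear_combination (-(1 - a * X)⁻¹ * (1 - a⁻¹ * X)⁻¹ * (1 - X)⁻¹) * mul_inv_cancel₀ hX2
  rw [e1, e2]
  exact hm

section SphericalValues

variable {V : Type*} [AddCommGroup V] [Module ℂ V]

/-- The factor pⁿ is the inverse of the square root of the modulus. For n > 0 the terms p - 1 on
both sides of the recursion cancel, leaving the recursion of the symmetric polynomials. For n = 0 a
term p survives and gives the first value a + a⁻¹ + 1. -/
theorem whittaker_tor_nat (F : RamifiedCompletion p E) (hp : p ≠ 2) {ψ : AddChar ℚ_[p] ℂ}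
    (hψ : IsUnramifiedAddChar ψ) {π : Representation ℂ F.G V} {Λ : V →ₗ[ℂ] ℂ}
    (hΛ : F.IsWhittaker ψ π Λ) {v : V} (hv : ∀ k ∈ F.K, π k v = v) {a : ℂ} (ha : a ≠ 0)
    (hc : ∑ i, π (F.heckeRep i) v = (p * a + p * a⁻¹ + (p - 1)) • v) (n : ℕ) :
    p ^ n * Λ (π (F.tor n 0) v) = sphericalCoeff a n * Λ v := by
  have hpC : (p : ℂ) ≠ 0 := by exact_mod_cast (Fact.out : p.Prime).ne_zero
  have h0 : Λ (π (F.tor 0 0) v) = Λ v := by simp [tor]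
  have hneg : Λ (π (F.tor (-1) 0) v) = 0 := F.whittaker_tor_neg hp hψ hΛ hv (by norm_num)
  induction n using Nat.twoStepInduction with
  | zero => simpa [sphericalCoeff] using h0
  | one =>
    have h := F.whittaker_recursion hp hψ hΛ hc 0
    simp only [Nat.cast_zero, zero_add, zero_sub, if_true, h0, hneg] at h
    have h1 := hsym_succ a 0
    simp only [sphericalCoeff, hsym_zero, zero_add, pow_one, mul_one, Nat.cast_one] at h1 ⊢
    rw [h1]
    apply mul_left_cancel₀ hpC
    linear_combination h
  | more n ih1 ih2 =>
    have h := F.whittaker_recursion hp hψ hΛ hc (n + 1)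
    rw [if_neg (Nat.succ_ne_zero n)] at h
    push_cast at h ih2 ⊢
    rw [add_sub_cancel_right, add_assoc (n : ℤ) 1 1, one_add_one_eq_two] at h
    have hr := sphericalCoeff_recursion ha n
    rw [pow_succ] at ih2
    have h5 : (p : ℂ) ^ n * (p ^ 2 * Λ (π (F.tor (n + 2) 0) v) + Λ (π (F.tor n 0) v)) =
        p ^ n * (p * (a + a⁻¹) * Λ (π (F.tor (n + 1) 0) v)) := by
      congr 1; linear_combination h
    rw [pow_add]
    linear_combination h5 + (a + a⁻¹) * ih2 - ih1 - Λ v * hr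

/-- The spherical Whittaker function on the dominant part of the torus. -/
theorem whittaker_apply (F : RamifiedCompletion p E) (hp : p ≠ 2) {ψ : AddChar ℚ_[p] ℂ}
    (hψ : IsUnramifiedAddChar ψ) {π : Representation ℂ F.G V} (hirr : π.IsIrreducible)
    (hadm : F.IsAdmissible π) {Λ : V →ₗ[ℂ] ℂ} (hΛ : F.IsWhittaker ψ π Λ) {v : V}
    (hv0 : v ≠ 0) (hv : ∀ k ∈ F.K, π k v = v) {η : F.T →* ℂˣ} (hη : F.IsConstituent η π)
    (d : E) (r : ℚ_[p]) (n : ℕ) (m : ℤ) {k : F.G} (hk : k ∈ F.K) :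
    F.whittaker π Λ v (F.uni d r * F.tor n m * k) =
      F.chi ψ (F.uni d r) * ((F.eta₂ η F.ϖ : ℂ) ^ m *
        (((p : ℂ) ^ n)⁻¹ * sphericalCoeff (F.eta₁ η F.ϖ) n)) := by
  have hpC : (p : ℂ) ≠ 0 := by exact_mod_cast (Fact.out : p.Prime).ne_zero
  have hΛv := F.whittaker_apply_ne_zero hp hψ hirr hadm hΛ hv0 hv
  obtain ⟨h1, h2⟩ := F.hecke_of_isConstituent hp hη hv
  obtain ⟨ω, hω0, hω⟩ := F.exists_central_scalar hirr hadm hv0 hv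
  have hω' : ω = F.eta₂ η F.ϖ := smul_left_injective ℂ hv0 (by
    change ω • v = _ • v
    rw [← hω, h2])
  have h3 := F.whittaker_tor_nat hp hψ hΛ hv (F.eta₁ η F.ϖ).ne_zero h1 n
  rw [whittaker, map_mul π _ k, Module.End.mul_apply, hv k hk, F.whittaker_uni hΛ,
    F.apply_tor hω0 hω, map_smul, smul_eq_mul, hω']
  field_simp
  linear_combination F.chi ψ (F.uni d r) * h3

theorem whittaker_apply_of_neg (F : RamifiedCompletion p E) (hp : p ≠ 2) {ψ : AddChar ℚ_[p] ℂ}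
    (hψ : IsUnramifiedAddChar ψ) {π : Representation ℂ F.G V} (hirr : π.IsIrreducible)
    (hadm : F.IsAdmissible π) {Λ : V →ₗ[ℂ] ℂ} (hΛ : F.IsWhittaker ψ π Λ) {v : V}
    (hv0 : v ≠ 0) (hv : ∀ k ∈ F.K, π k v = v) (d : E) (r : ℚ_[p]) {n : ℤ} (hn : n < 0) (m : ℤ)
    {k : F.G} (hk : k ∈ F.K) : F.whittaker π Λ v (F.uni d r * F.tor n m * k) = 0 := by
  obtain ⟨ω, hω0, hω⟩ := F.exists_central_scalar hirr hadm hv0 hv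
  rw [whittaker, map_mul π _ k, Module.End.mul_apply, hv k hk, F.whittaker_uni hΛ,
    F.apply_tor hω0 hω, map_smul, F.whittaker_tor_neg hp hψ hΛ hv hn, smul_zero, mul_zero, zero_div]

end SphericalValues

/-! ### The group `H` -/

theorem H_ext (F : RamifiedCompletion p E) {a b : F.H} (h1 : F.fstMat a = F.fstMat b)
    (h2 : a.1.2 = b.1.2) : a = b :=
  Subtype.ext (Prod.ext (Units.ext h1) h2)

/-- The element of `H` with the given components. -/
def ofH (F : RamifiedCompletion p E) (A : Matrix (Fin 2) (Fin 2) ℚ_[p]) (l : Eˣ)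
    (h : ι A.det = l * F.conj l) : F.H :=
  ⟨(Matrix.GeneralLinearGroup.mkOfDetNeZero A (by
    intro h0
    rw [h0, map_zero] at h
    exact mul_ne_zero l.ne_zero (F.conj_ne_zero.2 l.ne_zero) h.symm), l), h⟩

@[simp] theorem fstMat_ofH (F : RamifiedCompletion p E) (A : Matrix (Fin 2) (Fin 2) ℚ_[p]) (l : Eˣ)
    (h : ι A.det = l * F.conj l) : F.fstMat (F.ofH A l h) = A := rfl

@[simp] theorem snd_ofH (F : RamifiedCompletion p E) (A : Matrix (Fin 2) (Fin 2) ℚ_[p]) (l : Eˣ)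
    (h : ι A.det = l * F.conj l) : (F.ofH A l h).1.2 = l := rfl

theorem val_det₁ (F : RamifiedCompletion p E) (h : F.H) :
    (F.det₁ h : ℚ_[p]) = (F.fstMat h).det := rfl

theorem det₁_mul (F : RamifiedCompletion p E) (a b : F.H) :
    F.det₁ (a * b) = F.det₁ a * F.det₁ b :=
  map_mul Matrix.GeneralLinearGroup.det a.1.1 b.1.1

theorem algebraMap_det₁ (F : RamifiedCompletion p E) (h : F.H) :
    ι (F.det₁ h) = h.1.2 * F.conj h.1.2 := h.2

theorem norm_snd_sq (F : RamifiedCompletion p E) (hp : p ≠ 2) (h : F.H) :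
    ‖(h.1.2 : E)‖ ^ 2 = ‖(F.det₁ h : ℚ_[p])‖ := by
  rw [← norm_algebraMap' E (F.det₁ h : ℚ_[p]), algebraMap_det₁, norm_mul, F.norm_conj hp, pow_two]

theorem similitude_iota (F : RamifiedCompletion p E) (h : F.H) :
    F.similitude (F.iota h) = F.det₁ h := by
  have h1 := F.col_rel (F.iota h) 1 1
  have h2 := F.algebraMap_det₁ h
  have e : F.mat (F.iota h) = embMat (F.fstMat h) (h.1.2 : E) := rfl
  rw [e] at h1
  simp [embMat, J] at h1
  ext1
  apply (algebraMap ℚ_[p] E).injective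
  rw [h2, ← h1, mul_comm]

theorem det_fin_two_inv (F : RamifiedCompletion p E) (h : F.H) :
    F.fstMat h⁻¹ = (F.det₁ h : ℚ_[p])⁻¹ • !![F.fstMat h 1 1, -F.fstMat h 0 1;
      -F.fstMat h 1 0, F.fstMat h 0 0] := by
  rw [fstMat_inv, Matrix.inv_def, Matrix.adjugate_fin_two, Ring.inverse_eq_inv', val_det₁]

theorem mem_KH_iff (F : RamifiedCompletion p E) (hp : p ≠ 2) (h : F.H) :
    h ∈ F.KH ↔ (∀ i j, ‖F.fstMat h i j‖ ≤ 1) ∧ ‖(F.det₁ h : ℚ_[p])‖ = 1 := by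
  constructor
  · rintro ⟨h1, h2⟩
    refine ⟨fun i j => (h1 i j).1, ?_⟩
    rw [← F.norm_snd_sq hp, h2, one_pow]
  · rintro ⟨h1, h2⟩
    refine ⟨fun i j => ⟨h1 i j, ?_⟩, ?_⟩
    · change ‖F.fstMat h⁻¹ i j‖ ≤ 1
      rw [det_fin_two_inv, Matrix.smul_apply, norm_smul, norm_inv, h2, inv_one, one_mul]
      fin_cases i <;> fin_cases j <;> simp [h1]
    · exact (pow_eq_one_iff_of_nonneg (norm_nonneg _) two_ne_zero).1 ((F.norm_snd_sq hp h).trans h2)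

theorem iota_mem_K (F : RamifiedCompletion p E) (hp : p ≠ 2) {h : F.H} (hh : h ∈ F.KH) :
    F.iota h ∈ F.K := by
  have h1 := ((F.mem_KH_iff hp h).1 hh)
  rw [F.mem_K_iff hp, similitude_iota]
  refine ⟨fun i j => ?_, h1.2⟩
  have e : F.mat (F.iota h) = embMat (F.fstMat h) (h.1.2 : E) := rfl
  rw [e]
  fin_cases i <;> fin_cases j <;> simp [embMat, h1.1, hh.2]

/-- The element of `U₂` with upper right entry `x`. -/
def unip (F : RamifiedCompletion p E) (x : ℚ_[p]) : F.H :=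
  F.ofH !![1, x; 0, 1] 1 (by simp [Matrix.det_fin_two])

theorem unip_mem (F : RamifiedCompletion p E) (x : ℚ_[p]) : F.unip x ∈ F.U₂ := by
  refine ⟨?_, ?_, ?_, ?_⟩ <;> simp [unip]

theorem eq_unip (F : RamifiedCompletion p E) {u : F.H} (hu : u ∈ F.U₂) :
    u = F.unip (F.fstMat u 0 1) := by
  obtain ⟨h1, h2, h3, h4⟩ := hu
  refine F.H_ext ?_ ?_
  · ext i j
    fin_cases i <;> fin_cases j <;> simp [unip, h1, h2, h3]
  · simp [unip, h4]

theorem unip_mul (F : RamifiedCompletion p E) (x y : ℚ_[p]) :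
    F.unip x * F.unip y = F.unip (x + y) := by
  refine F.H_ext ?_ ?_
  · rw [fstMat_mul]
    ext i j
    fin_cases i <;> fin_cases j <;> simp [unip, Matrix.mul_apply, Fin.sum_univ_two, add_comm]
  · change (1 : Eˣ) * 1 = 1
    simp

theorem unip_inv (F : RamifiedCompletion p E) (x : ℚ_[p]) : (F.unip x)⁻¹ = F.unip (-x) := by
  have h0 : F.unip 0 = 1 := by
    refine F.H_ext ?_ rfl
    ext i j
    fin_cases i <;> fin_cases j <;> simp [unip, fstMat_one]
  rw [inv_eq_iff_mul_eq_one, unip_mul, add_neg_cancel, h0]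

theorem iota_unip (F : RamifiedCompletion p E) (x : ℚ_[p]) : F.iota (F.unip x) = F.uni 0 x := by
  apply F.G_ext
  have e : F.mat (F.iota (F.unip x)) = embMat !![1, x; 0, 1] 1 := rfl
  rw [e, mat_uni]
  ext i j
  fin_cases i <;> fin_cases j <;> simp [embMat]

/-- The bottom row of an element of `H` is not changed by left multiplication by `U₂`. -/
theorem fstMat_unip_mul (F : RamifiedCompletion p E) (x : ℚ_[p]) (h : F.H) (j : Fin 2) :
    F.fstMat (F.unip x * h) 1 j = F.fstMat h 1 j := by
  rw [fstMat_mul]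
  simp [unip, Matrix.mul_apply, Fin.sum_univ_two]

theorem det₁_unip (F : RamifiedCompletion p E) (x : ℚ_[p]) : F.det₁ (F.unip x) = 1 := by
  ext1
  rw [val_det₁]
  simp [unip, Matrix.det_fin_two]

/-- The element `diag(Dⁱ, Dʲ)` of `T_H`. -/
def diagH (F : RamifiedCompletion p E) (i j : ℤ) : F.H :=
  -- Powers of D are used because D = δ·conj δ is the norm of ϖ, whereas p itself may fail to be a
  -- norm from E_p.
  F.ofH !![(F.D : ℚ_[p]) ^ i, 0; 0, (F.D : ℚ_[p]) ^ j] (F.ϖ ^ (i + j)) (by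
    have hchar := F.charZero
    have hD : (F.D : E) ≠ 0 := by exact_mod_cast F.D_ne_zero
    have h1 : (F.D : E) = F.δ * -F.δ := by linear_combination F.δ_sq
    rw [Matrix.det_fin_two]
    simp only [of_apply, cons_val', cons_val_zero, cons_val_one, cons_val_fin_one, mul_zero,
      sub_zero, map_mul, map_zpow₀, map_natCast, Units.val_zpow_eq_zpow_val]
    rw [← zpow_add₀ hD, h1, _root_.mul_zpow]
    simp [ϖ, F.conj_δ])

theorem diagH_mem (F : RamifiedCompletion p E) (i j : ℤ) : F.diagH i j ∈ F.TH := by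
  constructor <;> simp [diagH]

theorem norm_det₁_diagH (F : RamifiedCompletion p E) (hp : p ≠ 2) (i j : ℤ) :
    ‖(F.det₁ (F.diagH i j) : ℚ_[p])‖ = ‖F.δ‖ ^ (2 * (i + j)) := by
  rw [val_det₁]
  simp only [diagH, fstMat_ofH, Matrix.det_fin_two, of_apply, cons_val', cons_val_zero,
    cons_val_one, cons_val_fin_one, mul_zero, sub_zero]
  rw [norm_mul, F.norm_D_zpow hp, F.norm_D_zpow hp, ← zpow_add₀ F.norm_δ_pos.ne', mul_add]

/-- Left multiplication by the inverse of `diag(Dⁱ, Dʲ)`. -/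
theorem fstMat_diagH_inv_mul (F : RamifiedCompletion p E) (i j : ℤ) (h : F.H) :
    F.fstMat ((F.diagH i j)⁻¹ * h) =
      !![(F.D : ℚ_[p]) ^ (-i) * F.fstMat h 0 0, (F.D : ℚ_[p]) ^ (-i) * F.fstMat h 0 1;
        (F.D : ℚ_[p]) ^ (-j) * F.fstMat h 1 0, (F.D : ℚ_[p]) ^ (-j) * F.fstMat h 1 1] := by
  have hD : (F.D : ℚ_[p]) ≠ 0 := by exact_mod_cast F.D_ne_zero
  have h0 : (F.diagH i j)⁻¹ = F.diagH (-i) (-j) := by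
    rw [inv_eq_iff_mul_eq_one]
    refine F.H_ext ?_ ?_
    · rw [fstMat_mul]
      ext a b
      fin_cases a <;> fin_cases b <;>
        simp [diagH, Matrix.mul_apply, Fin.sum_univ_two, fstMat_one,
          mul_inv_cancel₀ (zpow_ne_zero _ hD)]
    · change F.ϖ ^ (i + j) * F.ϖ ^ (-i + -j) = 1
      rw [← _root_.zpow_add, show i + j + (-i + -j) = 0 by ring, zpow_zero]
  rw [h0, fstMat_mul]
  ext a b
  fin_cases a <;> fin_cases b <;> simp [diagH, Matrix.mul_apply, Fin.sum_univ_two]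

/-- The torus elements modulo the integral ones. -/
theorem exists_diagH (F : RamifiedCompletion p E) (hp : p ≠ 2) {t : F.H} (ht : t ∈ F.TH) :
    ∃ i j : ℤ, (F.diagH i j)⁻¹ * t ∈ F.KH ∧ ‖F.fstMat t 0 0‖ = ‖F.δ‖ ^ (2 * i) ∧
      ‖F.fstMat t 1 1‖ = ‖F.δ‖ ^ (2 * j) := by
  have hδ := F.norm_δ_pos.ne'
  have hdet : F.fstMat t 0 0 * F.fstMat t 1 1 ≠ 0 := by
    have := (F.det₁ t).ne_zero
    rwa [val_det₁, Matrix.det_fin_two, ht.1, zero_mul, sub_zero] at this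
  refine ⟨_, _, ?_, F.norm_padic_eq hp (left_ne_zero_of_mul hdet),
    F.norm_padic_eq hp (right_ne_zero_of_mul hdet)⟩
  have h1 := F.norm_padic_eq hp (left_ne_zero_of_mul hdet)
  have h2 := F.norm_padic_eq hp (right_ne_zero_of_mul hdet)
  set i := (F.fstMat t 0 0).valuation
  set j := (F.fstMat t 1 1).valuation
  have e1 : ‖(F.D : ℚ_[p]) ^ (-i) * F.fstMat t 0 0‖ = 1 := by
    rw [norm_mul, F.norm_D_zpow hp, h1, ← zpow_add₀ hδ]; simp
  have e2 : ‖(F.D : ℚ_[p]) ^ (-j) * F.fstMat t 1 1‖ = 1 := by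
    rw [norm_mul, F.norm_D_zpow hp, h2, ← zpow_add₀ hδ]; simp
  rw [F.mem_KH_iff hp, val_det₁, fstMat_diagH_inv_mul, ht.1, ht.2]
  refine ⟨fun a b => ?_, ?_⟩
  · fin_cases a <;> fin_cases b <;> simp only [mul_zero, Fin.zero_eta, Fin.mk_one, of_apply,
      cons_val', cons_val_zero, cons_val_one, cons_val_fin_one, e1, e2, norm_zero, zero_le_one,
      le_refl]
  · simp only [Matrix.det_fin_two, of_apply, cons_val', cons_val_zero, cons_val_one,
      cons_val_fin_one, mul_zero, sub_zero, norm_mul _ (_ * _ : ℚ_[p]), e1, e2, mul_one]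

theorem exists_tor_of_diagH (F : RamifiedCompletion p E) (hp : p ≠ 2) (i j : ℤ) :
    ∃ k ∈ F.K, F.iota (F.diagH i j) = F.tor (i - j) (i + j) * k := by
  have hδ := F.norm_δ_pos.ne'
  have hmem : F.iota (F.diagH i j) ∈ F.T := by
    have hD : (F.D : E) ≠ 0 := by have := F.charZero; exact_mod_cast F.D_ne_zero
    refine ⟨![Units.mk0 _ hD ^ i, F.ϖ ^ (i + j), Units.mk0 _ hD ^ j], ?_⟩
    ext1
    have e : (F.iota (F.diagH i j)).1.val =
      embMat !![(F.D : ℚ_[p]) ^ i, 0; 0, (F.D : ℚ_[p]) ^ j] ((F.ϖ ^ (i + j) : Eˣ) : E) := rfl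
    rw [e]
    ext a b
    fin_cases a <;> fin_cases b <;> simp [embMat, diagGL]
  have e : F.mat (F.iota (F.diagH i j)) =
      embMat !![(F.D : ℚ_[p]) ^ i, 0; 0, (F.D : ℚ_[p]) ^ j] ((F.ϖ ^ (i + j) : Eˣ) : E) := rfl
  obtain ⟨n, m, k, hk, h, h0, h1, -⟩ := F.exists_tor_mul hp ⟨_, hmem⟩
  rw [e] at h0 h1
  have h0' : ‖F.δ‖ ^ (2 * i) = ‖F.δ‖ ^ (n + m) := by
    rw [← h0, ← F.norm_D_zpow hp, ← norm_algebraMap' E]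
    simp [embMat]
  have h1' : ‖F.δ‖ ^ (i + j) = ‖F.δ‖ ^ m := by
    rw [← h1]
    simp [embMat, ϖ]
  have e0 := F.norm_δ_zpow_injective hp h0'
  have e1 := F.norm_δ_zpow_injective hp h1'
  refine ⟨k, hk, ?_⟩
  have h2 := congrArg Subtype.val h
  have en : i - j = n := by omega
  rw [en, e1]
  exact h2

/-- The Iwasawa decomposition of `H`. -/
theorem iwasawa_H (F : RamifiedCompletion p E) (hp : p ≠ 2) (h : F.H) :
    ∃ (x : ℚ_[p]) (i j : ℤ), (F.diagH i j)⁻¹ * (F.unip x * h) ∈ F.KH := by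
  have key : ∀ h : F.H, ‖F.fstMat h 1 0‖ ≤ ‖F.fstMat h 1 1‖ →
      ∃ (x : ℚ_[p]) (i j : ℤ), (F.diagH i j)⁻¹ * (F.unip x * h) ∈ F.KH := by
    intro h hle
    have hdet := (F.det₁ h).ne_zero
    rw [val_det₁, Matrix.det_fin_two] at hdet
    have hd : F.fstMat h 1 1 ≠ 0 := by
      intro h0
      rw [h0, norm_zero, norm_le_zero_iff] at hle
      rw [h0, hle, mul_zero, mul_zero, sub_zero] at hdet
      exact hdet rfl
    -- The inverse of k clears the lower left entry from the right, and `F.unip x` then clears the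
    -- upper right entry.
    let k : F.H := F.ofH !![1, 0; F.fstMat h 1 0 / F.fstMat h 1 1, 1] 1 (by
      simp [Matrix.det_fin_two])
    have hk : k ∈ F.KH := by
      rw [F.mem_KH_iff hp, val_det₁]
      constructor
      · intro i j
        fin_cases i <;> fin_cases j <;> simp [k, div_le_one_of_le₀ hle (norm_nonneg _)]
      · simp [k, Matrix.det_fin_two]
    let x : ℚ_[p] := -(F.fstMat h 0 1 / F.fstMat h 1 1)
    have hkinv : F.fstMat k⁻¹ = !![1, 0; -(F.fstMat h 1 0 / F.fstMat h 1 1), 1] := by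
      rw [det_fin_two_inv, val_det₁]
      ext i j
      fin_cases i <;> fin_cases j <;> simp [k, Matrix.det_fin_two]
    have ht : F.unip x * h * k⁻¹ ∈ F.TH := by
      have e : F.fstMat (F.unip x) = !![1, x; 0, 1] := rfl
      constructor
      · rw [fstMat_mul, fstMat_mul, hkinv, e]
        simp only [Matrix.mul_apply, Fin.sum_univ_two, of_apply, cons_val', cons_val_zero,
          cons_val_one, cons_val_fin_one, x]
        field_simp
        ring
      · rw [fstMat_mul, fstMat_mul, hkinv, e]
        simp only [Matrix.mul_apply, Fin.sum_univ_two, of_apply, cons_val', cons_val_zero,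
          cons_val_one, cons_val_fin_one, x]
        field_simp
        ring
    obtain ⟨i, j, hij, -⟩ := F.exists_diagH hp ht
    refine ⟨x, i, j, ?_⟩
    have := mul_mem hij hk
    rwa [mul_assoc, inv_mul_cancel_right] at this
  rcases le_total ‖F.fstMat h 1 0‖ ‖F.fstMat h 1 1‖ with hle | hle
  · exact key h hle
  · let w : F.H := F.ofH !![0, -1; 1, 0] 1 (by simp [Matrix.det_fin_two])
    have hw : w ∈ F.KH := by
      rw [F.mem_KH_iff hp, val_det₁]
      constructor
      · intro i j
        fin_cases i <;> fin_cases j <;> simp [w]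
      · simp [w, Matrix.det_fin_two]
    obtain ⟨x, i, j, hx⟩ := key (h * w) (by
      rw [fstMat_mul]
      simpa [w, Matrix.mul_apply, Fin.sum_univ_two] using hle)
    refine ⟨x, i, j, ?_⟩
    have := mul_mem hx (inv_mem hw)
    rwa [mul_assoc, mul_assoc, mul_inv_cancel_right] at this

/-- The double coset `U₂ diag(Dⁱ, Dʲ) H(ℤ_p)`. -/
def cell (F : RamifiedCompletion p E) (i j : ℤ) : Set F.H :=
  {h | ∃ x : ℚ_[p], (F.diagH i j)⁻¹ * (F.unip x * h) ∈ F.KH}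

theorem exists_mem_cell (F : RamifiedCompletion p E) (hp : p ≠ 2) (h : F.H) :
    ∃ i j : ℤ, h ∈ F.cell i j := by
  obtain ⟨x, i, j, hx⟩ := F.iwasawa_H hp h
  exact ⟨i, j, x, hx⟩

theorem unip_zero (F : RamifiedCompletion p E) : F.unip 0 = 1 := by
  have h := F.unip_mul 0 0
  rwa [add_zero, mul_eq_left] at h

theorem mem_cell_of_mem (F : RamifiedCompletion p E) {i j : ℤ} {t : F.H}
    (h : (F.diagH i j)⁻¹ * t ∈ F.KH) : t ∈ F.cell i j :=
  ⟨0, by rwa [unip_zero, one_mul]⟩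

theorem unip_mul_mem_cell (F : RamifiedCompletion p E) {i j : ℤ} {h : F.H} (x : ℚ_[p]) :
    F.unip x * h ∈ F.cell i j ↔ h ∈ F.cell i j := by
  constructor
  · rintro ⟨y, hy⟩
    refine ⟨y + x, ?_⟩
    rwa [← mul_assoc (F.unip y), unip_mul] at hy
  · rintro ⟨y, hy⟩
    refine ⟨y - x, ?_⟩
    rwa [← mul_assoc (F.unip _), unip_mul, sub_add_cancel]

theorem norm_det₁_of_mem_cell (F : RamifiedCompletion p E) (hp : p ≠ 2) {i j : ℤ} {h : F.H}
    (hh : h ∈ F.cell i j) : ‖(F.det₁ h : ℚ_[p])‖ = ‖F.δ‖ ^ (2 * (i + j)) := by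
  obtain ⟨x, hx⟩ := hh
  have h1 := ((F.mem_KH_iff hp _).1 hx).2
  have h2 : F.det₁ h = F.det₁ (F.diagH i j) * F.det₁ ((F.diagH i j)⁻¹ * (F.unip x * h)) := by
    rw [← det₁_mul, mul_inv_cancel_left, det₁_mul, det₁_unip, one_mul]
  rw [h2, Units.val_mul, norm_mul, h1, mul_one, F.norm_det₁_diagH hp]

theorem exists_norm_row_eq_one (F : RamifiedCompletion p E) (hp : p ≠ 2) {k : F.H}
    (hk : k ∈ F.KH) : ∃ b, ‖F.fstMat k 1 b‖ = 1 := by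
  obtain ⟨h1, h2⟩ := (F.mem_KH_iff hp k).1 hk
  by_contra! h
  have h0 : ∀ b, ‖F.fstMat k 1 b‖ < 1 := fun b => lt_of_le_of_ne (h1 1 b) (h b)
  rw [val_det₁, Matrix.det_fin_two] at h2
  have h3 : ‖F.fstMat k 0 0 * F.fstMat k 1 1 - F.fstMat k 0 1 * F.fstMat k 1 0‖ < 1 := by
    rw [sub_eq_add_neg]
    refine (Padic.nonarchimedean _ _).trans_lt (max_lt ?_ ?_)
    · rw [norm_mul]
      exact mul_lt_one_of_nonneg_of_lt_one_right (h1 0 0) (norm_nonneg _) (h0 1)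
    · rw [norm_neg, norm_mul]
      exact mul_lt_one_of_nonneg_of_lt_one_right (h1 0 1) (norm_nonneg _) (h0 0)
  exact h3.ne h2

theorem norm_row_of_mem_cell (F : RamifiedCompletion p E) (hp : p ≠ 2) {i j : ℤ} {h : F.H}
    (hh : h ∈ F.cell i j) : (∀ b, ‖F.fstMat h 1 b‖ ≤ ‖F.δ‖ ^ (2 * j)) ∧
      ∃ b, ‖F.fstMat h 1 b‖ = ‖F.δ‖ ^ (2 * j) := by
  obtain ⟨x, hx⟩ := hh
  have hδ := F.norm_δ_pos
  have h1 : ∀ b, ‖F.fstMat h 1 b‖ =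
      ‖F.δ‖ ^ (2 * j) * ‖F.fstMat ((F.diagH i j)⁻¹ * (F.unip x * h)) 1 b‖ := fun b => by
    have e : F.fstMat ((F.diagH i j)⁻¹ * (F.unip x * h)) 1 b =
        (F.D : ℚ_[p]) ^ (-j) * F.fstMat h 1 b := by
      rw [fstMat_diagH_inv_mul, ← F.fstMat_unip_mul x h b]
      fin_cases b <;> rfl
    rw [e, norm_mul, F.norm_D_zpow hp, ← mul_assoc, ← zpow_add₀ hδ.ne']
    simp
  refine ⟨fun b => ?_, ?_⟩
  · rw [h1]
    exact mul_le_of_le_one_right (zpow_pos hδ _).le (((F.mem_KH_iff hp _).1 hx).1 1 b)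
  · obtain ⟨b, hb⟩ := F.exists_norm_row_eq_one hp hx
    exact ⟨b, by rw [h1, hb, mul_one]⟩

/-- The determinant determines i + j, and the largest entry of the bottom row determines j. -/
theorem cell_eq (F : RamifiedCompletion p E) (hp : p ≠ 2) {i j i' j' : ℤ} {h : F.H}
    (hh : h ∈ F.cell i j) (hh' : h ∈ F.cell i' j') : i = i' ∧ j = j' := by
  have h1 := F.norm_δ_zpow_injective hp
    ((F.norm_det₁_of_mem_cell hp hh).symm.trans (F.norm_det₁_of_mem_cell hp hh'))
  obtain ⟨h2, b, h3⟩ := F.norm_row_of_mem_cell hp hh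
  obtain ⟨h2', b', h3'⟩ := F.norm_row_of_mem_cell hp hh'
  have h4 := h2' b
  have h5 := h2 b'
  rw [h3, F.norm_δ_zpow_le hp] at h4
  rw [h3', F.norm_δ_zpow_le hp] at h5
  omega

/-- The image of U₂ has d = 0, where χ is trivial. So W is constant on each cell and is given there
by its value at `F.tor (i - j) (i + j)`. -/
theorem exists_iota_of_mem_cell (F : RamifiedCompletion p E) (hp : p ≠ 2) {i j : ℤ} {h : F.H}
    (hh : h ∈ F.cell i j) : ∃ (r : ℚ_[p]), ∃ k ∈ F.K,
      F.iota h = F.uni 0 r * F.tor (i - j) (i + j) * k := by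
  obtain ⟨x, hx⟩ := hh
  obtain ⟨k, hk, h1⟩ := F.exists_tor_of_diagH hp i j
  refine ⟨-x, _, mul_mem hk (F.iota_mem_K hp hx), ?_⟩
  rw [mul_assoc, ← mul_assoc _ k, ← h1, ← iota_unip, ← map_mul, ← map_mul, mul_inv_cancel_left,
    ← unip_inv, inv_mul_cancel_left]

/-- The value of an unramified character of `ℚ_p^×`. -/
theorem unramified_apply (F : RamifiedCompletion p E) (hp : p ≠ 2) {ν₁ : ℚ_[p]ˣ →* ℂˣ}
    (hν : ∀ u : ℚ_[p]ˣ, ‖(u : ℚ_[p])‖ = 1 → ν₁ u = 1) {u : ℚ_[p]ˣ} {m : ℤ}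
    (hu : ‖(u : ℚ_[p])‖ = ‖F.δ‖ ^ (2 * m)) : ν₁ u = ν₁ (pUnit p) ^ m := by
  have h1 := hν (u * (pUnit p ^ m)⁻¹) (by
    have h2 : ‖((pUnit p : ℚ_[p]ˣ) : ℚ_[p])‖ = ‖F.δ‖ ^ (2 : ℤ) := by
      rw [pUnit, Units.val_mk0, Padic.norm_p, ← F.norm_δ_sq hp]; norm_cast
    rw [Units.val_mul, norm_mul, hu, Units.val_inv_eq_inv_val, norm_inv, Units.val_zpow_eq_zpow_val,
      norm_zpow, h2, ← _root_.zpow_mul]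
    exact mul_inv_cancel₀ (zpow_ne_zero _ F.norm_δ_pos.ne'))
  rw [map_mul, map_inv, map_zpow, mul_inv_eq_one] at h1
  exact h1

theorem ofReal_pow_cpow {r : ℝ} (hr : 0 ≤ r) (m : ℕ) (s : ℂ) :
    ((r ^ m : ℝ) : ℂ) ^ s = ((r : ℂ) ^ s) ^ m := by
  induction m with
  | zero => simp
  | succ m ih =>
    rw [pow_succ, pow_succ, ← ih, Complex.ofReal_mul, Complex.mul_cpow_ofReal_nonneg (pow_nonneg hr _) hr]

theorem norm_cpow (F : RamifiedCompletion p E) (hp : p ≠ 2) {u : ℚ_[p]} {m : ℕ}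
    (hu : ‖u‖ = ‖F.δ‖ ^ (2 * m : ℤ)) (s : ℂ) :
    ((‖u‖ : ℝ) : ℂ) ^ s = ((p : ℂ) ^ (-s)) ^ m := by
  have h1 : ‖u‖ = ((p : ℝ)⁻¹) ^ m := by
    rw [hu, ← F.norm_δ_sq hp, ← pow_mul]; norm_cast
  rw [h1, ofReal_pow_cpow (by positivity), Complex.cpow_neg, Complex.ofReal_inv,
    Complex.ofReal_natCast, Complex.inv_cpow]
  rw [Complex.natCast_arg]
  exact Real.pi_pos.ne

/-! ### The two integrands on the cells of H -/

section Integrands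

variable {V : Type*} [AddCommGroup V] [Module ℂ V]

theorem whittaker_of_mem_cell (F : RamifiedCompletion p E) (hp : p ≠ 2) {ψ : AddChar ℚ_[p] ℂ}
    (hψ : IsUnramifiedAddChar ψ) {π : Representation ℂ F.G V} (hirr : π.IsIrreducible)
    (hadm : F.IsAdmissible π) {Λ : V →ₗ[ℂ] ℂ} (hΛ : F.IsWhittaker ψ π Λ) {v : V}
    (hv0 : v ≠ 0) (hv : ∀ k ∈ F.K, π k v = v) {η : F.T →* ℂˣ} (hη : F.IsConstituent η π)
    {n j : ℕ} {h : F.H} (hh : h ∈ F.cell (n + j) j) :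
    F.whittaker π Λ v (F.iota h) = (F.eta₂ η F.ϖ : ℂ) ^ (n + 2 * j) *
        (((p : ℂ) ^ n)⁻¹ * sphericalCoeff (F.eta₁ η F.ϖ) n) := by
  obtain ⟨r, k, hk, h1⟩ := F.exists_iota_of_mem_cell hp hh
  rw [h1, add_sub_cancel_right, F.whittaker_apply hp hψ hirr hadm hΛ hv0 hv hη _ _ _ _ hk,
    F.chi_uni_eq_one hp hψ (by simp), one_mul]
  congr 1
  rw [← zpow_natCast]
  congr 1
  push_cast
  ring

theorem whittaker_eq_zero_of_mem_cell (F : RamifiedCompletion p E) (hp : p ≠ 2)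
    {ψ : AddChar ℚ_[p] ℂ} (hψ : IsUnramifiedAddChar ψ) {π : Representation ℂ F.G V}
    (hirr : π.IsIrreducible) (hadm : F.IsAdmissible π) {Λ : V →ₗ[ℂ] ℂ} (hΛ : F.IsWhittaker ψ π Λ)
    {v : V} (hv0 : v ≠ 0) (hv : ∀ k ∈ F.K, π k v = v) {i j : ℤ} (hij : i < j) {h : F.H}
    (hh : h ∈ F.cell i j) : F.whittaker π Λ v (F.iota h) = 0 := by
  obtain ⟨r, k, hk, h1⟩ := F.exists_iota_of_mem_cell hp hh
  rw [h1]
  exact F.whittaker_apply_of_neg hp hψ hirr hadm hΛ hv0 hv _ _ (sub_neg.2 hij) _ hk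

theorem norm_δ_zpow_le_one (F : RamifiedCompletion p E) (hp : p ≠ 2) {m : ℤ} :
    ‖F.δ‖ ^ m ≤ 1 ↔ 0 ≤ m := by
  rw [← zpow_zero ‖F.δ‖, F.norm_δ_zpow_le hp]

theorem charLattice_of_mem_cell (F : RamifiedCompletion p E) (hp : p ≠ 2) {i j : ℤ} {h : F.H}
    (hh : h ∈ F.cell i j) :
    charLattice p (![0, 1] ᵥ* F.fstMat h) = if 0 ≤ j then 1 else 0 := by
  have e : ∀ b, (![0, 1] ᵥ* F.fstMat h) b = F.fstMat h 1 b := fun b => by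
    simp [Matrix.vecMul, dotProduct, Fin.sum_univ_two]
  obtain ⟨h1, b, h2⟩ := F.norm_row_of_mem_cell hp hh
  rw [charLattice]
  congr 1
  rw [eq_iff_iff]
  constructor
  · intro h3
    have h4 := h3 b
    rw [e, h2, F.norm_δ_zpow_le_one hp] at h4
    omega
  · intro hj b
    rw [e]
    refine (h1 b).trans ((F.norm_δ_zpow_le_one hp).2 (by omega))

/-- The zeta integrand on the cells which contribute. -/
theorem zetaIntegrand_of_mem_cell (F : RamifiedCompletion p E) (hp : p ≠ 2) {ψ : AddChar ℚ_[p] ℂ}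
    (hψ : IsUnramifiedAddChar ψ) {π : Representation ℂ F.G V} (hirr : π.IsIrreducible)
    (hadm : F.IsAdmissible π) {Λ : V →ₗ[ℂ] ℂ} (hΛ : F.IsWhittaker ψ π Λ) {v : V}
    (hv0 : v ≠ 0) (hv : ∀ k ∈ F.K, π k v = v) {η : F.T →* ℂˣ} (hη : F.IsConstituent η π)
    {ν₁ : ℚ_[p]ˣ →* ℂˣ} (hν : ∀ u : ℚ_[p]ˣ, ‖(u : ℚ_[p])‖ = 1 → ν₁ u = 1) (s : ℂ)
    {n j : ℕ} {h : F.H} (hh : h ∈ F.cell (n + j) j) :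
    F.zetaIntegrand (F.whittaker π Λ v) (charLattice p) ν₁ s h =
      ((p : ℂ) ^ n)⁻¹ * (sphericalCoeff (F.eta₁ η F.ϖ) n *
        ((ν₁ (pUnit p) : ℂ) * F.eta₂ η F.ϖ * (p : ℂ) ^ (-s)) ^ (n + 2 * j)) := by
  have hdet := F.norm_det₁_of_mem_cell hp hh
  have e : (n + j + j : ℤ) = ((n + 2 * j : ℕ) : ℤ) := by push_cast; ring
  rw [e] at hdet
  rw [zetaIntegrand, F.charLattice_of_mem_cell hp hh, if_pos (Int.natCast_nonneg j),
    F.whittaker_of_mem_cell hp hψ hirr hadm hΛ hv0 hv hη hh, F.unramified_apply hp hν hdet,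
    F.norm_cpow hp hdet, Units.val_zpow_eq_zpow_val, zpow_natCast, mul_pow, mul_pow]
  ring

/-- Φ forces j ≥ 0 and W forces i ≥ j. This is why the contributing cells are indexed by pairs of
natural numbers with i = n + j. -/
theorem zetaIntegrand_eq_zero (F : RamifiedCompletion p E) (hp : p ≠ 2) {ψ : AddChar ℚ_[p] ℂ}
    (hψ : IsUnramifiedAddChar ψ) {π : Representation ℂ F.G V} (hirr : π.IsIrreducible)
    (hadm : F.IsAdmissible π) {Λ : V →ₗ[ℂ] ℂ} (hΛ : F.IsWhittaker ψ π Λ) {v : V}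
    (hv0 : v ≠ 0) (hv : ∀ k ∈ F.K, π k v = v) (ν₁ : ℚ_[p]ˣ →* ℂˣ) (s : ℂ) {h : F.H}
    (hh : ∀ n j : ℕ, h ∉ F.cell (n + j) j) :
    F.zetaIntegrand (F.whittaker π Λ v) (charLattice p) ν₁ s h = 0 := by
  obtain ⟨i, j, hij⟩ := F.exists_mem_cell hp h
  rw [zetaIntegrand, F.charLattice_of_mem_cell hp hij]
  split_ifs with hj
  · rw [F.whittaker_eq_zero_of_mem_cell hp hψ hirr hadm hΛ hv0 hv (lt_of_not_ge fun hle => ?_) hij]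
    · ring
    · lift j to ℕ using hj
      obtain ⟨n, hn⟩ := Int.eq_ofNat_of_zero_le (sub_nonneg.2 hle)
      refine hh n j ?_
      rwa [← hn, sub_add_cancel]
  · ring

/-- The integral part of the torus of `H` in the cells. -/
theorem norm_of_mem_cell (F : RamifiedCompletion p E) (hp : p ≠ 2) {i j : ℤ} {t : F.H}
    (ht : t ∈ F.TH) (h : t ∈ F.cell i j) : (F.diagH i j)⁻¹ * t ∈ F.KH ∧
      ‖F.fstMat t 0 0‖ = ‖F.δ‖ ^ (2 * i) ∧ ‖F.fstMat t 1 1‖ = ‖F.δ‖ ^ (2 * j) := by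
  obtain ⟨i', j', h1, h2⟩ := F.exists_diagH hp ht
  obtain ⟨rfl, rfl⟩ := F.cell_eq hp h (F.mem_cell_of_mem h1)
  exact ⟨h1, h2⟩

theorem charInt_of_mem_cell (F : RamifiedCompletion p E) (hp : p ≠ 2) {i j : ℤ} {t : F.H}
    (ht : t ∈ F.TH) (h : t ∈ F.cell i j) :
    F.charInt (F.iota t) = if 0 ≤ i ∧ 0 ≤ j then 1 else 0 := by
  obtain ⟨-, h1, h2⟩ := F.norm_of_mem_cell hp ht h
  have h3 := F.norm_snd_sq hp t
  rw [F.norm_det₁_of_mem_cell hp h] at h3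
  have e : F.mat (F.iota t) = embMat (F.fstMat t) (t.1.2 : E) := rfl
  rw [charInt, e]
  congr 1
  rw [eq_iff_iff]
  constructor
  · intro h4
    have h5 := h4 0 0
    have h6 := h4 2 2
    simp only [embMat, of_apply, cons_val', cons_val_zero, cons_val_fin_one, cons_val,
      norm_algebraMap', h1, h2, F.norm_δ_zpow_le_one hp] at h5 h6
    omega
  · rintro ⟨hi, hj⟩
    have h5 : ‖F.fstMat t 0 0‖ ≤ 1 := by rw [h1, F.norm_δ_zpow_le_one hp]; omega
    have h6 : ‖F.fstMat t 1 1‖ ≤ 1 := by rw [h2, F.norm_δ_zpow_le_one hp]; omega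
    have h7 : ‖(t.1.2 : E)‖ ≤ 1 := by
      rw [← sq_le_one_iff₀ (norm_nonneg _), h3, F.norm_δ_zpow_le_one hp]; omega
    intro a b
    fin_cases a <;> fin_cases b <;> simp [embMat, ht.1, ht.2, h5, h6, h7]

/-- The torus integrand on the cells which contribute. -/
theorem torusIntegrand_of_mem_cell (F : RamifiedCompletion p E) (hp : p ≠ 2) {ψ : AddChar ℚ_[p] ℂ}
    (hψ : IsUnramifiedAddChar ψ) {π : Representation ℂ F.G V} (hirr : π.IsIrreducible)
    (hadm : F.IsAdmissible π) {Λ : V →ₗ[ℂ] ℂ} (hΛ : F.IsWhittaker ψ π Λ) {v : V}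
    (hv0 : v ≠ 0) (hv : ∀ k ∈ F.K, π k v = v) {η : F.T →* ℂˣ} (hη : F.IsConstituent η π)
    {ν₁ : ℚ_[p]ˣ →* ℂˣ} (hν : ∀ u : ℚ_[p]ˣ, ‖(u : ℚ_[p])‖ = 1 → ν₁ u = 1) (s : ℂ)
    {n j : ℕ} {t : F.TH} (h : (t : F.H) ∈ F.cell (n + j) j) :
    F.torusIntegrand (F.whittaker π Λ v) ν₁ s t =
      sphericalCoeff (F.eta₁ η F.ϖ) n *
        ((ν₁ (pUnit p) : ℂ) * F.eta₂ η F.ϖ * (p : ℂ) ^ (-s)) ^ (n + 2 * j) := by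
  have hpC : (p : ℂ) ≠ 0 := by exact_mod_cast (Fact.out : p.Prime).ne_zero
  have hdet := F.norm_det₁_of_mem_cell hp h
  have e : (n + j + j : ℤ) = ((n + 2 * j : ℕ) : ℤ) := by push_cast; ring
  rw [e] at hdet
  obtain ⟨-, h1, h2⟩ := F.norm_of_mem_cell hp t.2 h
  -- The inverse modulus of `F.TH` cancels the p⁻ⁿ contained in W.
  have h3 : (F.modulusBH t)⁻¹ = (p : ℝ) ^ n := by
    have h4 : 2 * (n + j : ℤ) - 2 * j = ((2 * n : ℕ) : ℤ) := by push_cast; ring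
    rw [modulusBH, norm_div, h1, h2, ← zpow_sub₀ F.norm_δ_pos.ne', h4, zpow_natCast, pow_mul,
      F.norm_δ_sq hp, inv_pow, inv_inv]
  rw [torusIntegrand, similitude_iota, F.charInt_of_mem_cell hp t.2 h, if_pos (by omega),
    F.whittaker_of_mem_cell hp hψ hirr hadm hΛ hv0 hv hη h, F.unramified_apply hp hν hdet,
    F.norm_cpow hp hdet, Units.val_zpow_eq_zpow_val, zpow_natCast, mul_pow, mul_pow, h3]
  push_cast
  field_simp

theorem torusIntegrand_eq_zero (F : RamifiedCompletion p E) (hp : p ≠ 2) {ψ : AddChar ℚ_[p] ℂ}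
    (hψ : IsUnramifiedAddChar ψ) {π : Representation ℂ F.G V} (hirr : π.IsIrreducible)
    (hadm : F.IsAdmissible π) {Λ : V →ₗ[ℂ] ℂ} (hΛ : F.IsWhittaker ψ π Λ) {v : V}
    (hv0 : v ≠ 0) (hv : ∀ k ∈ F.K, π k v = v) (ν₁ : ℚ_[p]ˣ →* ℂˣ) (s : ℂ) {t : F.TH}
    (hh : ∀ n j : ℕ, (t : F.H) ∉ F.cell (n + j) j) :
    F.torusIntegrand (F.whittaker π Λ v) ν₁ s t = 0 := by
  obtain ⟨i, j, hij⟩ := F.exists_mem_cell hp t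
  rw [torusIntegrand, F.charInt_of_mem_cell hp t.2 hij]
  split_ifs with hj
  · rw [F.whittaker_eq_zero_of_mem_cell hp hψ hirr hadm hΛ hv0 hv (lt_of_not_ge fun hle => ?_) hij]
    · ring
    · obtain ⟨m, rfl⟩ := Int.eq_ofNat_of_zero_le hj.2
      obtain ⟨n, hn⟩ := Int.eq_ofNat_of_zero_le (sub_nonneg.2 hle)
      refine hh n m ?_
      rwa [← hn, sub_add_cancel]
  · ring

end Integrands

/-! ### Measures -/

/-- Integration of a function which is constant on the pieces of a countable partition of its
support. -/
theorem integral_eq_of_hasSum {Ω I : Type*} [MeasurableSpace Ω] [Countable I] {μ : Measure Ω}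
    {S : I → Set Ω} (hS : ∀ i, MeasurableSet (S i)) (hd : Pairwise (Function.onFun Disjoint S))
    {f : Ω → ℂ} {c : I → ℂ} (hf : ∀ i, ∀ x ∈ S i, f x = c i)
    (h0 : ∀ x, (∀ i, x ∉ S i) → f x = 0) {m : I → ℝ} (hm0 : ∀ i, 0 ≤ m i)
    (hm : ∀ i, μ (S i) = ENNReal.ofReal (m i)) {A : ℂ} (hs : HasSum (fun i => m i * c i) A) :
    Integrable f μ ∧ ∫ x, f x ∂μ = A := by
  have hr : ∀ i, μ.real (S i) = m i := fun i => by
    rw [Measure.real, hm, ENNReal.toReal_ofReal (hm0 i)]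
  have hi : ∀ i, IntegrableOn f (S i) μ := fun i => by
    rw [integrableOn_congr_fun (hf i) (hS i)]
    exact integrableOn_const (by rw [hm]; exact ENNReal.ofReal_ne_top)
  have hn : ∀ i, ∫ x in S i, ‖f x‖ ∂μ = ‖m i * c i‖ := fun i => by
    rw [setIntegral_congr_fun (hS i) fun x hx => congrArg norm (hf i x hx), setIntegral_const, hr,
      smul_eq_mul, norm_mul, Complex.norm_real, Real.norm_of_nonneg (hm0 i)]
  have hv : ∀ i, ∫ x in S i, f x ∂μ = m i * c i := fun i => by
    rw [setIntegral_congr_fun (hS i) (hf i), setIntegral_const, hr, Complex.real_smul]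
  have h0' : ∀ x, x ∉ ⋃ i, S i → f x = 0 := fun x hx =>
    h0 x fun i hi => hx (Set.mem_iUnion_of_mem i hi)
  have hU : IntegrableOn f (⋃ i, S i) μ :=
    integrableOn_iUnion_of_summable_integral_norm hi (by simpa only [hn] using hs.summable.norm)
  refine ⟨hU.integrable_of_forall_notMem_eq_zero h0', ?_⟩
  have h1 := hasSum_integral_iUnion hS hd hU
  simp only [hv] at h1
  rw [← setIntegral_eq_integral_of_forall_compl_eq_zero h0']
  exact h1.unique hs

theorem continuous_fstMat_apply (F : RamifiedCompletion p E) (i j : Fin 2) :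
    Continuous fun h : F.H => F.fstMat h i j :=
  (Units.continuous_val.comp (continuous_fst.comp continuous_subtype_val)).matrix_elem i j

theorem isOpen_KH (F : RamifiedCompletion p E) (hp : p ≠ 2) : IsOpen (F.KH : Set F.H) := by
  have h : (F.KH : Set F.H) = (⋂ i, ⋂ j, (fun h : F.H => F.fstMat h i j) ⁻¹' Metric.closedBall 0 1) ∩
      (fun h : F.H => (F.fstMat h).det) ⁻¹' Metric.sphere 0 1 := by
    ext h
    simp only [SetLike.mem_coe, F.mem_KH_iff hp, Set.mem_inter_iff, Set.mem_iInter, Set.mem_preimage,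
      mem_closedBall_zero_iff, mem_sphere_zero_iff_norm, val_det₁]
  have hcont : Continuous fun h : F.H => F.fstMat h :=
    Units.continuous_val.comp (continuous_fst.comp continuous_subtype_val)
  rw [h]
  refine IsOpen.inter (isOpen_iInter_of_finite fun i => isOpen_iInter_of_finite fun j => ?_) ?_
  · exact (IsUltrametricDist.isOpen_closedBall _ one_ne_zero).preimage (F.continuous_fstMat_apply i j)
  · exact (IsUltrametricDist.isOpen_sphere _ one_ne_zero).preimage hcont.matrix_det

theorem isOpen_cell (F : RamifiedCompletion p E) (hp : p ≠ 2) (i j : ℤ) : IsOpen (F.cell i j) := by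
  have h : F.cell i j = ⋃ x : ℚ_[p],
      (fun h : F.H => (F.diagH i j)⁻¹ * (F.unip x * h)) ⁻¹' F.KH := by
    ext h
    simp [cell]
  rw [h]
  exact isOpen_iUnion fun x => (F.isOpen_KH hp).preimage
    (continuous_const.mul (continuous_const.mul continuous_id))

theorem unip_mem_KH_iff (F : RamifiedCompletion p E) (hp : p ≠ 2) (x : ℚ_[p]) :
    F.unip x ∈ F.KH ↔ ‖x‖ ≤ 1 := by
  rw [F.mem_KH_iff hp, det₁_unip]
  constructor
  · intro h
    simpa [unip] using h.1 0 1
  · intro h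
    refine ⟨fun i j => ?_, by simp⟩
    fin_cases i <;> fin_cases j <;> simp [unip, h]

theorem diagH_inv_mul_unip (F : RamifiedCompletion p E) (i j : ℤ) (x : ℚ_[p]) :
    (F.diagH i j)⁻¹ * F.unip x = F.unip ((F.D : ℚ_[p]) ^ (j - i) * x) * (F.diagH i j)⁻¹ := by
  have hD : (F.D : ℚ_[p]) ≠ 0 := by exact_mod_cast F.D_ne_zero
  rw [inv_mul_eq_iff_eq_mul, ← mul_assoc, eq_mul_inv_iff_mul_eq]
  refine F.H_ext ?_ ?_
  · rw [fstMat_mul, fstMat_mul]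
    have h : (F.D : ℚ_[p]) ^ i * (F.D : ℚ_[p]) ^ (j - i) = (F.D : ℚ_[p]) ^ j := by
      rw [← zpow_add₀ hD]; congr 1; ring
    ext a b
    fin_cases a <;> fin_cases b <;>
      simp [unip, diagH, Matrix.mul_apply, Fin.sum_univ_two, ← mul_assoc, h, mul_comm x]
  · change (1 : Eˣ) * _ = _ * (1 : Eˣ)
    rw [one_mul, mul_one]

/-- The elements of `U₂` with entry in `pⁿℤ_p`. -/
def unipBall (F : RamifiedCompletion p E) (n : ℕ) : Set F.U₂ :=
  {u | ‖F.fstMat u 0 1‖ ≤ (p : ℝ)⁻¹ ^ n}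

theorem measurableSet_unipBall (F : RamifiedCompletion p E) [MeasurableSpace F.H] [BorelSpace F.H]
    (n : ℕ) : MeasurableSet (F.unipBall n) :=
  (isClosed_le ((F.continuous_fstMat_apply 0 1).comp continuous_subtype_val).norm
    continuous_const).measurableSet

/-- By induction, as pⁿℤ_p is the disjoint union of p translates of pⁿ⁺¹ℤ_p. -/
theorem measure_unipBall (F : RamifiedCompletion p E) (hp : p ≠ 2) [MeasurableSpace F.H]
    [BorelSpace F.H] {du : Measure F.U₂} (hdu : du.IsHaarMeasure)
    (hdu1 : du (F.KH.subgroupOf F.U₂ : Set F.U₂) = 1) (n : ℕ) :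
    du (F.unipBall n) = (p : ℝ≥0∞)⁻¹ ^ n := by
  have hp0 : (p : ℚ_[p]) ≠ 0 := by exact_mod_cast (Fact.out : p.Prime).ne_zero
  have hpR : (0 : ℝ) < (p : ℝ)⁻¹ := inv_pos.2 p_pos
  induction n with
  | zero =>
    rw [pow_zero, ← hdu1]
    congr 1
    ext u
    rw [SetLike.mem_coe, Subgroup.mem_subgroupOf, F.eq_unip u.2, F.unip_mem_KH_iff hp, unipBall,
      Set.mem_ofPred_eq, pow_zero]
  | succ n ih =>
    let τ : ℕ → F.U₂ := fun a => ⟨F.unip (-(a * (p : ℚ_[p]) ^ n)), F.unip_mem _⟩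
    have hτ : ∀ a (u : F.U₂), F.fstMat (τ a * u : F.U₂) 0 1 = F.fstMat u 0 1 - a * (p : ℚ_[p]) ^ n := by
      intro a u
      have h1 : F.fstMat (u : F.H) 1 1 = 1 := u.2.2.2.1
      change F.fstMat (F.unip _ * u) 0 1 = _
      rw [fstMat_mul]
      simp [unip, Matrix.mul_apply, Fin.sum_univ_two, h1, sub_eq_add_neg]
    have hU : F.unipBall n = ⋃ a ∈ Finset.range p, (fun u => τ a * u) ⁻¹' F.unipBall (n + 1) := by
      ext u
      simp only [unipBall, Set.mem_ofPred_eq, Set.mem_iUnion, Set.mem_preimage, hτ, exists_prop,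
        Finset.mem_range]
      constructor
      · intro h
        have h1 : ‖F.fstMat u 0 1 / (p : ℚ_[p]) ^ n‖ ≤ 1 := by
          rw [norm_div, norm_pow, Padic.norm_p]
          exact div_le_one_of_le₀ h (by positivity)
        obtain ⟨a, ha, h2⟩ := F.exists_residue h1
        refine ⟨a, ha, ?_⟩
        have h3 : F.fstMat u 0 1 - a * (p : ℚ_[p]) ^ n =
            (F.fstMat u 0 1 / (p : ℚ_[p]) ^ n - a) * (p : ℚ_[p]) ^ n := by field_simp
        rw [h3, norm_mul, norm_pow, Padic.norm_p, pow_succ, mul_comm]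
        exact mul_le_mul_of_nonneg_left h2 (by positivity)
      · rintro ⟨a, -, h⟩
        have h3 : F.fstMat u 0 1 = (F.fstMat u 0 1 - a * (p : ℚ_[p]) ^ n) + a * (p : ℚ_[p]) ^ n := by
          ring
        rw [h3]
        refine (Padic.nonarchimedean _ _).trans (max_le (h.trans ?_) ?_)
        · exact pow_le_pow_of_le_one hpR.le (inv_le_one_of_one_le₀ one_lt_p.le) n.le_succ
        · rw [norm_mul, norm_pow, Padic.norm_p]
          exact mul_le_of_le_one_left (by positivity) (by exact_mod_cast Padic.norm_int_le_one (a : ℤ))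
    have hmeas : ∀ a, MeasurableSet ((fun u => τ a * u) ⁻¹' F.unipBall (n + 1)) := fun a =>
      (F.measurableSet_unipBall (n + 1)).preimage
        (continuous_const.mul continuous_id : Continuous fun u => τ a * u).measurable
    have hdisj : Set.PairwiseDisjoint (Finset.range p : Set ℕ)
        fun a => (fun u => τ a * u) ⁻¹' F.unipBall (n + 1) := by
      intro a ha b hb hab
      rw [Function.onFun, Set.disjoint_left]
      intro u h1 h2
      apply hab
      simp only [unipBall, Set.mem_preimage, Set.mem_ofPred_eq, hτ] at h1 h2
      refine F.norm_natCast_sub_le (Finset.mem_range.1 ha) (Finset.mem_range.1 hb) ?_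
      have h3 : ((a : ℚ_[p]) - b) * (p : ℚ_[p]) ^ n =
          (F.fstMat u 0 1 - b * (p : ℚ_[p]) ^ n) + -(F.fstMat u 0 1 - a * (p : ℚ_[p]) ^ n) := by ring
      have h4 : ‖((a : ℚ_[p]) - b) * (p : ℚ_[p]) ^ n‖ ≤ (p : ℝ)⁻¹ ^ (n + 1) := by
        rw [h3]
        exact (Padic.nonarchimedean _ _).trans (max_le h2 (by rwa [norm_neg]))
      rw [norm_mul, norm_pow, Padic.norm_p, pow_succ, mul_comm] at h4
      exact (le_of_mul_le_mul_left h4 (by positivity)).trans_lt (inv_lt_one_of_one_lt₀ one_lt_p)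
    rw [hU, measure_biUnion_finset hdisj fun a _ => hmeas a,
      Finset.sum_congr rfl fun a _ => measure_preimage_mul du (τ a) _, Finset.sum_const,
      Finset.card_range, nsmul_eq_mul] at ih
    have hpE : (p : ℝ≥0∞) ≠ 0 := by exact_mod_cast (Fact.out : p.Prime).ne_zero
    rw [pow_succ, ← ih, mul_comm (p : ℝ≥0∞), mul_assoc,
      ENNReal.mul_inv_cancel hpE (ENNReal.natCast_ne_top p), mul_one]

/-- The image of a cell in `U₂\H`. -/
def cellQuot (F : RamifiedCompletion p E) (i j : ℤ) : Set (Quotient (QuotientGroup.rightRel F.U₂)) :=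
  {q | q.out ∈ F.cell i j}

/-- Cells are stable under U₂, so the chosen representative does not matter, and measurability in
the quotient follows from openness of cells. -/
theorem preimage_cellQuot (F : RamifiedCompletion p E) (i j : ℤ) :
    (Quotient.mk'' : F.H → Quotient (QuotientGroup.rightRel F.U₂)) ⁻¹' F.cellQuot i j =
      F.cell i j := by
  ext h
  have h1 : QuotientGroup.rightRel F.U₂
      (Quotient.out (Quotient.mk'' h : Quotient (QuotientGroup.rightRel F.U₂))) h :=
    Quotient.mk_out h
  rw [QuotientGroup.rightRel_apply] at h1
  have h2 : h = F.unip _ *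
      Quotient.out (Quotient.mk'' h : Quotient (QuotientGroup.rightRel F.U₂)) :=
    eq_mul_of_mul_inv_eq (F.eq_unip h1)
  change Quotient.out (Quotient.mk'' h : Quotient (QuotientGroup.rightRel F.U₂)) ∈ F.cell i j ↔ _
  conv_rhs => rw [h2]
  rw [unip_mul_mem_cell]

theorem measurableSet_cellQuot (F : RamifiedCompletion p E) (hp : p ≠ 2) [MeasurableSpace F.H]
    [BorelSpace F.H] (i j : ℤ) : MeasurableSet (F.cellQuot i j) := by
  rw [measurableSet_quotient, preimage_cellQuot]
  exact (F.isOpen_cell hp i j).measurableSet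

/-- The volume of the image of a cell in `U₂\H`. -/
theorem measure_cellQuot (F : RamifiedCompletion p E) (hp : p ≠ 2) [MeasurableSpace F.H]
    [BorelSpace F.H] {dh : Measure F.H} (hdh : dh.IsHaarMeasure) (hdh1 : dh (F.KH : Set F.H) = 1)
    {du : Measure F.U₂} (hdu : du.IsHaarMeasure)
    (hdu1 : du (F.KH.subgroupOf F.U₂ : Set F.U₂) = 1)
    {dq : Measure (Quotient (QuotientGroup.rightRel F.U₂))}
    (hdq : IsQuotientMeasure F.U₂ dh du dq) (n : ℕ) (j : ℤ) :
    dq (F.cellQuot (n + j) j) = ENNReal.ofReal ((p : ℝ) ^ n) := by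
  let t := F.diagH (n + j) j
  let A : Set F.H := (fun h => t⁻¹ * h) ⁻¹' F.KH
  have hA : MeasurableSet A := ((F.isOpen_KH hp).preimage
    (continuous_const.mul continuous_id)).measurableSet
  -- The defining identity of the quotient measure is tested on the indicator of tH(ℤ_p), which has
  -- volume 1.
  have h1 := hdq (A.indicator 1) (measurable_one.indicator hA)
  rw [lintegral_indicator_one hA, measure_preimage_mul, hdh1] at h1
  -- Over a point of the cell, the u that land in tH(ℤ_p) form a translate of t(U₂ ∩ H(ℤ_p))t⁻¹.
  -- This is pⁿℤ_p, of volume p⁻ⁿ.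
  have h2 : ∀ q : Quotient (QuotientGroup.rightRel F.U₂),
      ∫⁻ u : F.U₂, A.indicator 1 ((u : F.H) * q.out) ∂du =
        (F.cellQuot (n + j) j).indicator (fun _ => (p : ℝ≥0∞)⁻¹ ^ n) q := by
    intro q
    have hB : MeasurableSet ((fun u : F.U₂ => (u : F.H) * q.out) ⁻¹' A) :=
      hA.preimage (continuous_subtype_val.mul continuous_const).measurable
    have h3 : ∀ u : F.U₂, A.indicator (1 : F.H → ℝ≥0∞) ((u : F.H) * q.out) =
        ((fun u : F.U₂ => (u : F.H) * q.out) ⁻¹' A).indicator 1 u := fun u => rfl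
    rw [lintegral_congr h3, lintegral_indicator_one hB]
    by_cases hq : q ∈ F.cellQuot (n + j) j
    · rw [Set.indicator_of_mem hq, ← F.measure_unipBall hp hdu hdu1]
      obtain ⟨x, hx⟩ := hq
      rw [← measure_preimage_mul du ⟨F.unip (-x), F.unip_mem _⟩ (F.unipBall n)]
      congr 1
      ext u
      obtain ⟨y, hy⟩ : ∃ y, (u : F.H) = F.unip y := ⟨_, F.eq_unip u.2⟩
      change t⁻¹ * ((u : F.H) * q.out) ∈ F.KH ↔ ‖F.fstMat (F.unip (-x) * u) 0 1‖ ≤ _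
      have h4 : t⁻¹ * (F.unip y * q.out) =
          F.unip ((F.D : ℚ_[p]) ^ (j - (n + j)) * (-x + y)) * (t⁻¹ * (F.unip x * q.out)) := by
        rw [← mul_assoc _ t⁻¹, ← diagH_inv_mul_unip, mul_assoc, ← mul_assoc (F.unip _), unip_mul]
        congr 3
        ring
      have h5 : F.fstMat (F.unip (-x + y)) 0 1 = -x + y := by simp [unip]
      rw [hy, h4, Subgroup.mul_mem_cancel_right _ hx, F.unip_mem_KH_iff hp, unip_mul, h5, norm_mul,
        F.norm_D_zpow hp, show 2 * (j - (n + j)) = -((2 * n : ℕ) : ℤ) by push_cast; ring,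
        _root_.zpow_neg, zpow_natCast, pow_mul, F.norm_δ_sq hp, inv_mul_le_one₀]
      have := p_pos (p := p)
      positivity
    · rw [Set.indicator_of_notMem hq]
      refine (congrArg du ?_).trans measure_empty
      rw [Set.eq_empty_iff_forall_notMem]
      intro u hu
      refine hq ⟨F.fstMat u 0 1, ?_⟩
      rw [← F.eq_unip u.2]
      exact hu
  rw [lintegral_congr h2, lintegral_indicator_const (F.measurableSet_cellQuot hp _ _)] at h1
  have hpE : (p : ℝ≥0∞) ≠ 0 := by exact_mod_cast (Fact.out : p.Prime).ne_zero
  have h6 : (p : ℝ≥0∞) ^ n * (p : ℝ≥0∞)⁻¹ ^ n = 1 := by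
    rw [← mul_pow, ENNReal.mul_inv_cancel hpE (ENNReal.natCast_ne_top p), one_pow]
  rw [ENNReal.ofReal_pow p_pos.le, ENNReal.ofReal_natCast]
  calc dq (F.cellQuot (n + j) j)
      = (p : ℝ≥0∞) ^ n * ((p : ℝ≥0∞)⁻¹ ^ n * dq (F.cellQuot (n + j) j)) := by
        rw [← mul_assoc, h6, one_mul]
    _ = (p : ℝ≥0∞) ^ n := by rw [← h1, mul_one]

/-- The volume of the part of `T_H` in a cell. -/
theorem measure_cell_torus (F : RamifiedCompletion p E) (hp : p ≠ 2) [MeasurableSpace F.H]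
    [BorelSpace F.H] {dt : Measure F.TH} (hdt : dt.IsHaarMeasure)
    (hdt1 : dt (F.KH.subgroupOf F.TH : Set F.TH) = 1) (i j : ℤ) :
    dt {t : F.TH | (t : F.H) ∈ F.cell i j} = 1 := by
  let τ : F.TH := ⟨(F.diagH i j)⁻¹, inv_mem (F.diagH_mem i j)⟩
  have h : {t : F.TH | (t : F.H) ∈ F.cell i j} = (fun t => τ * t) ⁻¹' (F.KH.subgroupOf F.TH) := by
    ext t
    change _ ↔ (F.diagH i j)⁻¹ * (t : F.H) ∈ F.KH
    exact ⟨fun h => (F.norm_of_mem_cell hp t.2 h).1, fun h => F.mem_cell_of_mem h⟩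
  rw [h, measure_preimage_mul, hdt1]

theorem cell_pairwise_disjoint (F : RamifiedCompletion p E) (hp : p ≠ 2) {x y : ℕ × ℕ} (hxy : x ≠ y)
    {h : F.H} (h1 : h ∈ F.cell (x.1 + x.2) x.2) (h2 : h ∈ F.cell (y.1 + y.2) y.2) : False := by
  have := F.cell_eq hp h1 h2
  exact hxy (Prod.ext (by omega) (by omega))

/-! ### The `L`-factor -/

theorem mem_inertialInvariants_iff (v : Fin 3 ⊕ Fin 3 → ℂ) :
    v ∈ inertialInvariants ↔ ∀ i, v (Sum.inl i) = v (Sum.inr i) := by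
  have h : (stdRep (SemidirectProduct.inr (-1))).val = fromBlocks 0 1 1 0 := by
    rw [stdRep, SemidirectProduct.lift_inr]
    rfl
  change (stdRep (SemidirectProduct.inr (-1))).val *ᵥ v = v ↔ _
  rw [h, fromBlocks_mulVec]
  constructor
  · intro h1 i
    simpa using (congrFun h1 (Sum.inl i)).symm
  · intro h1
    funext i
    rcases i with i | i <;> simp [h1]

/-- The inertial invariants are the diagonal copy of `ℂ³`. -/
def invariantsEquiv : inertialInvariants ≃ₗ[ℂ] (Fin 3 → ℂ) where
  toFun v i := v.1 (Sum.inl i)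
  invFun w := ⟨Sum.elim w w, (mem_inertialInvariants_iff _).2 fun _ => rfl⟩
  map_add' _ _ := rfl
  map_smul' _ _ := rfl
  left_inv v := by
    apply Subtype.ext
    funext i
    rcases i with i | i
    · rfl
    · exact (mem_inertialInvariants_iff _).1 v.2 i
  right_inv _ := rfl

/-- An invariant vector is read off from its first three coordinates, so only the upper left block
is computed and the lower one stays unspecified. -/
theorem frobOnInvariants_apply (x : ℂˣ) (d : Fin 3 → ℂˣ)
    (hs : galAction (-1) (x, diagGL d) = (x, diagGL d)) (v : inertialInvariants) (i : Fin 3) :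
    invariantsEquiv (frobOnInvariants (x, diagGL d) hs v) i = x * d i * invariantsEquiv v i := by
  have h : ∃ N : Matrix (Fin 3) (Fin 3) ℂ, (stdRep (SemidirectProduct.inl (x, diagGL d))).val =
      fromBlocks (diagonal fun i => (x * d i : ℂ)) 0 0 N := by
    rw [stdRep, SemidirectProduct.lift_inl]
    refine ⟨(scalarGL (x * Matrix.GeneralLinearGroup.det (diagGL d)) *
      (Phi₃ * invTranspose (diagGL d) * Phi₃⁻¹)).val, ?_⟩
    change fromBlocks (scalarGL x * diagGL d).val 0 0 _ = _
    congr 1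
    change Matrix.scalar (Fin 3) (x : ℂ) * diagonal _ = _
    rw [Matrix.scalar_apply, diagonal_mul_diagonal]
  obtain ⟨N, hN⟩ := h
  change ((stdRep (SemidirectProduct.inl (x, diagGL d))).val *ᵥ v.1) (Sum.inl i) =
    x * d i * v.1 (Sum.inl i)
  rw [hN, fromBlocks_mulVec]
  simp [mulVec_diagonal]

theorem det_frobOnInvariants (x : ℂˣ) (d : Fin 3 → ℂˣ)
    (hs : galAction (-1) (x, diagGL d) = (x, diagGL d)) (c : ℂ) :
    LinearMap.det (1 - c • frobOnInvariants (x, diagGL d) hs) = ∏ i, (1 - c * (x * d i)) := by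
  have h : invariantsEquiv.toLinearMap ∘ₗ (1 - c • frobOnInvariants (x, diagGL d) hs) ∘ₗ
      invariantsEquiv.symm.toLinearMap = Matrix.toLin' (diagonal fun i => 1 - c * (x * d i : ℂ)) := by
    ext j i
    have h1 := frobOnInvariants_apply x d hs (invariantsEquiv.symm (Pi.single j 1)) i
    rw [LinearEquiv.apply_symm_apply] at h1
    simp only [LinearMap.comp_apply, LinearMap.sub_apply, Module.End.one_apply, LinearMap.smul_apply,
      LinearEquiv.coe_coe, map_sub, map_smul, LinearEquiv.apply_symm_apply, Pi.sub_apply,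
      Pi.smul_apply, LinearMap.single_apply, h1, smul_eq_mul, Matrix.toLin'_apply, mulVec_diagonal]
    ring
  rw [← LinearMap.det_conj _ invariantsEquiv, h, LinearMap.det_toLin', det_diagonal]

/-- The parameter attached to an unramified character of `T`. -/
theorem satake_eq (F : RamifiedCompletion p E) {η : F.T →* ℂˣ} (hη : F.IsUnramified η) :
    F.satake η = (F.eta₂ η F.ϖ, diagGL ![F.eta₁ η F.ϖ, 1, (F.eta₁ η F.ϖ)⁻¹]) := by
  have hne : ‖F.δ‖ ≠ 0 := F.norm_δ_pos.ne'
  have h1 : η (F.torusElt (F.conjU F.ϖ) (F.conjU F.ϖ) (F.conjU F.ϖ) rfl) = F.eta₂ η F.ϖ := by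
    -- Conjugation sends ϖ to -ϖ, and the scalar -1 lies in K, where η is trivial.
    have h2 : F.torusElt (F.conjU F.ϖ) (F.conjU F.ϖ) (F.conjU F.ϖ) rfl =
        F.torusElt F.ϖ F.ϖ F.ϖ rfl * F.torusElt (-1) (-1) (-1) rfl := by
      rw [torusElt_mul]
      congr 1 <;> ext1 <;> simp [ϖ, F.conj_δ]
    have h3 : η (F.torusElt (-1) (-1) (-1) rfl) = 1 :=
      hη _ (F.torusElt_mem_K _ _ _ _ (by simp) (by simp) (by simp))
    rw [h2, map_mul, h3, mul_one]
    rfl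
  have h2 : η (F.torusElt 1 (F.ϖ / F.conjU F.ϖ) 1 (by
      ext1; simp [ϖ, F.conj_δ, F.δ_ne_zero])) = 1 :=
    hη _ (F.torusElt_mem_K _ _ _ _ (by simp) (by simp [ϖ, F.conj_δ, hne]) (by simp))
  have h3 : η (F.torusElt (F.conjU F.ϖ)⁻¹ 1 F.ϖ (by
      ext1; simp [F.conj_conj, ϖ, F.δ_ne_zero])) = (F.eta₁ η F.ϖ)⁻¹ := by
    rw [eq_inv_iff_mul_eq_one, eta₁, ← map_mul, torusElt_mul]
    exact hη _ (F.torusElt_mem_K _ _ _ _ (by simp [ϖ, F.conj_δ, hne]) (by simp)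
      (by simp [ϖ, F.conj_δ, hne]))
  rw [satake, h1, h2, h3]
  rfl

theorem eulerFactor_eq_langlandsLFactor (F : RamifiedCompletion p E) {η : F.T →* ℂˣ}
    (hη : F.IsUnramified η) {ν₁ : ℚ_[p]ˣ →* ℂˣ} {α : ℂ} (hα : α ^ 2 = ν₁ (pUnit p)) (s : ℂ) :
    F.eulerFactor η α s = F.langlandsLFactor η hη ν₁ s := by
  -- The proof of Galois invariance depends on the parameter, so the parameter is replaced together
  -- with that proof.
  have h : ∀ (y : DualConn) (hy : galAction (-1) y = y), y = F.satake η →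
      LinearMap.det (1 - ((p : ℂ) ^ (-s) * (ν₁ (pUnit p) : ℂ)) •
        frobOnInvariants (F.satake η) (F.galAction_satake η hη)) =
      LinearMap.det (1 - ((p : ℂ) ^ (-s) * (ν₁ (pUnit p) : ℂ)) • frobOnInvariants y hy) := by
    rintro y hy rfl
    rfl
  have hs := F.galAction_satake η hη
  rw [F.satake_eq hη] at hs
  rw [langlandsLFactor, h _ hs (F.satake_eq hη).symm, det_frobOnInvariants, Fin.prod_univ_three,
    eulerFactor, one_div, ← hα]
  simp only [cons_val_zero, cons_val_one, cons_val, Units.val_one, Units.val_inv_eq_inv_val]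
  congr 1
  ring

end RamifiedCompletion

end GU21

end

/-! ### Summation over the cells -/

open GU21 in
theorem mainTheorem8 (p : ℕ) [Fact p.Prime] (hp : p ≠ 2)
    (E : Type*) [NormedField E] [NormedAlgebra ℚ_[p] E] (F : RamifiedCompletion p E)
    (ψ : AddChar ℚ_[p] ℂ) (hψ : IsUnramifiedAddChar ψ)
    (V : Type*) [AddCommGroup V] [Module ℂ V] (π : Representation ℂ F.G V)
    (hirr : π.IsIrreducible) (hadm : F.IsAdmissible π)
    (Λ : V →ₗ[ℂ] ℂ) (hΛ : F.IsWhittaker ψ π Λ)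
    (v : V) (hv0 : v ≠ 0) (hv : ∀ k ∈ F.K, π k v = v)
    [MeasurableSpace F.H] [BorelSpace F.H]
    (dh : Measure F.H) (hdh : dh.IsHaarMeasure) (hdh1 : dh (F.KH : Set F.H) = 1)
    (du : Measure F.U₂) (hdu : du.IsHaarMeasure) (hdu1 : du (F.KH.subgroupOf F.U₂ : Set F.U₂) = 1)
    (dt : Measure F.TH) (hdt : dt.IsHaarMeasure) (hdt1 : dt (F.KH.subgroupOf F.TH : Set F.TH) = 1)
    (dq : Measure (Quotient (QuotientGroup.rightRel F.U₂)))
    (hdq : IsQuotientMeasure F.U₂ dh du dq) :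
    Λ v ≠ 0 ∧
    ∀ (η : F.T →* ℂˣ) (hη : F.IsUnramified η), F.IsConstituent η π →
    ∀ ν₁ : ℚ_[p]ˣ →* ℂˣ, (∀ u : ℚ_[p]ˣ, ‖(u : ℚ_[p])‖ = 1 → ν₁ u = 1) →
    ∀ α : ℂ, α ^ 2 = ν₁ (pUnit p) →
    ∀ s : ℂ, ‖α ^ 2 * F.eta₁ η F.ϖ * F.eta₂ η F.ϖ * (p : ℂ) ^ (-s)‖ < 1 →
      ‖α ^ 2 * (F.eta₁ η F.ϖ : ℂ)⁻¹ * F.eta₂ η F.ϖ * (p : ℂ) ^ (-s)‖ < 1 →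
      (Integrable (F.torusIntegrand (F.whittaker π Λ v) ν₁ s) dt ∧
        ∫ t, F.torusIntegrand (F.whittaker π Λ v) ν₁ s t ∂dt = F.eulerFactor η α s) ∧
      (Integrable (fun q => F.zetaIntegrand (F.whittaker π Λ v) (charLattice p) ν₁ s q.out) dq ∧
        ∫ q, F.zetaIntegrand (F.whittaker π Λ v) (charLattice p) ν₁ s q.out ∂dq =
          F.eulerFactor η α s) ∧
      F.eulerFactor η α s = F.langlandsLFactor η hη ν₁ s := by
  refine ⟨F.whittaker_apply_ne_zero hp hψ hirr hadm hΛ hv0 hv, ?_⟩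
  intro η hη hπ ν₁ hν α hα s h1 h2
  set a : ℂ := ((F.eta₁ η F.ϖ : ℂˣ) : ℂ) with ha
  set X : ℂ := (ν₁ (pUnit p) : ℂ) * (F.eta₂ η F.ϖ : ℂˣ) * (p : ℂ) ^ (-s) with hX
  have ha0 : a ≠ 0 := (F.eta₁ η F.ϖ).ne_zero
  have e1 : α ^ 2 * a * F.eta₂ η F.ϖ * (p : ℂ) ^ (-s) = a * X := by rw [hX, hα]; ring
  have e2 : α ^ 2 * a⁻¹ * F.eta₂ η F.ϖ * (p : ℂ) ^ (-s) = a⁻¹ * X := by rw [hX, hα]; ring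
  have e3 : α ^ 2 * F.eta₂ η F.ϖ * (p : ℂ) ^ (-s) = X := by rw [hX, hα]
  have hE : F.eulerFactor η α s = 1 / ((1 - a * X) * (1 - X) * (1 - a⁻¹ * X)) := by
    rw [RamifiedCompletion.eulerFactor, ← ha, e1, e2, e3]
  rw [e1] at h1
  rw [e2] at h2
  have hsum := RamifiedCompletion.hasSum_sphericalCoeff_mul ha0 h1 h2
  refine ⟨?_, ?_, F.eulerFactor_eq_langlandsLFactor hη hα s⟩
  · rw [hE]
    refine RamifiedCompletion.integral_eq_of_hasSum
      (S := fun x : ℕ × ℕ => {t : F.TH | (t : F.H) ∈ F.cell (x.1 + x.2) x.2})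
      (c := fun x => RamifiedCompletion.sphericalCoeff a x.1 * X ^ (x.1 + 2 * x.2))
      -- Each cell meets `F.TH` in a coset of its integral points, of volume 1.
      (m := fun _ => 1) (fun x => ?_) (fun x y hxy => ?_) (fun x t ht => ?_) (fun t ht => ?_)
      (fun _ => zero_le_one) (fun x => ?_) ?_
    · exact ((F.isOpen_cell hp _ _).preimage continuous_subtype_val).measurableSet
    · exact Set.disjoint_left.2 fun t => F.cell_pairwise_disjoint hp hxy
    · exact F.torusIntegrand_of_mem_cell hp hψ hirr hadm hΛ hv0 hv hπ hν s ht
    · exact F.torusIntegrand_eq_zero hp hψ hirr hadm hΛ hv0 hv ν₁ s fun n j => ht (n, j)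
    · rw [F.measure_cell_torus hp hdt hdt1, ENNReal.ofReal_one]
    · simpa only [Complex.ofReal_one, one_mul] using hsum
  · rw [hE]
    have hpC : (p : ℂ) ≠ 0 := by exact_mod_cast (Fact.out : p.Prime).ne_zero
    refine RamifiedCompletion.integral_eq_of_hasSum
      (S := fun x : ℕ × ℕ => F.cellQuot (x.1 + x.2) x.2)
      (c := fun x => ((p : ℂ) ^ x.1)⁻¹ *
        (RamifiedCompletion.sphericalCoeff a x.1 * X ^ (x.1 + 2 * x.2)))
      -- The volume of the cell in U₂\H. It cancels the factor p⁻ⁿ of the integrand, which leaves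
      -- the same series as for the torus integral.
      (m := fun x => (p : ℝ) ^ x.1) (fun x => ?_) (fun x y hxy => ?_) (fun x q hq => ?_)
      (fun q hq => ?_) (fun x => by positivity) (fun x => ?_) ?_
    · exact F.measurableSet_cellQuot hp _ _
    · exact Set.disjoint_left.2 fun q => F.cell_pairwise_disjoint hp hxy
    · exact F.zetaIntegrand_of_mem_cell hp hψ hirr hadm hΛ hv0 hv hπ hν s hq
    · exact F.zetaIntegrand_eq_zero hp hψ hirr hadm hΛ hv0 hv ν₁ s fun n j => hq (n, j)
    · exact F.measure_cellQuot hp hdh hdh1 hdu hdu1 hdq _ _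
    · have h3 : ∀ x : ℕ × ℕ, (((p : ℝ) ^ x.1 : ℝ) : ℂ) * (((p : ℂ) ^ x.1)⁻¹ *
          (RamifiedCompletion.sphericalCoeff a x.1 * X ^ (x.1 + 2 * x.2))) =
          RamifiedCompletion.sphericalCoeff a x.1 * X ^ (x.1 + 2 * x.2) := fun x => by
        rw [Complex.ofReal_pow, Complex.ofReal_natCast, mul_inv_cancel_left₀ (pow_ne_zero _ hpC)]
      simpa only [h3] using hsum
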